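/- Let $G$ be a reductive algebraic group over $\mathbb{Q}$ (an affine group scheme of finite type, not necessarily connected, all of whose finite-dimensional representations are completely reducible). A cdga over $G$ is a complex $A=\bigoplus_{n\in\mathbb{Z}}A^n$ of algebraic (possibly infinite-dimensional) $G$-representations over $\mathbb{Q}$ with a $G$-equivariant, unital, associative, graded commutative multiplication satisfying the Leibniz rule $d(ab)=da\cdot b+(-1)^{\deg a}a\cdot db$. A dg $A$-module over $G$ is a complex $M$ of $G$-representations with a $G$-equivariant, degree-preserving, unital and associative action $A\otimes M\to M$ satisfying $d(am)=da\cdot m+(-1)^{\deg a}a\cdot dm$; morphisms are the $G$-equivariant $A$-linear chain maps. The homotopy category $\mathcal{K}_A^G$ has the dg $A$-modules over $G$ as objects and as morphisms the morphisms of dg $A$-modules modulo homotopy, where $f\sim g$ if $f-g=dh+hd$ for a $G$-equivariant linear map $h$ of degree $-1$ with $h(am)=(-1)^{\deg a}a\,h(m)$. It is triangulated: the shift is $M[1]^n=M^{n+1}$ with differential $-d$, and the distinguished triangles are those isomorphic to a cone sequence $M\xrightarrow{f}N\to \mathrm{Cone}(f)\to M[1]$, where $\mathrm{Cone}(f)^n=N^n\oplus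 M^{n+1}$ and $d(n,m)=(dn+f(m),-dm)$. The derived category $\mathcal{D}_A^G$ is the localization of $\mathcal{K}_A^G$ at the morphisms inducing an isomorphism on cohomology, with the induced triangulated structure. A cell module is a dg $A$-module $M$ for which there are a set $J$ and, for each $j\in J$, an integer $n_j$, a finite-dimensional $G$-representation $V_j$ and a $G$-equivariant linear map $b_j:V_j\to M^{n_j}$ such that the map $\bigoplus_{j\in J}A[-n_j]\otimes V_j\to M$, $a\otimes v\mapsto a\,b_j(v)$, is bijective, together with a filtration $\emptyset=J_{-1}\subset J_0\subset J_1\subset\cdots$ of $J$ with $J=\bigcup_k J_k$ such that, for $j\in J_k$ and $v\in V_j$, the element $d(b_j(v))$ lies in $\sum_{i\in J_{k-1}}A\cdot b_i(V_i)$. It is a finite cell module if one can take $J$ finite. Let $\mathcal{KCM}_A^G$ and $\mathcal{KCM}_A^{G,f}$ be the full subcategories of $\mathcal{K}_A^G$ of cell modules and of finite cell modules, and let $\mathcal{D}_A^{G,f}$ be the full subcategory of $\mathcal{D}_A^G$ of the objects isomorphic in $\mathcal{D}_A^G$ to a finite cell module. Theorem. For every cdga $A$ over $G$: 1. $\mathcal{KCM}_A^G$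 is a triangulated subcategory of $\mathcal{K}_A^G$, and the localization functor restricts to an equivalence of triangulated categories $\mathcal{KCM}_A^G\to\mathcal{D}_A^G$; 2. $\mathcal{KCM}_A^{G,f}$ and $\mathcal{D}_A^{G,f}$ are triangulated subcategories of $\mathcal{K}_A^G$ and $\mathcal{D}_A^G$, and the localization functor restricts to an equivalence of triangulated categories $\mathcal{KCM}_A^{G,f}\to\mathcal{D}_A^{G,f}$. (Here a triangulated subcategory is a full subcategory that contains a zero object, is stable under all shifts and, up to isomorphism, under extensions; an equivalence of triangulated categories is an exact functor that is an equivalence.) -/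

import Mathlib

open CategoryTheory CategoryTheory.Limits CategoryTheory.Pretriangulated
open scoped TensorProduct

universe u

namespace RepDG

/-! ### Algebraic representations of an affine group scheme `G = Spec H` over `ℚ` -/

section Reps

variable {H : Type u} [CommRing H] [HopfAlgebra ℚ H]
variable {V W U : Type u} [AddCommGroup V] [Module ℚ V] [AddCommGroup W] [Module ℚ W]
  [AddCommGroup U] [Module ℚ U]

/-- A (linear, possibly infinite-dimensional) representation of `G = Spec H` on the rational vector
space `V` is a right `H`-comodule structure on `V`: a coassociative and counital linear map
`ρ : V → V ⊗ H`. -/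
structure IsCoaction (ρ : V →ₗ[ℚ] V ⊗[ℚ] H) : Prop where
  coassoc : (TensorProduct.assoc ℚ V H H).toLinearMap ∘ₗ ρ.rTensor H ∘ₗ ρ =
    (Coalgebra.comul (R := ℚ) (A := H)).lTensor V ∘ₗ ρ
  counit : ∀ v, (Coalgebra.counit (R := ℚ) (A := H)).lTensor V (ρ v) = v ⊗ₜ[ℚ] (1 : ℚ)

/-- `G`-equivariance of a linear map. -/
def IsEquivariant (ρV : V →ₗ[ℚ] V ⊗[ℚ] H) (ρW : W →ₗ[ℚ] W ⊗[ℚ] H) (f : V →ₗ[ℚ] W) : Prop :=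
  ∀ v, ρW (f v) = f.rTensor H (ρV v)

/-- `G`-equivariance of a bilinear map `β : V × W → U`, that is, of the linear map `V ⊗ W → U`
for the tensor product representation `v ⊗ w ↦ ∑ (v₀ ⊗ w₀) ⊗ v₁ w₁`. Here
`TensorProduct.map₂ β (LinearMap.mul ℚ H)` sends `(v ⊗ h, w ⊗ k)` to `β v w ⊗ h k`. -/
def IsEquivariant₂ (ρV : V →ₗ[ℚ] V ⊗[ℚ] H) (ρW : W →ₗ[ℚ] W ⊗[ℚ] H) (ρU : U →ₗ[ℚ] U ⊗[ℚ] H)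
    (β : V →ₗ[ℚ] W →ₗ[ℚ] U) : Prop :=
  ∀ v w, ρU (β v w) = TensorProduct.map₂ β (LinearMap.mul ℚ H) (ρV v) (ρW w)

/-- The subspace `S` is a subrepresentation: `ρ(S) ⊆ S ⊗ H`. -/
def IsSubrep (ρ : V →ₗ[ℚ] V ⊗[ℚ] H) (S : Submodule ℚ V) : Prop :=
  ∀ v ∈ S, ρ v ∈ LinearMap.range (S.subtype.rTensor H)

end Reps

/-- The affine group scheme `G = Spec H` over `ℚ` is a reductive algebraic group: it is of finite
type and, the base field having characteristic zero, every finite-dimensional representation of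
`G` is completely reducible. (`G` need not be connected.) -/
structure IsReductive (H : Type u) [CommRing H] [HopfAlgebra ℚ H] : Prop where
  finiteType : Algebra.FiniteType ℚ H
  completelyReducible : ∀ (V : Type u) [AddCommGroup V] [Module ℚ V] [Module.Finite ℚ V]
    (ρ : V →ₗ[ℚ] V ⊗[ℚ] H), IsCoaction ρ → ∀ S : Submodule ℚ V, IsSubrep ρ S →
      ∃ T : Submodule ℚ V, IsSubrep ρ T ∧ IsCompl S T

/-! ### Commutative differential graded algebras over `G` and their dg modules -/

/-- A cdga over `G = Spec H`: a complex `A = ⨁ₙ Aⁿ` of `G`-representations (differential of degree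
`+1`) with a `G`-equivariant, unital, associative, graded commutative multiplication which satisfies
the Leibniz rule. -/
structure Cdga (H : Type u) [CommRing H] [HopfAlgebra ℚ H] where
  carrier : Type u
  [ring : Ring carrier]
  [algebra : Algebra ℚ carrier]
  /-- the cohomological grading -/
  deg : ℤ → Submodule ℚ carrier
  [graded : GradedAlgebra deg]
  /-- the representation of `G` -/
  coact : carrier →ₗ[ℚ] carrier ⊗[ℚ] H
  isCoaction : IsCoaction coact
  isSubrep_deg : ∀ n, IsSubrep coact (deg n)
  coact_one : coact 1 = 1 ⊗ₜ[ℚ] 1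
  mul_equivariant : IsEquivariant₂ coact coact coact (LinearMap.mul ℚ carrier)
  graded_comm : ∀ p q : ℤ, ∀ a ∈ deg p, ∀ b ∈ deg q, a * b = (-1 : ℚ) ^ (p * q) • (b * a)
  /-- the differential -/
  d : carrier →ₗ[ℚ] carrier
  d_equivariant : IsEquivariant coact coact d
  d_deg : ∀ n, ∀ a ∈ deg n, d a ∈ deg (n + 1)
  d_d : ∀ a, d (d a) = 0
  leibniz : ∀ p : ℤ, ∀ a ∈ deg p, ∀ b, d (a * b) = d a * b + (-1 : ℚ) ^ p • (a * d b)

attribute [instance] Cdga.ring Cdga.algebra Cdga.graded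

variable {H : Type u} [CommRing H] [HopfAlgebra ℚ H]

/-- A dg `A`-module over `G`: a complex `M = ⨁ₙ Mⁿ` of `G`-representations with a `G`-equivariant,
degree-preserving, unital and associative action of `A` which satisfies the Leibniz rule. -/
structure DGModule (A : Cdga H) where
  carrier : Type u
  [addCommGroup : AddCommGroup carrier]
  [module : Module ℚ carrier]
  /-- the cohomological grading -/
  deg : ℤ → Submodule ℚ carrier
  isInternal : DirectSum.IsInternal deg
  /-- the representation of `G` -/
  coact : carrier →ₗ[ℚ] carrier ⊗[ℚ] H
  isCoaction : IsCoaction coact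
  isSubrep_deg : ∀ n, IsSubrep coact (deg n)
  /-- the action of `A` -/
  act : A.carrier →ₗ[ℚ] carrier →ₗ[ℚ] carrier
  act_equivariant : IsEquivariant₂ A.coact coact coact act
  act_deg : ∀ p q : ℤ, ∀ a ∈ A.deg p, ∀ m ∈ deg q, act a m ∈ deg (p + q)
  one_act : ∀ m, act 1 m = m
  mul_act : ∀ a b m, act (a * b) m = act a (act b m)
  /-- the differential -/
  d : carrier →ₗ[ℚ] carrier
  d_equivariant : IsEquivariant coact coact d
  d_deg : ∀ n, ∀ m ∈ deg n, d m ∈ deg (n + 1)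
  d_d : ∀ m, d (d m) = 0
  leibniz : ∀ p : ℤ, ∀ a ∈ A.deg p, ∀ m, d (act a m) = act (A.d a) m + (-1 : ℚ) ^ p • act a (d m)

attribute [instance] DGModule.addCommGroup DGModule.module

/-! ### Homomorphisms, homotopies -/

namespace DGModule

variable {A : Cdga H}

/-- `f` is a `G`-equivariant element of `Hom_A(M, N)ⁿ`: it raises degrees by `n`, and
`f (a m) = (-1)^{n p} a f(m)` for `a ∈ A^p`. -/
structure IsHom (M N : DGModule A) (n : ℤ) (f : M.carrier →ₗ[ℚ] N.carrier) : Prop where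
  map_deg : ∀ k, ∀ m ∈ M.deg k, f m ∈ N.deg (k + n)
  equivariant : IsEquivariant M.coact N.coact f
  map_act : ∀ p : ℤ, ∀ a ∈ A.deg p, ∀ m, f (M.act a m) = (-1 : ℚ) ^ (n * p) • N.act a (f m)

/-- Morphisms of dg `A`-modules over `G`. -/
@[ext]
structure Hom (M N : DGModule A) where
  lin : M.carrier →ₗ[ℚ] N.carrier
  isHom : IsHom M N 0 lin
  comm : ∀ m, lin (M.d m) = N.d (lin m)

lemma eps_mul (n m : ℤ) : (-1 : ℚ) ^ (n + m) = (-1) ^ n * (-1) ^ m :=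
  zpow_add₀ (by norm_num) n m

lemma eps_sq (n : ℤ) : (-1 : ℚ) ^ n * (-1) ^ n = 1 := by
  rw [← eps_mul]; exact Even.neg_one_zpow ⟨n, rfl⟩

lemma eps_neg (n : ℤ) : (-1 : ℚ) ^ (-n) = (-1) ^ n := by
  rw [zpow_neg]; exact inv_eq_of_mul_eq_one_left (eps_sq n)

namespace IsHom

variable {M N P : DGModule A} {n m : ℤ} {f g : M.carrier →ₗ[ℚ] N.carrier}

lemma zero : IsHom M N n 0 where
  map_deg k m _ := by simp
  equivariant v := by simp
  map_act := by simp

lemma add (hf : IsHom M N n f) (hg : IsHom M N n g) : IsHom M N n (f + g) where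
  map_deg k m hm := add_mem (hf.map_deg k m hm) (hg.map_deg k m hm)
  equivariant v := by simp [hf.equivariant v, hg.equivariant v, LinearMap.rTensor_add]
  map_act p a ha m := by simp [hf.map_act p a ha, hg.map_act p a ha]

lemma smul (c : ℚ) (hf : IsHom M N n f) : IsHom M N n (c • f) where
  map_deg k m hm := Submodule.smul_mem _ _ (hf.map_deg k m hm)
  equivariant v := by simp [hf.equivariant v, LinearMap.rTensor_smul]
  map_act p a ha m := by simp [hf.map_act p a ha, smul_comm c]

lemma neg (hf : IsHom M N n f) : IsHom M N n (-f) := by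
  simpa using hf.smul (-1)

lemma sub (hf : IsHom M N n f) (hg : IsHom M N n g) : IsHom M N n (f - g) := by
  rw [sub_eq_add_neg]; exact hf.add hg.neg

lemma comp {g : N.carrier →ₗ[ℚ] P.carrier} (hg : IsHom N P m g) (hf : IsHom M N n f)
    {k : ℤ} (hk : n + m = k) : IsHom M P k (g ∘ₗ f) where
  map_deg i x hx := by
    have := hg.map_deg _ _ (hf.map_deg i x hx)
    rwa [add_assoc, hk] at this
  equivariant v := by
    simp [hg.equivariant (f v), hf.equivariant v, LinearMap.rTensor_comp]
  map_act p a ha x := by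
    subst hk
    simp only [LinearMap.comp_apply, hf.map_act p a ha, map_smul, hg.map_act p a ha, smul_smul]
    rw [add_mul, eps_mul]

lemma id (M : DGModule A) : IsHom M M 0 LinearMap.id where
  map_deg k m hm := by simpa using hm
  equivariant v := by simp
  map_act := by simp

lemma d_comp (hf : IsHom M N n f) {k : ℤ} (hk : n + 1 = k)
    : ∀ i, ∀ x ∈ M.deg i, N.d (f x) ∈ N.deg (i + k) := by
  intro i x hx
  have := N.d_deg _ _ (hf.map_deg i x hx)
  rwa [add_assoc, hk] at this

end IsHom

instance : Category (DGModule A) where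
  Hom := Hom
  id M := ⟨LinearMap.id, IsHom.id M, fun _ => rfl⟩
  comp f g := ⟨g.lin ∘ₗ f.lin, g.isHom.comp f.isHom (by simp), fun m => by
    simp [f.comm, g.comm]⟩

variable {M N P : DGModule A}

@[ext]
lemma hom_ext {f g : M ⟶ N} (h : f.lin = g.lin) : f = g := Hom.ext h

@[simp] lemma id_lin (M : DGModule A) : Hom.lin (𝟙 M) = LinearMap.id := rfl
@[simp] lemma comp_lin (f : M ⟶ N) (g : N ⟶ P) : (f ≫ g).lin = g.lin ∘ₗ f.lin := rfl

instance : Zero (M ⟶ N) := ⟨⟨0, IsHom.zero, by simp⟩⟩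
instance : Add (M ⟶ N) := ⟨fun f g => ⟨f.lin + g.lin, f.isHom.add g.isHom, by
  simp [f.comm, g.comm]⟩⟩
instance : Neg (M ⟶ N) := ⟨fun f => ⟨-f.lin, f.isHom.neg, by simp [f.comm]⟩⟩

@[simp] lemma zero_lin : Hom.lin (0 : M ⟶ N) = 0 := rfl
@[simp] lemma add_lin (f g : M ⟶ N) : (f + g).lin = f.lin + g.lin := rfl
@[simp] lemma neg_lin (f : M ⟶ N) : (-f).lin = -f.lin := rfl

instance : AddCommGroup (M ⟶ N) where
  add_assoc f g h := by ext; simp [add_assoc]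
  zero_add f := by ext; simp
  add_zero f := by ext; simp
  nsmul := nsmulRec
  zsmul := zsmulRec
  neg_add_cancel f := by ext; simp
  add_comm f g := by ext; simp [add_comm]

@[simp] lemma sub_lin (f g : M ⟶ N) : (f - g).lin = f.lin - g.lin := by
  rw [sub_eq_add_neg, add_lin, neg_lin, sub_eq_add_neg]

instance : Preadditive (DGModule A) where
  add_comp _ _ _ f g h := by ext; simp
  comp_add _ _ _ f g h := by ext; simp

/-- Two morphisms are homotopic if their difference is the differential `d h + h d` of a
`G`-equivariant element `h` of `Hom_A(M, N)⁻¹`. -/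
def homotopic (A : Cdga H) : HomRel (DGModule A) := fun M N f g =>
  ∃ h : M.carrier →ₗ[ℚ] N.carrier, IsHom M N (-1) h ∧
    ∀ m, f.lin m - g.lin m = N.d (h m) + h (M.d m)

instance : Congruence (homotopic A) where
  equivalence := {
    refl := fun f => ⟨0, IsHom.zero, by simp⟩
    symm := by
      rintro f g ⟨h, hh, e⟩
      refine ⟨-h, hh.neg, fun m => ?_⟩
      simp only [LinearMap.neg_apply, map_neg]
      rw [← neg_add, ← e, neg_sub]
    trans := by
      rintro f g k ⟨h, hh, e⟩ ⟨h', hh', e'⟩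
      refine ⟨h + h', hh.add hh', fun m => ?_⟩
      rw [← sub_add_sub_cancel _ (g.lin m), e, e']
      simp only [LinearMap.add_apply, map_add]
      abel }
  comp_left := by
    rintro M N P f g g' ⟨h, hh, e⟩
    refine ⟨h ∘ₗ f.lin, hh.comp f.isHom (by simp), fun m => ?_⟩
    simp [e, f.comm]
  comp_right := by
    rintro M N P f f' g ⟨h, hh, e⟩
    refine ⟨g.lin ∘ₗ h, g.isHom.comp hh (by simp), fun m => ?_⟩
    simp [← map_sub, e, g.comm]

lemma homotopic_add ⦃M N : DGModule A⦄ (f₁ f₂ g₁ g₂ : M ⟶ N) (h₁ : homotopic A f₁ f₂)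
    (h₂ : homotopic A g₁ g₂) : homotopic A (f₁ + g₁) (f₂ + g₂) := by
  obtain ⟨h, hh, e⟩ := h₁
  obtain ⟨h', hh', e'⟩ := h₂
  refine ⟨h + h', hh.add hh', fun m => ?_⟩
  simp only [add_lin, LinearMap.add_apply, map_add]
  rw [add_sub_add_comm, e, e']
  abel

end DGModule
section Aux

variable {V W U V' W' U' : Type u} [AddCommGroup V] [Module ℚ V] [AddCommGroup W] [Module ℚ W]
  [AddCommGroup U] [Module ℚ U] [AddCommGroup V'] [Module ℚ V'] [AddCommGroup W'] [Module ℚ W']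
  [AddCommGroup U'] [Module ℚ U']

lemma map₂_natural (β : V →ₗ[ℚ] W →ₗ[ℚ] U) (β' : V' →ₗ[ℚ] W' →ₗ[ℚ] U')
    (f : V →ₗ[ℚ] V') (g : W →ₗ[ℚ] W') (h : U →ₗ[ℚ] U') (e : ∀ v w, β' (f v) (g w) = h (β v w))
    (x : V ⊗[ℚ] H) (y : W ⊗[ℚ] H) :
    TensorProduct.map₂ β' (LinearMap.mul ℚ H) (f.rTensor H x) (g.rTensor H y) =
      h.rTensor H (TensorProduct.map₂ β (LinearMap.mul ℚ H) x y) := by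
  induction x with
  | zero => simp
  | add x₁ x₂ h₁ h₂ => simp only [map_add, LinearMap.add_apply, h₁, h₂]
  | tmul v a =>
    induction y with
    | zero => simp
    | add y₁ y₂ h₁ h₂ => simp only [map_add, h₁, h₂]
    | tmul w b => simp [e]

lemma IsCoaction.coassoc_apply {ρ : V →ₗ[ℚ] V ⊗[ℚ] H} (hρ : IsCoaction ρ) (v : V) :
    TensorProduct.assoc ℚ V H H (ρ.rTensor H (ρ v)) =
      (Coalgebra.comul (R := ℚ) (A := H)).lTensor V (ρ v) :=
  LinearMap.congr_fun hρ.coassoc v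

lemma coassoc_of_equivariant {ρV : V →ₗ[ℚ] V ⊗[ℚ] H} {ρW : W →ₗ[ℚ] W ⊗[ℚ] H}
    (hρ : IsCoaction ρV) {f : V →ₗ[ℚ] W} (hf : IsEquivariant ρV ρW f) (v : V) :
    TensorProduct.assoc ℚ W H H (ρW.rTensor H (ρW (f v))) =
      (Coalgebra.comul (R := ℚ) (A := H)).lTensor W (ρW (f v)) := by
  have h1 : ∀ x : V ⊗[ℚ] H, TensorProduct.assoc ℚ W H H (ρW.rTensor H (f.rTensor H x)) =
      f.rTensor (H ⊗[ℚ] H) (TensorProduct.assoc ℚ V H H (ρV.rTensor H x)) := by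
    intro x
    induction x with
    | zero => simp
    | add x y hx hy => simp only [map_add, hx, hy]
    | tmul v a =>
      simp only [LinearMap.rTensor_tmul, hf v]
      generalize ρV v = z
      induction z with
      | zero => simp
      | add x y hx hy => simp only [map_add, TensorProduct.add_tmul, hx, hy]
      | tmul w b => simp
  rw [hf, h1, hρ.coassoc_apply]
  generalize ρV v = z
  induction z with
  | zero => simp
  | add x y hx hy => simp only [map_add, hx, hy]
  | tmul w b => simp

lemma counit_of_equivariant {ρV : V →ₗ[ℚ] V ⊗[ℚ] H} {ρW : W →ₗ[ℚ] W ⊗[ℚ] H}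
    (hρ : IsCoaction ρV) {f : V →ₗ[ℚ] W} (hf : IsEquivariant ρV ρW f) (v : V) :
    (Coalgebra.counit (R := ℚ) (A := H)).lTensor W (ρW (f v)) = f v ⊗ₜ[ℚ] (1 : ℚ) := by
  rw [hf]
  have h1 : ∀ x : V ⊗[ℚ] H, (Coalgebra.counit (R := ℚ) (A := H)).lTensor W (f.rTensor H x) =
      f.rTensor ℚ ((Coalgebra.counit (R := ℚ) (A := H)).lTensor V x) := by
    intro x
    induction x with
    | zero => simp
    | add x y hx hy => simp only [map_add, hx, hy]
    | tmul w b => simp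
  rw [h1, hρ.counit]
  simp

/-- The direct sum of two representations. -/
def prodCoact (ρV : V →ₗ[ℚ] V ⊗[ℚ] H) (ρW : W →ₗ[ℚ] W ⊗[ℚ] H) :
    (V × W) →ₗ[ℚ] (V × W) ⊗[ℚ] H :=
  LinearMap.coprod ((LinearMap.inl ℚ V W).rTensor H ∘ₗ ρV) ((LinearMap.inr ℚ V W).rTensor H ∘ₗ ρW)

variable (ρV : V →ₗ[ℚ] V ⊗[ℚ] H) (ρW : W →ₗ[ℚ] W ⊗[ℚ] H) {ρU : U →ₗ[ℚ] U ⊗[ℚ] H}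

lemma inl_equivariant : IsEquivariant ρV (prodCoact ρV ρW) (LinearMap.inl ℚ V W) := by
  intro v; simp [prodCoact]

lemma inr_equivariant : IsEquivariant ρW (prodCoact ρV ρW) (LinearMap.inr ℚ V W) := by
  intro v; simp [prodCoact]

lemma fst_equivariant : IsEquivariant (prodCoact ρV ρW) ρV (LinearMap.fst ℚ V W) := by
  rintro ⟨v, w⟩
  simp only [prodCoact, LinearMap.coprod_apply, LinearMap.comp_apply, map_add,
    ← LinearMap.rTensor_comp_apply]
  simp

lemma snd_equivariant : IsEquivariant (prodCoact ρV ρW) ρW (LinearMap.snd ℚ V W) := by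
  rintro ⟨v, w⟩
  simp only [prodCoact, LinearMap.coprod_apply, LinearMap.comp_apply, map_add,
    ← LinearMap.rTensor_comp_apply]
  simp

variable {ρV ρW}

lemma IsEquivariant.comp {g : W →ₗ[ℚ] U} {f : V →ₗ[ℚ] W} (hg : IsEquivariant ρW ρU g)
    (hf : IsEquivariant ρV ρW f) : IsEquivariant ρV ρU (g ∘ₗ f) := by
  intro v; simp [hg (f v), hf v, LinearMap.rTensor_comp]

lemma IsEquivariant.add {g f : V →ₗ[ℚ] W} (hg : IsEquivariant ρV ρW g)
    (hf : IsEquivariant ρV ρW f) : IsEquivariant ρV ρW (g + f) := by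
  intro v; simp [hg v, hf v, LinearMap.rTensor_add]

lemma IsEquivariant.smul (c : ℚ) {f : V →ₗ[ℚ] W}
    (hf : IsEquivariant ρV ρW f) : IsEquivariant ρV ρW (c • f) := by
  intro v; simp [hf v, LinearMap.rTensor_smul]

lemma prod_eq (x : V × W) : x = LinearMap.inl ℚ V W x.1 + LinearMap.inr ℚ V W x.2 := by
  simp

lemma prodCoact_isCoaction (hV : IsCoaction ρV) (hW : IsCoaction ρW) :
    IsCoaction (prodCoact ρV ρW) where
  coassoc := by
    ext1
    · refine LinearMap.ext fun v => ?_
      exact coassoc_of_equivariant hV (inl_equivariant ρV ρW) v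
    · refine LinearMap.ext fun v => ?_
      exact coassoc_of_equivariant hW (inr_equivariant ρV ρW) v
  counit x := by
    rw [prod_eq x, map_add, map_add, counit_of_equivariant hV (inl_equivariant ρV ρW),
      counit_of_equivariant hW (inr_equivariant ρV ρW), TensorProduct.add_tmul]

lemma subrep_map {S : Submodule ℚ V} {T : Submodule ℚ W} (hS : IsSubrep ρV S)
    {f : V →ₗ[ℚ] W} (hf : IsEquivariant ρV ρW f) (hST : ∀ v ∈ S, f v ∈ T) (v : V) (hv : v ∈ S) :
    ρW (f v) ∈ LinearMap.range (T.subtype.rTensor H) := by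
  obtain ⟨z, hz⟩ := hS v hv
  refine ⟨(f.restrict hST).rTensor H z, ?_⟩
  rw [hf, ← hz, ← LinearMap.comp_apply, ← LinearMap.rTensor_comp, ← LinearMap.comp_apply,
    ← LinearMap.rTensor_comp]
  rfl

lemma prod_isSubrep {S : Submodule ℚ V} {T : Submodule ℚ W} (hS : IsSubrep ρV S)
    (hT : IsSubrep ρW T) : IsSubrep (prodCoact ρV ρW) (S.prod T) := by
  intro x hx
  rw [prod_eq x, map_add]
  exact add_mem
    (subrep_map hS (inl_equivariant ρV ρW) (by intro v hv; simpa using hv) _ hx.1)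
    (subrep_map hT (inr_equivariant ρV ρW) (by intro v hv; simpa using hv) _ hx.2)

lemma prod_isInternal {S : ℤ → Submodule ℚ V} {T : ℤ → Submodule ℚ W}
    (hS : DirectSum.IsInternal S) (hT : DirectSum.IsInternal T) :
    DirectSum.IsInternal (fun n => (S n).prod (T n)) := by
  rw [DirectSum.isInternal_submodule_iff_iSupIndep_and_iSup_eq_top] at *
  constructor
  · intro n
    have h : (⨆ j, ⨆ (_ : j ≠ n), (S j).prod (T j)) ≤
        (⨆ j, ⨆ (_ : j ≠ n), S j).prod (⨆ j, ⨆ (_ : j ≠ n), T j) := by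
      refine iSup₂_le fun j hj => Submodule.prod_mono ?_ ?_
      · exact le_iSup₂_of_le j hj le_rfl
      · exact le_iSup₂_of_le j hj le_rfl
    refine Disjoint.mono_right h ?_
    rw [Submodule.disjoint_def]
    rintro ⟨v, w⟩ ⟨h1, h2⟩ ⟨h3, h4⟩
    exact Prod.ext (Submodule.disjoint_def.1 (hS.1 n) v h1 h3)
      (Submodule.disjoint_def.1 (hT.1 n) w h2 h4)
  · rw [eq_top_iff]
    rintro ⟨v, w⟩ -
    have h1 : (⨆ n, S n).map (LinearMap.inl ℚ V W) ≤ ⨆ n, (S n).prod (T n) := by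
      rw [Submodule.map_iSup]
      refine iSup_mono fun n => ?_
      rintro _ ⟨v, hv, rfl⟩
      exact ⟨hv, zero_mem _⟩
    have h2 : (⨆ n, T n).map (LinearMap.inr ℚ V W) ≤ ⨆ n, (S n).prod (T n) := by
      rw [Submodule.map_iSup]
      refine iSup_mono fun n => ?_
      rintro _ ⟨v, hv, rfl⟩
      exact ⟨zero_mem _, hv⟩
    rw [prod_eq (v, w)]
    exact add_mem (h1 (Submodule.mem_map_of_mem (by simp [hS.2]))) (h2 (Submodule.mem_map_of_mem (by simp [hT.2])))

lemma shift_isInternal {S : ℤ → Submodule ℚ V} (hS : DirectSum.IsInternal S) (n : ℤ) :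
    DirectSum.IsInternal (fun k => S (k + n)) := by
  rw [DirectSum.isInternal_submodule_iff_iSupIndep_and_iSup_eq_top] at *
  exact ⟨hS.1.comp (add_left_injective n), ((Equiv.addRight n).iSup_comp (g := S)).trans hS.2⟩

end Aux

namespace Cdga

variable (A : Cdga H)

/-- The automorphism of `A` which is multiplication by `(-1)^{n p}` on `A^p`. -/
def twist (n : ℤ) : A.carrier →ₗ[ℚ] A.carrier :=
  (DirectSum.toModule ℚ ℤ A.carrier fun p => (-1 : ℚ) ^ (n * p) • (A.deg p).subtype) ∘ₗ
    (DirectSum.decomposeLinearEquiv A.deg).toLinearMap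

variable {A}

lemma twist_of_mem (n : ℤ) {p : ℤ} {a : A.carrier} (ha : a ∈ A.deg p) :
    A.twist n a = (-1 : ℚ) ^ (n * p) • a := by
  simp only [twist, LinearMap.comp_apply, LinearEquiv.coe_coe,
    DirectSum.decomposeLinearEquiv_apply, DirectSum.decompose_of_mem _ ha]
  exact DirectSum.toModule_lof (φ := fun p => (-1 : ℚ) ^ (n * p) • (A.deg p).subtype) ℚ p
    (⟨a, ha⟩ : A.deg p)

lemma induction {motive : A.carrier → Prop} (zero : motive 0)
    (homogeneous : ∀ p, ∀ a ∈ A.deg p, motive a)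
    (add : ∀ a b, motive a → motive b → motive (a + b)) (a : A.carrier) : motive a :=
  DirectSum.Decomposition.inductionOn A.deg zero (fun {i} m => homogeneous i m m.2) add a

lemma one_mem : (1 : A.carrier) ∈ A.deg 0 := SetLike.GradedOne.one_mem

lemma mul_mem {p q : ℤ} {a b : A.carrier} (ha : a ∈ A.deg p) (hb : b ∈ A.deg q) :
    a * b ∈ A.deg (p + q) := SetLike.GradedMul.mul_mem ha hb

lemma twist_mem (n : ℤ) {p : ℤ} {a : A.carrier} (ha : a ∈ A.deg p) : A.twist n a ∈ A.deg p := by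
  rw [twist_of_mem n ha]; exact Submodule.smul_mem _ _ ha

lemma twist_one (n : ℤ) : A.twist n 1 = 1 := by
  rw [twist_of_mem n one_mem]; simp

lemma twist_mul (n : ℤ) (a b : A.carrier) : A.twist n (a * b) = A.twist n a * A.twist n b := by
  induction a using Cdga.induction with
  | zero => simp
  | add a a' h h' => simp [add_mul, h, h']
  | homogeneous p a ha =>
    induction b using Cdga.induction with
    | zero => simp
    | add a a' h h' => simp [mul_add, h, h']
    | homogeneous q b hb =>
      rw [twist_of_mem n ha, twist_of_mem n hb, twist_of_mem n (mul_mem ha hb), mul_add,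
        DGModule.eps_mul]
      simp [smul_smul, mul_comm]

lemma twist_twist (n m : ℤ) (a : A.carrier) : A.twist m (A.twist n a) = A.twist (n + m) a := by
  induction a using Cdga.induction with
  | zero => simp
  | add a a' h h' => simp [h, h']
  | homogeneous p a ha =>
    rw [twist_of_mem n ha, map_smul, twist_of_mem m ha, twist_of_mem _ ha, add_mul,
      DGModule.eps_mul, smul_smul]

lemma twist_zero (a : A.carrier) : A.twist 0 a = a := by
  induction a using Cdga.induction with
  | zero => simp
  | add a a' h h' => simp [h, h']
  | homogeneous p a ha => rw [twist_of_mem 0 ha]; simp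

lemma twist_equivariant (n : ℤ) : IsEquivariant A.coact A.coact (A.twist n) := by
  intro a
  induction a using Cdga.induction with
  | zero => simp
  | add a a' h h' => simp [h, h']
  | homogeneous p a ha =>
    obtain ⟨z, hz⟩ := A.isSubrep_deg p a ha
    have : A.twist n ∘ₗ (A.deg p).subtype = (-1 : ℚ) ^ (n * p) • (A.deg p).subtype := by
      ext ⟨b, hb⟩
      simp [twist_of_mem n hb]
    rw [twist_of_mem n ha, map_smul, ← hz, ← LinearMap.comp_apply, ← LinearMap.rTensor_comp, this,
      LinearMap.rTensor_smul, LinearMap.smul_apply]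

lemma d_twist (n : ℤ) {p : ℤ} {a : A.carrier} (ha : a ∈ A.deg p) :
    A.d (A.twist n a) = (-1 : ℚ) ^ n • A.twist n (A.d a) := by
  rw [twist_of_mem n ha, twist_of_mem n (A.d_deg p a ha), map_smul, smul_smul, mul_add, mul_one,
    DGModule.eps_mul, mul_left_comm, DGModule.eps_sq, mul_one]

end Cdga

namespace DGModule

variable {A : Cdga H}

lemma twistAct_equivariant (M : DGModule A) (n : ℤ) :
    IsEquivariant₂ A.coact M.coact M.coact (M.act ∘ₗ A.twist n) := by
  intro a m
  have := map₂_natural (H := H) (M.act ∘ₗ A.twist n) M.act (A.twist n) LinearMap.id LinearMap.id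
    (by simp) (A.coact a) (M.coact m)
  simp only [LinearMap.rTensor_id, LinearMap.id_apply] at this
  rw [← this, LinearMap.comp_apply, M.act_equivariant, A.twist_equivariant]

/-- The shift `M[n]`: `M[n]^k = M^{k+n}`, with differential `(-1)^n d` and with the action
`(a, m) ↦ (-1)^{n p} a m` for `a ∈ A^p` (the sign is forced by the Leibniz rule). -/
abbrev shift (M : DGModule A) (n : ℤ) : DGModule A where
  carrier := M.carrier
  deg k := M.deg (k + n)
  isInternal := shift_isInternal M.isInternal n
  coact := M.coact
  isCoaction := M.isCoaction
  isSubrep_deg k := M.isSubrep_deg (k + n)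
  act := M.act ∘ₗ A.twist n
  act_equivariant := M.twistAct_equivariant n
  act_deg p q a ha m hm := by
    rw [add_assoc]; exact M.act_deg _ _ _ (Cdga.twist_mem n ha) _ hm
  one_act m := by simp [Cdga.twist_one, M.one_act]
  mul_act a b m := by simp [Cdga.twist_mul, M.mul_act]
  d := (-1 : ℚ) ^ n • M.d
  d_equivariant := M.d_equivariant.smul _
  d_deg k m hm := by
    have := M.d_deg _ m hm
    rw [add_right_comm] at this
    exact Submodule.smul_mem _ _ this
  d_d m := by simp [M.d_d]
  leibniz p a ha m := by
    simp only [LinearMap.smul_apply, LinearMap.comp_apply]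
    rw [M.leibniz p _ (Cdga.twist_mem n ha), Cdga.d_twist n ha, map_smul, LinearMap.smul_apply,
      smul_add, smul_smul, eps_sq, one_smul, map_smul, smul_comm]

/-- The mapping cone: `Cone(f)^k = N^k ⊕ M^{k+1}`, `d (n, m) = (d n + f m, - d m)`; as a graded
`A`-module it is `N ⊕ M[1]`. -/
abbrev cone {M N : DGModule A} (f : M ⟶ N) : DGModule A where
  carrier := N.carrier × M.carrier
  deg k := (N.deg k).prod (M.deg (k + 1))
  isInternal := prod_isInternal N.isInternal (shift_isInternal M.isInternal 1)
  coact := prodCoact N.coact M.coact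
  isCoaction := prodCoact_isCoaction N.isCoaction M.isCoaction
  isSubrep_deg k := prod_isSubrep (N.isSubrep_deg k) (M.isSubrep_deg (k + 1))
  act := LinearMap.mk₂ ℚ (fun a x => (N.act a x.1, M.act (A.twist 1 a) x.2))
    (by simp) (by simp) (by simp) (by simp)
  act_equivariant := by
    intro a x
    have h1 := map₂_natural (H := H) N.act (LinearMap.mk₂ ℚ
        (fun a (x : N.carrier × M.carrier) => (N.act a x.1, M.act (A.twist 1 a) x.2))
        (by simp) (by simp) (by simp) (by simp))
      LinearMap.id (LinearMap.inl ℚ _ _) (LinearMap.inl ℚ _ _) (by simp) (A.coact a) (N.coact x.1)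
    have h2 := map₂_natural (H := H) (M.act ∘ₗ A.twist 1) (LinearMap.mk₂ ℚ
        (fun a (x : N.carrier × M.carrier) => (N.act a x.1, M.act (A.twist 1 a) x.2))
        (by simp) (by simp) (by simp) (by simp))
      LinearMap.id (LinearMap.inr ℚ _ _) (LinearMap.inr ℚ _ _) (by simp) (A.coact a) (M.coact x.2)
    simp only [LinearMap.rTensor_id, LinearMap.id_apply] at h1 h2
    rw [← N.act_equivariant] at h1
    rw [← M.twistAct_equivariant 1] at h2
    simp only [prodCoact, LinearMap.coprod_apply, LinearMap.comp_apply, map_add, h1, h2,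
      LinearMap.mk₂_apply]
  act_deg p q a ha x hx := ⟨N.act_deg _ _ _ ha _ hx.1, by
    have := M.act_deg _ _ _ (Cdga.twist_mem 1 ha) _ hx.2
    rwa [← add_assoc] at this⟩
  one_act x := by simp [Cdga.twist_one, N.one_act, M.one_act]
  mul_act a b x := by simp [Cdga.twist_mul, N.mul_act, M.mul_act]
  d := LinearMap.prod (LinearMap.coprod N.d f.lin) (-(M.d ∘ₗ LinearMap.snd ℚ _ _))
  d_equivariant := by
    intro x
    have h1 := inl_equivariant N.coact M.coact
    have h2 := inr_equivariant N.coact M.coact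
    have h3 := fst_equivariant N.coact M.coact
    have h4 := snd_equivariant N.coact M.coact
    have := ((h1.comp ((N.d_equivariant.comp h3).add (f.isHom.equivariant.comp h4))).add
      ((h2.comp (M.d_equivariant.comp h4)).smul (-1)))
    convert! this x using 2
    · simp
    · congr 1
      ext <;> simp
  d_deg k x hx := ⟨add_mem (N.d_deg _ _ hx.1) (by simpa using f.isHom.map_deg _ _ hx.2),
    neg_mem (M.d_deg _ _ hx.2)⟩
  d_d x := by simp [N.d_d, M.d_d, f.comm]
  leibniz p a ha x := by
    have := f.isHom.map_act p a ha x.2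
    simp only [zero_mul, zpow_zero, one_smul] at this
    refine Prod.ext ?_ ?_
    · simp only [LinearMap.mk₂_apply, LinearMap.prod_apply, Function.prod, LinearMap.coprod_apply,
        Prod.fst_add, Prod.smul_fst, N.leibniz p a ha, map_add, smul_add,
        Cdga.twist_of_mem 1 ha, map_smul, LinearMap.smul_apply, this, one_mul, add_assoc]
    · simp [M.leibniz p _ (Cdga.twist_mem 1 ha), Cdga.d_twist 1 ha]
      abel

end DGModule
namespace DGModule

variable {A : Cdga H}

lemma IsHom.shift {M N : DGModule A} {k : ℤ} {f : M.carrier →ₗ[ℚ] N.carrier} (hf : IsHom M N k f)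
    {i j l : ℤ} (h : i + k = l + j) : IsHom (M.shift i) (N.shift j) l f where
  map_deg x m hm := by
    have := hf.map_deg _ m hm
    rw [add_assoc, h, ← add_assoc] at this
    exact this
  equivariant := hf.equivariant
  map_act p a ha m := by
    have h1 : f (M.act (A.twist i a) m) = (-1 : ℚ) ^ (l * p) • N.act (A.twist j a) (f m) := by
      rw [Cdga.twist_of_mem i ha, Cdga.twist_of_mem j ha, map_smul, map_smul, LinearMap.smul_apply,
        LinearMap.smul_apply, map_smul, hf.map_act p a ha, smul_smul, smul_smul, ← eps_mul,
        ← eps_mul, ← add_mul, ← add_mul, h]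
    exact h1

lemma IsHom.of_eq {M N : DGModule A} {k : ℤ} {f : M.carrier →ₗ[ℚ] N.carrier}
    (hf : IsHom M N k f) {l : ℤ} (h : k = l) : IsHom M N l f := h ▸ hf

lemma isHom_toShift (M : DGModule A) (n : ℤ) {l : ℤ} (h : l + n = 0) :
    IsHom M (M.shift n) l (LinearMap.id : M.carrier →ₗ[ℚ] M.carrier) where
  map_deg x m hm := by
    have h1 : m ∈ M.deg (x + l + n) := by rw [add_assoc, h, add_zero]; exact hm
    exact h1
  equivariant := (IsHom.id M).equivariant
  map_act p a ha m := by
    have h1 : M.act a m = (-1 : ℚ) ^ (l * p) • M.act (A.twist n a) m := by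
      rw [Cdga.twist_of_mem n ha, map_smul, LinearMap.smul_apply, smul_smul, ← eps_mul, ← add_mul,
        h, zero_mul, zpow_zero, one_smul]
    exact h1

lemma isHom_ofShift (M : DGModule A) (n : ℤ) :
    IsHom (M.shift n) M n (LinearMap.id : M.carrier →ₗ[ℚ] M.carrier) where
  map_deg x m hm := hm
  equivariant := (IsHom.id M).equivariant
  map_act p a ha m := by
    have h1 : M.act (A.twist n a) m = (-1 : ℚ) ^ (n * p) • M.act a m := by
      rw [Cdga.twist_of_mem n ha, map_smul, LinearMap.smul_apply]
    exact h1

/-- The functor `M ↦ M[n]`. -/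
def shiftFun (A : Cdga H) (n : ℤ) : DGModule A ⥤ DGModule A where
  obj M := M.shift n
  map {M N} f := ⟨f.lin, f.isHom.shift (by simp), fun m => by
    have h : f.lin ((-1 : ℚ) ^ n • M.d m) = (-1 : ℚ) ^ n • N.d (f.lin m) := by
      rw [map_smul, f.comm]
    exact h⟩

/-- The identity of the underlying vector space, as an isomorphism `M ≅ M[0]`. -/
def shiftZeroIso (M : DGModule A) : M.shift 0 ≅ M where
  hom := ⟨(LinearMap.id : M.carrier →ₗ[ℚ] M.carrier), isHom_ofShift M 0, fun m => by
    have h : (-1 : ℚ) ^ (0 : ℤ) • M.d m = M.d m := by simp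
    exact h⟩
  inv := ⟨(LinearMap.id : M.carrier →ₗ[ℚ] M.carrier), isHom_toShift M 0 rfl, fun m => by
    have h : M.d m = (-1 : ℚ) ^ (0 : ℤ) • M.d m := by simp
    exact h⟩

/-- The identity of the underlying vector space, as an isomorphism `M[n + m] ≅ M[n][m]`. -/
def shiftAddIso (M : DGModule A) (n m : ℤ) : M.shift (n + m) ≅ (M.shift n).shift m where
  hom := ⟨(LinearMap.id : M.carrier →ₗ[ℚ] M.carrier),
    ((isHom_toShift (M.shift n) m (l := -m) (by simp)).comp
      ((isHom_toShift M n (l := -n) (by simp)).comp (isHom_ofShift M (n + m)) rfl) (by ring)),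
    fun x => by
      have h : (-1 : ℚ) ^ (n + m) • M.d x = (-1 : ℚ) ^ m • (-1 : ℚ) ^ n • M.d x := by
        rw [eps_mul, smul_smul, mul_comm]
      exact h⟩
  inv := ⟨(LinearMap.id : M.carrier →ₗ[ℚ] M.carrier),
    ((isHom_toShift M (n + m) (l := -(n + m)) (by simp)).comp
      ((isHom_ofShift M n).comp (isHom_ofShift (M.shift n) m) rfl) (by ring)),
    fun x => by
      have h : (-1 : ℚ) ^ m • (-1 : ℚ) ^ n • M.d x = (-1 : ℚ) ^ (n + m) • M.d x := by
        rw [eps_mul, smul_smul, mul_comm]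
      exact h⟩

lemma eqToHom_shift_lin (M : DGModule A) {n m : ℤ} (h : n = m) :
    Hom.lin (eqToHom (show M.shift n = M.shift m by rw [h])) =
      (LinearMap.id : M.carrier →ₗ[ℚ] M.carrier) := by
  subst h; rfl

noncomputable instance : HasShift (DGModule A) ℤ := hasShiftMk _ _
  { F := shiftFun A
    zero := NatIso.ofComponents (fun M => shiftZeroIso M) (fun f => by ext m; rfl)
    add := fun n m => NatIso.ofComponents (fun M => shiftAddIso M n m) (fun f => by ext m; rfl)
    assoc_hom_app := fun n₁ n₂ n₃ M => by
      refine hom_ext ?_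
      have := eqToHom_shift_lin M (add_assoc n₁ n₂ n₃)
      refine Eq.trans ?_ (congrArg (fun z : M.carrier →ₗ[ℚ] M.carrier => z) this.symm)
      rfl
    zero_add_hom_app := fun n M => by
      refine hom_ext ?_
      exact (eqToHom_shift_lin M (zero_add n)).symm
    add_zero_hom_app := fun n M => by
      refine hom_ext ?_
      exact (eqToHom_shift_lin M (add_zero n)).symm }

lemma shift_obj (M : DGModule A) (n : ℤ) : M⟦n⟧ = M.shift n := rfl

@[simp]
lemma shift_map_lin {M N : DGModule A} (f : M ⟶ N) (n : ℤ) : Hom.lin (f⟦n⟧') = f.lin := rfl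

instance (n : ℤ) : (shiftFunctor (DGModule A) n).Additive where
  map_add := rfl

lemma homotopic_shift {M N : DGModule A} (f g : M ⟶ N) (h : homotopic A f g) (n : ℤ) :
    homotopic A (f⟦n⟧') (g⟦n⟧') := by
  obtain ⟨h, hh, e⟩ := h
  refine ⟨(-1 : ℚ) ^ n • h, (hh.shift (by ring)).smul _, fun (m : M.carrier) => ?_⟩
  have : f.lin m - g.lin m = (-1 : ℚ) ^ n • N.d ((-1 : ℚ) ^ n • h m) +
      (-1 : ℚ) ^ n • h ((-1 : ℚ) ^ n • M.d m) := by
    rw [map_smul, map_smul, smul_smul, smul_smul, eps_sq, one_smul, one_smul, e]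
  exact this

instance : (homotopic A).IsCompatibleWithShift ℤ where
  condition n _ _ f g h := homotopic_shift f g h n

/-- The zero module. -/
def zeroModule (A : Cdga H) : DGModule A where
  carrier := PUnit
  deg _ := ⊤
  isInternal := by
    rw [DirectSum.isInternal_submodule_iff_iSupIndep_and_iSup_eq_top]
    refine ⟨fun i => ?_, Subsingleton.elim _ _⟩
    rw [Submodule.disjoint_def]
    intros; rfl
  coact := 0
  isCoaction := ⟨by ext; simp, fun v => (TensorProduct.zero_tmul _ _).symm⟩
  isSubrep_deg _ v _ := by simp
  act := 0
  act_equivariant _ _ := by simp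
  act_deg := by simp
  one_act _ := rfl
  mul_act _ _ _ := rfl
  d := 0
  d_equivariant _ := by simp
  d_deg := by simp
  d_d _ := rfl
  leibniz _ _ _ _ := rfl

lemma isZero_zeroModule : IsZero (zeroModule A) where
  unique_to N := ⟨⟨⟨0⟩, fun f => by
    refine hom_ext (LinearMap.ext fun x => ?_)
    have : x = 0 := rfl
    rw [this, map_zero, map_zero]⟩⟩
  unique_from N := ⟨⟨⟨0⟩, fun f => by
    refine hom_ext (LinearMap.ext fun x => ?_)
    rfl⟩⟩

instance : HasZeroObject (DGModule A) := ⟨⟨_, isZero_zeroModule⟩⟩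

/-! ### Cone sequences -/

section Cone

variable {M N : DGModule A} (f : M ⟶ N)

lemma isHom_inl : IsHom N (cone f) 0 (LinearMap.inl ℚ N.carrier M.carrier) where
  map_deg k x hx := by rw [add_zero]; exact ⟨hx, zero_mem _⟩
  equivariant := inl_equivariant _ _
  map_act p a ha x := by
    refine Prod.ext ?_ ?_ <;> simp [cone]

lemma isHom_inr : IsHom M (cone f) (-1) (LinearMap.inr ℚ N.carrier M.carrier) where
  map_deg k x hx := by
    have h : ((0, x) : N.carrier × M.carrier) ∈ (N.deg (k + -1)).prod (M.deg (k + -1 + 1)) :=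
      ⟨zero_mem _, by simpa using hx⟩
    exact h
  equivariant := inr_equivariant _ _
  map_act p a ha x := by
    refine Prod.ext ?_ ?_
    · simp [cone]
    · simp only [LinearMap.inr_apply, cone, LinearMap.mk₂_apply, Prod.smul_snd]
      rw [Cdga.twist_of_mem 1 ha, map_smul, LinearMap.smul_apply, smul_smul, ← eps_mul]
      simp

lemma isHom_fst : IsHom (cone f) N 0 (LinearMap.fst ℚ N.carrier M.carrier) where
  map_deg k x hx := by rw [add_zero]; exact hx.1
  equivariant := fst_equivariant _ _
  map_act p a ha x := by simp [cone]

lemma isHom_snd : IsHom (cone f) M 1 (LinearMap.snd ℚ N.carrier M.carrier) where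
  map_deg k x hx := hx.2
  equivariant := snd_equivariant _ _
  map_act p a ha x := by
    simp [cone, Cdga.twist_of_mem 1 ha]

/-- The inclusion `N ⟶ Cone(f)`. -/
def coneInl : N ⟶ cone f :=
  ⟨LinearMap.inl ℚ N.carrier M.carrier, isHom_inl f, fun x => by
    refine Prod.ext ?_ ?_ <;> simp [cone]⟩

/-- The projection `Cone(f) ⟶ M[1]`. -/
def coneSnd : cone f ⟶ M⟦(1 : ℤ)⟧ :=
  ⟨LinearMap.snd ℚ N.carrier M.carrier,
    (isHom_toShift M 1 (l := -1) (by simp)).comp (isHom_snd f) (by simp), fun x => by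
      have h : -M.d x.2 = (-1 : ℚ) ^ (1 : ℤ) • M.d x.2 := by simp
      exact h⟩

/-- The cone sequence `M ⟶ N ⟶ Cone(f) ⟶ M[1]`. -/
noncomputable def coneTriangle : Triangle (DGModule A) := Triangle.mk f (coneInl f) (coneSnd f)

end Cone

end DGModule

/-! ### The homotopy category -/

/-- The homotopy category `K` of dg `A`-modules over `G`. -/
abbrev HoCat (A : Cdga H) := Quotient (DGModule.homotopic A)

namespace HoCat

variable (A : Cdga H)

/-- The functor from dg modules to the homotopy category. -/
abbrev quot : DGModule A ⥤ HoCat A := Quotient.functor (DGModule.homotopic A)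

noncomputable instance : Preadditive (HoCat A) :=
  Quotient.preadditive _ DGModule.homotopic_add

instance : (quot A).Additive := Quotient.functor_additive _ DGModule.homotopic_add

instance : HasZeroObject (HoCat A) := (quot A).hasZeroObject_of_additive

instance (n : ℤ) : (shiftFunctor (HoCat A) n).Additive := by
  have : ((quot A) ⋙ shiftFunctor (HoCat A) n).Additive :=
    Functor.additive_of_iso ((quot A).commShiftIso n)
  exact Functor.additive_of_full_essSurj_comp (quot A) _

variable {A}

lemma quot_eq_iff {M N : DGModule A} (f g : M ⟶ N) :
    (quot A).map f = (quot A).map g ↔ DGModule.homotopic A f g :=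
  Quotient.functor_map_eq_iff _ _ _

end HoCat
namespace DGModule

variable {A : Cdga H}

@[simp]
lemma cone_d {M N : DGModule A} (f : M ⟶ N) (x : N.carrier × M.carrier) :
    (cone f).d x = (N.d x.1 + f.lin x.2, -M.d x.2) := rfl

@[simp]
lemma shiftOne_d (M : DGModule A) (x : M.carrier) : (M.shift 1).d x = -M.d x := by
  change (-1 : ℚ) ^ (1 : ℤ) • M.d x = _
  simp

@[simp]
lemma coneInl_lin {M N : DGModule A} (f : M ⟶ N) (x : N.carrier) :
    (coneInl f).lin x = ((x, 0) : N.carrier × M.carrier) := rfl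

@[simp]
lemma coneSnd_lin {M N : DGModule A} (f : M ⟶ N) (x : N.carrier × M.carrier) :
    (coneSnd f).lin x = x.2 := rfl

lemma isZero_quot_coneId (M : DGModule A) : IsZero ((HoCat.quot A).obj (cone (𝟙 M))) := by
  rw [IsZero.iff_id_eq_zero, ← (HoCat.quot A).map_id, ← (HoCat.quot A).map_zero,
    HoCat.quot_eq_iff]
  refine ⟨LinearMap.inr ℚ M.carrier M.carrier ∘ₗ LinearMap.fst ℚ M.carrier M.carrier,
    (isHom_inr _).comp (isHom_fst _) (by simp), ?_⟩
  rintro ⟨x, y⟩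
  simp

/-- The map on cones induced by a square which commutes up to a given homotopy. -/
def coneMap {M N M' N' : DGModule A} {f : M ⟶ N} {f' : M' ⟶ N'} (a : M ⟶ M') (b : N ⟶ N')
    (h : M.carrier →ₗ[ℚ] N'.carrier) (hh : IsHom M N' (-1) h)
    (e : ∀ m, b.lin (f.lin m) - f'.lin (a.lin m) = N'.d (h m) + h (M.d m)) :
    cone f ⟶ cone f' where
  lin := LinearMap.inl ℚ N'.carrier M'.carrier ∘ₗ (b.lin ∘ₗ LinearMap.fst ℚ N.carrier M.carrier +
      h ∘ₗ LinearMap.snd ℚ N.carrier M.carrier) +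
    LinearMap.inr ℚ N'.carrier M'.carrier ∘ₗ a.lin ∘ₗ LinearMap.snd ℚ N.carrier M.carrier
  isHom := ((isHom_inl f').comp ((b.isHom.comp (isHom_fst f) (by simp)).add
      (hh.comp (isHom_snd f) (by simp) (k := 0))) (by simp)).add
    ((isHom_inr f').comp (a.isHom.comp (isHom_snd f) rfl) (by simp))
  comm := by
    rintro ⟨x, y⟩
    have := e y
    rw [sub_eq_iff_eq_add] at this
    simp [this, a.comm, b.comm]
    abel

section Rotate

variable {M N : DGModule A} (f : M ⟶ N)

/-- The map `M[1] ⟶ Cone(N ⟶ Cone(f))`. -/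
def rotHom : M⟦(1 : ℤ)⟧ ⟶ cone (coneInl f) where
  lin := (LinearMap.inl ℚ (N.carrier × M.carrier) N.carrier ∘ₗ
      LinearMap.inr ℚ N.carrier M.carrier -
    LinearMap.inr ℚ (N.carrier × M.carrier) N.carrier ∘ₗ f.lin : _ →ₗ[ℚ] _)
  isHom := IsHom.sub
    (((isHom_inl (coneInl f)).comp ((isHom_inr f).comp (isHom_ofShift M 1) rfl) rfl).of_eq
      (by simp))
    (((isHom_inr (coneInl f)).comp (f.isHom.comp (isHom_ofShift M 1) rfl) rfl).of_eq (by simp))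
  comm (x : M.carrier) := by
    have h' : (M⟦(1 : ℤ)⟧).d x = -M.d x := shiftOne_d M x
    rw [h']
    have h : (((0, -M.d x), 0) - ((0, 0), f.lin (-M.d x)) : (N.carrier × M.carrier) × N.carrier) =
      ((N.d (0 - 0) + f.lin (x - 0), -M.d (x - 0)) + (0 - f.lin x, 0), -N.d (0 - f.lin x)) := by
        simp [f.comm]
    exact h

/-- The map `Cone(N ⟶ Cone(f)) ⟶ M[1]`. -/
def rotInv : cone (coneInl f) ⟶ M⟦(1 : ℤ)⟧ where
  lin := (LinearMap.snd ℚ N.carrier M.carrier ∘ₗ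
    LinearMap.fst ℚ (N.carrier × M.carrier) N.carrier : _ →ₗ[ℚ] _)
  isHom := (coneSnd f).isHom.comp (isHom_fst (coneInl f)) (by simp)
  comm x := by
    refine Eq.trans ?_ (shiftOne_d M x.1.2).symm
    have h : -M.d x.1.2 + 0 = -M.d x.1.2 := add_zero _
    exact h

lemma rotInv_rotHom : rotHom f ≫ rotInv f = 𝟙 _ := by
  refine hom_ext (LinearMap.ext fun (x : M.carrier) => ?_)
  have h : x - 0 = x := sub_zero x
  exact h

lemma rotHom_rotInv : homotopic A (𝟙 _) (rotInv f ≫ rotHom f) := by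
  refine ⟨LinearMap.inr ℚ (N.carrier × M.carrier) N.carrier ∘ₗ
    LinearMap.fst ℚ N.carrier M.carrier ∘ₗ LinearMap.fst ℚ (N.carrier × M.carrier) N.carrier,
    (isHom_inr _).comp ((isHom_fst _).comp (isHom_fst _) rfl) (by simp), ?_⟩
  rintro ⟨⟨x, y⟩, z⟩
  have h : ((x, y), z) - (((0, y), 0) - ((0, 0), f.lin y)) =
      (((0, 0) + (x, 0), -N.d x) + ((0, 0), (N.d x + f.lin y) + z) :
        (N.carrier × M.carrier) × N.carrier) := by
    simp
    abel
  refine Eq.trans h ?_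
  have h2 : (((0, 0) + (x, 0), -N.d x) + ((0, 0), (N.d x + f.lin y) + z) :
        (N.carrier × M.carrier) × N.carrier) =
      ((N.d 0 + f.lin 0, -M.d 0) + (x, 0), -N.d x) + ((0, 0), (N.d x + f.lin y) + z) := by simp
  exact h2

lemma rotHom_comm : homotopic A (coneInl (coneInl f)) (coneSnd f ≫ rotHom f) := by
  have : coneSnd f = coneInl (coneInl f) ≫ rotInv f := rfl
  rw [this, Category.assoc]
  conv_lhs => rw [← Category.comp_id (coneInl (coneInl f))]
  exact HomRel.comp_left _ (rotHom_rotInv f)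

end Rotate

section Octahedron

variable {X Y Z : DGModule A} (f : X ⟶ Y) (g : Y ⟶ Z)

/-- `Cone(f) ⟶ Cone(g f)` -/
def octa₁ : cone f ⟶ cone (f ≫ g) := coneMap (𝟙 X) g 0 IsHom.zero (by simp)

/-- `Cone(g f) ⟶ Cone(g)` -/
def octa₂ : cone (f ≫ g) ⟶ cone g := coneMap f (𝟙 Z) 0 IsHom.zero (by simp)

@[simp]
lemma octa₁_lin (x : Y.carrier × X.carrier) : (octa₁ f g).lin x = (g.lin x.1, x.2) := by
  simp [octa₁, coneMap]

@[simp]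
lemma octa₂_lin (x : Z.carrier × X.carrier) : (octa₂ f g).lin x = (x.1, f.lin x.2) := by
  simp [octa₂, coneMap]

/-- `Cone(g) ⟶ Cone(Cone(f) ⟶ Cone(g f))` -/
def octaHom : cone g ⟶ cone (octa₁ f g) where
  lin := LinearMap.inl ℚ (Z.carrier × X.carrier) (Y.carrier × X.carrier) ∘ₗ
      LinearMap.inl ℚ Z.carrier X.carrier ∘ₗ LinearMap.fst ℚ Z.carrier Y.carrier +
    LinearMap.inr ℚ (Z.carrier × X.carrier) (Y.carrier × X.carrier) ∘ₗ
      LinearMap.inl ℚ Y.carrier X.carrier ∘ₗ LinearMap.snd ℚ Z.carrier Y.carrier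
  isHom := ((isHom_inl (octa₁ f g)).comp ((isHom_inl (f ≫ g)).comp (isHom_fst g) rfl) rfl).add
    (((isHom_inr (octa₁ f g)).comp ((isHom_inl f).comp (isHom_snd g) rfl) rfl).of_eq (by simp))
  comm := by
    rintro ⟨z, y⟩
    have h : (((Z.d z + g.lin y, 0), 0) + ((0, 0), (-Y.d y, 0)) :
          (Z.carrier × X.carrier) × (Y.carrier × X.carrier)) =
        ((Z.d (z + 0) + (f ≫ g).lin (0 + 0), -X.d (0 + 0)) + (g.lin (0 + y) + 0 + 0, 0 + (0 + 0)),
          -(Y.d (0 + y) + f.lin (0 + 0), -X.d (0 + 0))) := by simp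
    exact h

/-- `Cone(Cone(f) ⟶ Cone(g f)) ⟶ Cone(g)` -/
def octaInv : cone (octa₁ f g) ⟶ cone g where
  lin := LinearMap.inl ℚ Z.carrier Y.carrier ∘ₗ LinearMap.fst ℚ Z.carrier X.carrier ∘ₗ
      LinearMap.fst ℚ (Z.carrier × X.carrier) (Y.carrier × X.carrier) +
    LinearMap.inr ℚ Z.carrier Y.carrier ∘ₗ (LinearMap.fst ℚ Y.carrier X.carrier ∘ₗ
        LinearMap.snd ℚ (Z.carrier × X.carrier) (Y.carrier × X.carrier) +
      f.lin ∘ₗ LinearMap.snd ℚ Z.carrier X.carrier ∘ₗ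
        LinearMap.fst ℚ (Z.carrier × X.carrier) (Y.carrier × X.carrier))
  isHom := ((isHom_inl g).comp ((isHom_fst (f ≫ g)).comp (isHom_fst (octa₁ f g)) rfl) rfl).add
    (((isHom_inr g).comp (IsHom.add
      (((isHom_fst f).comp (isHom_snd (octa₁ f g)) rfl))
      ((f.isHom.comp ((isHom_snd (f ≫ g)).comp (isHom_fst (octa₁ f g)) rfl) rfl).of_eq
        (by simp))) rfl).of_eq (by simp))
  comm := by
    rintro ⟨⟨z, x⟩, ⟨y, x'⟩⟩
    have h1 : (octa₁ f g).lin (y, x') = (g.lin y, x') := octa₁_lin f g (y, x')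
    have h : ((Z.d z + g.lin (f.lin x) + g.lin y, -(Y.d y + f.lin x') + f.lin (-X.d x + x')) :
        Z.carrier × Y.carrier) =
        (Z.d z + g.lin (y + f.lin x), -Y.d (y + f.lin x)) := by
      simp [f.comm]
      constructor <;> abel
    refine Eq.trans ?_ (h.trans ?_)
    · simp
      rw [h1]
      exact ⟨rfl, rfl⟩
    · simp

lemma octaHom_octaInv : octaHom f g ≫ octaInv f g = 𝟙 _ := by
  refine hom_ext (LinearMap.ext ?_)
  rintro ⟨z, y⟩
  simp [octaHom, octaInv]

lemma octaInv_octaHom : homotopic A (𝟙 _) (octaInv f g ≫ octaHom f g) := by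
  refine ⟨LinearMap.inr ℚ (Z.carrier × X.carrier) (Y.carrier × X.carrier) ∘ₗ
    LinearMap.inr ℚ Y.carrier X.carrier ∘ₗ LinearMap.snd ℚ Z.carrier X.carrier ∘ₗ
      LinearMap.fst ℚ (Z.carrier × X.carrier) (Y.carrier × X.carrier),
    ((isHom_inr _).comp ((isHom_inr _).comp ((isHom_snd _).comp (isHom_fst _) rfl) rfl)
      (by simp)), ?_⟩
  rintro ⟨⟨z, x⟩, ⟨y, x'⟩⟩
  have h1 : (octa₁ f g).lin (y, x') = (g.lin y, x') := octa₁_lin f g (y, x')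
  have h2 : (octa₁ f g).lin (0, x) = (0, x) := by
    rw [octa₁_lin, map_zero]
  simp [octaHom, octaInv]
  rw [h1, h2]
  simp

lemma octa_comm : homotopic A (coneInl (octa₁ f g)) (octa₂ f g ≫ octaHom f g) := by
  have : octa₂ f g = coneInl (octa₁ f g) ≫ octaInv f g := by
    refine hom_ext (LinearMap.ext ?_)
    rintro ⟨z, y⟩
    refine (octa₂_lin f g (z, y)).trans ?_
    have h : ((z, f.lin y) : Z.carrier × Y.carrier) = (z + 0, 0 + (0 + f.lin y)) := by simp
    exact h
  rw [this, Category.assoc]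
  conv_lhs => rw [← Category.comp_id (coneInl (octa₁ f g))]
  exact HomRel.comp_left _ (octaInv_octaHom f g)

end Octahedron

end DGModule
namespace DGModule

variable {A : Cdga H}

lemma neg_one_units_smul {M N : DGModule A} (f : M ⟶ N) : (-1 : ℤ).negOnePow • f = -f := by
  simp [Int.negOnePow_neg]

lemma shiftFunctorAdd_lin (M : DGModule A) (i j : ℤ) :
    Hom.lin ((shiftFunctorAdd (DGModule A) i j).hom.app M) =
      (LinearMap.id : M.carrier →ₗ[ℚ] M.carrier) := rfl

lemma shiftFunctorAdd'_lin (M : DGModule A) (i j k : ℤ) (h : i + j = k) :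
    Hom.lin ((shiftFunctorAdd' (DGModule A) i j k h).hom.app M) =
      (LinearMap.id : M.carrier →ₗ[ℚ] M.carrier) := by
  subst h
  rw [shiftFunctorAdd'_eq_shiftFunctorAdd]
  rfl

lemma shiftFunctorAdd'_inv_lin (M : DGModule A) (i j k : ℤ) (h : i + j = k) :
    Hom.lin ((shiftFunctorAdd' (DGModule A) i j k h).inv.app M) =
      (LinearMap.id : M.carrier →ₗ[ℚ] M.carrier) := by
  subst h
  rw [shiftFunctorAdd'_eq_shiftFunctorAdd]
  rfl

lemma shiftFunctorComm_lin (M : DGModule A) (i j : ℤ) :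
    Hom.lin ((shiftFunctorComm (DGModule A) i j).hom.app M) =
      (LinearMap.id : M.carrier →ₗ[ℚ] M.carrier) := by
  rw [shiftFunctorComm_eq _ i j (i + j) rfl]
  have h1 := shiftFunctorAdd'_inv_lin M i j (i + j) rfl
  have h2 := shiftFunctorAdd'_lin M j i (i + j) (add_comm j i)
  refine (congrArg₂ (fun (a b : M.carrier →ₗ[ℚ] M.carrier) => b ∘ₗ a) h1 h2)

section

variable {M N : DGModule A} (f : M ⟶ N)

/-- The comparison `Cone(f)[-1] ≅ Cone(-f[-1])`, multiplication by `-1`. -/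
def coneShiftHom : (cone f)⟦(-1 : ℤ)⟧ ⟶ cone (-f⟦(-1 : ℤ)⟧') where
  lin := -(LinearMap.id : N.carrier × M.carrier →ₗ[ℚ] N.carrier × M.carrier)
  isHom := IsHom.neg
    { map_deg := fun k (x : N.carrier × M.carrier) hx => by
        have h : x.1 ∈ N.deg (k + 0 + -1) ∧ x.2 ∈ M.deg (k + 0 + 1 + -1) := by
          rw [add_zero, add_right_comm]
          exact hx
        exact h
      equivariant := fun v => ((IsHom.id (cone f)).equivariant v)
      map_act := fun p a ha (x : N.carrier × M.carrier) => by
        have h : ((N.act (A.twist (-1) a) x.1, M.act (A.twist 1 (A.twist (-1) a)) x.2) :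
            N.carrier × M.carrier) = (-1 : ℚ) ^ ((0 : ℤ) * p) •
              (N.act (A.twist (-1) a) x.1, M.act (A.twist (-1) (A.twist 1 a)) x.2) := by
          rw [zero_mul, zpow_zero, one_smul, Cdga.twist_twist, Cdga.twist_twist]
          rfl
        exact h }
  comm (x : N.carrier × M.carrier) := by
    have h : -((-1 : ℚ) ^ (-1 : ℤ) • ((N.d x.1 + f.lin x.2, -M.d x.2) :
        N.carrier × M.carrier)) = ((-1 : ℚ) ^ (-1 : ℤ) • N.d (-x.1) + (-f.lin (-x.2)),
          -((-1 : ℚ) ^ (-1 : ℤ) • M.d (-x.2))) := by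
      simp
    exact h

/-- The inverse of `coneShiftHom`. -/
def coneShiftInv : cone (-f⟦(-1 : ℤ)⟧') ⟶ (cone f)⟦(-1 : ℤ)⟧ where
  lin := -(LinearMap.id : N.carrier × M.carrier →ₗ[ℚ] N.carrier × M.carrier)
  isHom := IsHom.neg
    { map_deg := fun k (x : N.carrier × M.carrier) hx => by
        have h : x.1 ∈ N.deg (k + 0 + -1) ∧ x.2 ∈ M.deg (k + 0 + -1 + 1) := by
          rw [add_zero, add_right_comm]
          exact hx
        exact h
      equivariant := fun v => ((IsHom.id (cone f)).equivariant v)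
      map_act := fun p a ha (x : N.carrier × M.carrier) => by
        have h : ((N.act (A.twist (-1) a) x.1, M.act (A.twist (-1) (A.twist 1 a)) x.2) :
            N.carrier × M.carrier) = (-1 : ℚ) ^ ((0 : ℤ) * p) •
              (N.act (A.twist (-1) a) x.1, M.act (A.twist 1 (A.twist (-1) a)) x.2) := by
          rw [zero_mul, zpow_zero, one_smul, Cdga.twist_twist, Cdga.twist_twist]
          rfl
        exact h }
  comm (x : N.carrier × M.carrier) := by
    have h : -(((-1 : ℚ) ^ (-1 : ℤ) • N.d x.1 + (-f.lin x.2),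
          -((-1 : ℚ) ^ (-1 : ℤ) • M.d x.2)) : N.carrier × M.carrier) =
        (-1 : ℚ) ^ (-1 : ℤ) • (N.d (-x.1) + f.lin (-x.2), -M.d (-x.2)) := by
      simp
    exact h

lemma coneShift_comm₂ : ((-1 : ℤ).negOnePow • (coneInl f)⟦(-1 : ℤ)⟧') ≫ coneShiftHom f =
    coneInl (-f⟦(-1 : ℤ)⟧') := by
  rw [neg_one_units_smul]
  refine hom_ext (LinearMap.ext fun (x : N.carrier) => ?_)
  exact neg_neg ((x, 0) : N.carrier × M.carrier)

lemma coneShift_comm₃ : (-1 : ℤ).negOnePow • ((coneSnd f)⟦(-1 : ℤ)⟧' ≫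
      (shiftFunctorComm (DGModule A) 1 (-1)).hom.app M) =
    coneShiftHom f ≫ coneSnd (-f⟦(-1 : ℤ)⟧') := by
  rw [neg_one_units_smul]
  refine hom_ext (LinearMap.ext fun (x : N.carrier × M.carrier) => ?_)
  have h1 := LinearMap.congr_fun (shiftFunctorComm_lin M 1 (-1)) (x.2)
  exact congrArg (fun z : M.carrier => -z) h1

/-- The isomorphism `Cone(f)[-1] ≅ Cone(-f[-1])`. -/
def coneShiftObjIso : (cone f)⟦(-1 : ℤ)⟧ ≅ cone (-f⟦(-1 : ℤ)⟧') where
  hom := coneShiftHom f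
  inv := coneShiftInv f
  hom_inv_id := hom_ext (LinearMap.ext fun (x : N.carrier × M.carrier) => neg_neg x)
  inv_hom_id := hom_ext (LinearMap.ext fun (x : N.carrier × M.carrier) => neg_neg x)

/-- The shift by `-1` of a cone sequence is a cone sequence. -/
noncomputable def coneShiftIso : (Triangle.shiftFunctor (DGModule A) (-1)).obj (coneTriangle f) ≅
    coneTriangle (-f⟦(-1 : ℤ)⟧') :=
  Triangle.isoMk _ _ (Iso.refl _) (Iso.refl _) (coneShiftObjIso f)
    ((Category.comp_id _).trans ((neg_one_units_smul (f⟦(-1 : ℤ)⟧')).trans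
      (Category.id_comp _).symm))
    ((coneShift_comm₂ f).trans (Category.id_comp _).symm)
    ((congrArg (fun z => _ ≫ z) (CategoryTheory.Functor.map_id _ _)).trans
      ((Category.comp_id _).trans (coneShift_comm₃ f)))

end

end DGModule
namespace HoCat

variable {A : Cdga H}

open DGModule

/-- The cone sequence of `f` in the homotopy category. -/
noncomputable def coneTri {M N : DGModule A} (f : M ⟶ N) : Triangle (HoCat A) :=
  (quot A).mapTriangle.obj (coneTriangle f)

lemma quot_comm {M N N' P : DGModule A} {f : M ⟶ N} {g : N ⟶ P} {f' : M ⟶ N'} {g' : N' ⟶ P}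
    (h : homotopic A (f ≫ g) (f' ≫ g')) :
    (quot A).map f ≫ (quot A).map g = (quot A).map f' ≫ (quot A).map g' := by
  rw [← Functor.map_comp, ← Functor.map_comp]
  exact (quot_eq_iff _ _).2 h

lemma homotopic_refl {M N : DGModule A} (f : M ⟶ N) : homotopic A f f :=
  (quot_eq_iff _ _).1 rfl

lemma homotopic_of_eq {M N : DGModule A} {f g : M ⟶ N} (h : f = g) : homotopic A f g :=
  h ▸ homotopic_refl f

/-- A morphism of triangles up to homotopy induces a morphism of triangles. -/
noncomputable def triMap (T T' : Triangle (DGModule A)) (a : T.obj₁ ⟶ T'.obj₁)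
    (b : T.obj₂ ⟶ T'.obj₂) (c : T.obj₃ ⟶ T'.obj₃)
    (h₁ : homotopic A (T.mor₁ ≫ b) (a ≫ T'.mor₁)) (h₂ : homotopic A (T.mor₂ ≫ c) (b ≫ T'.mor₂))
    (h₃ : homotopic A (T.mor₃ ≫ a⟦(1 : ℤ)⟧') (c ≫ T'.mor₃)) :
    (quot A).mapTriangle.obj T ⟶ (quot A).mapTriangle.obj T' where
  hom₁ := (quot A).map a
  hom₂ := (quot A).map b
  hom₃ := (quot A).map c
  comm₁ := quot_comm h₁
  comm₂ := quot_comm h₂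
  comm₃ := by
    change ((quot A).map T.mor₃ ≫ ((quot A).commShiftIso (1 : ℤ)).hom.app T.obj₁) ≫
      ((quot A).map a)⟦(1 : ℤ)⟧' = (quot A).map c ≫ (quot A).map T'.mor₃ ≫
        ((quot A).commShiftIso (1 : ℤ)).hom.app T'.obj₁
    have := ((quot A).commShiftIso (1 : ℤ)).hom.naturality a
    dsimp only [Functor.comp_map] at this
    rw [Category.assoc, ← this, ← Category.assoc, ← Category.assoc, quot_comm h₃]

/-- A homotopy equivalence of triangles induces an isomorphism of triangles. -/
lemma triIso (T T' : Triangle (DGModule A)) (a : T.obj₁ ⟶ T'.obj₁)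
    (b : T.obj₂ ⟶ T'.obj₂) (c : T.obj₃ ⟶ T'.obj₃)
    (h₁ : homotopic A (T.mor₁ ≫ b) (a ≫ T'.mor₁)) (h₂ : homotopic A (T.mor₂ ≫ c) (b ≫ T'.mor₂))
    (h₃ : homotopic A (T.mor₃ ≫ a⟦(1 : ℤ)⟧') (c ≫ T'.mor₃))
    (ha : IsIso ((quot A).map a)) (hb : IsIso ((quot A).map b)) (hc : IsIso ((quot A).map c)) :
    Nonempty ((quot A).mapTriangle.obj T ≅ (quot A).mapTriangle.obj T') := by
  have := Triangle.isIso_of_isIsos (triMap T T' a b c h₁ h₂ h₃) ha hb hc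
  exact ⟨asIso (triMap T T' a b c h₁ h₂ h₃)⟩

lemma isIso_quot_id (M : DGModule A) : IsIso ((quot A).map (𝟙 M)) := inferInstance

lemma isIso_quot_map {M N : DGModule A} (f : M ⟶ N) (g : N ⟶ M)
    (h₁ : homotopic A (f ≫ g) (𝟙 _)) (h₂ : homotopic A (𝟙 _) (g ≫ f)) :
    IsIso ((quot A).map f) :=
  ⟨(quot A).map g, ((quot A).map_comp f g).symm.trans
      (((quot_eq_iff _ _).2 h₁).trans ((quot A).map_id _)),
    ((quot A).map_comp g f).symm.trans
      (((quot_eq_iff _ _).2 h₂).symm.trans ((quot A).map_id _))⟩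

/-- A triangle in `K` is distinguished if it is isomorphic to a cone sequence. -/
def distinguished (A : Cdga H) : Set (Triangle (HoCat A)) :=
  {T | ∃ (M N : DGModule A) (f : M ⟶ N), Nonempty (T ≅ coneTri f)}

lemma isomorphic_distinguished (T₁ : Triangle (HoCat A)) (hT₁ : T₁ ∈ distinguished A)
    (T₂ : Triangle (HoCat A)) (e : T₂ ≅ T₁) : T₂ ∈ distinguished A := by
  obtain ⟨X, Y, f, ⟨e'⟩⟩ := hT₁
  exact ⟨X, Y, f, ⟨e ≪≫ e'⟩⟩

lemma contractible_distinguished (X : HoCat A) :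
    Pretriangulated.contractibleTriangle X ∈ distinguished A := by
  obtain ⟨M⟩ := X
  refine ⟨M, M, 𝟙 M, ⟨?_⟩⟩
  exact Triangle.isoMk _ _ (Iso.refl _) (Iso.refl _) (isZero_quot_coneId M).isoZero.symm
    ((Category.comp_id _).trans (Category.id_comp _).symm)
    ((isZero_quot_coneId M).eq_of_tgt _ _)
    ((isZero_zero _).eq_of_src _ _)

lemma cocone_triangle {X Y : HoCat A} (f : X ⟶ Y) :
    ∃ (Z : HoCat A) (g : Y ⟶ Z) (h : Z ⟶ X⟦(1 : ℤ)⟧), Triangle.mk f g h ∈ distinguished A := by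
  obtain ⟨M⟩ := X
  obtain ⟨N⟩ := Y
  obtain ⟨f, rfl⟩ := (quot A).map_surjective f
  exact ⟨_, _, _, ⟨M, N, f, ⟨Iso.refl _⟩⟩⟩

lemma rotate_coneTri {M N : DGModule A} (f : M ⟶ N) :
    Nonempty ((coneTri f).rotate ≅ coneTri (coneInl f)) := by
  obtain ⟨e⟩ := triIso (coneTriangle f).rotate (coneTriangle (coneInl f)) (𝟙 _) (𝟙 _) (rotHom f)
    (homotopic_of_eq ((Category.comp_id _).trans (Category.id_comp _).symm))
    ((Congruence.equivalence (r := homotopic A)).symm (by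
      have := rotHom_comm f
      rw [← Category.id_comp (coneInl (coneInl f))] at this
      exact this))
    (homotopic_of_eq (by
      refine hom_ext (LinearMap.ext fun (x : M.carrier) => ?_)
      have h : -f.lin x = 0 - f.lin x := (zero_sub _).symm
      exact h))
    (isIso_quot_id _) (isIso_quot_id _)
    (isIso_quot_map (rotHom f) (rotInv f) (homotopic_of_eq (rotInv_rotHom f)) (rotHom_rotInv f))
  exact ⟨((quot A).mapTriangleRotateIso.app (coneTriangle f)) ≪≫ e⟩

lemma rotate_distinguished (T : Triangle (HoCat A)) (hT : T ∈ distinguished A) :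
    T.rotate ∈ distinguished A := by
  obtain ⟨M, N, f, ⟨e⟩⟩ := hT
  exact ⟨_, _, _, ⟨(rotate _).mapIso e ≪≫ (rotate_coneTri f).some⟩⟩

lemma shift_distinguished (T : Triangle (HoCat A)) (hT : T ∈ distinguished A) :
    (Triangle.shiftFunctor _ (-1)).obj T ∈ distinguished A := by
  obtain ⟨M, N, f, ⟨e⟩⟩ := hT
  exact ⟨_, _, _, ⟨(Triangle.shiftFunctor _ (-1)).mapIso e ≪≫
    ((quot A).mapTriangle.commShiftIso (-1 : ℤ)).symm.app (coneTriangle f) ≪≫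
    (quot A).mapTriangle.mapIso (coneShiftIso f)⟩⟩

lemma invRotate_distinguished (T : Triangle (HoCat A)) (hT : T ∈ distinguished A) :
    T.invRotate ∈ distinguished A :=
  isomorphic_distinguished _
    (shift_distinguished _ (rotate_distinguished _ (rotate_distinguished _ hT))) _
    ((invRotateIsoRotateRotateShiftFunctorNegOne _).app T)

lemma rotate_distinguished_triangle (T : Triangle (HoCat A)) :
    T ∈ distinguished A ↔ T.rotate ∈ distinguished A := by
  constructor
  · exact rotate_distinguished T
  · intro hT
    exact isomorphic_distinguished _ (invRotate_distinguished T.rotate hT) _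
      ((triangleRotation _).unitIso.app T)

lemma exists_coneTri_map {M N M' N' : DGModule A} (f : M ⟶ N) (f' : M' ⟶ N')
    (a : M ⟶ M') (b : N ⟶ N') (h : homotopic A (f ≫ b) (a ≫ f')) :
    ∃ φ : coneTri f ⟶ coneTri f', φ.hom₁ = (quot A).map a ∧ φ.hom₂ = (quot A).map b := by
  have h' := h
  obtain ⟨k, hk, e⟩ := h
  refine ⟨triMap (coneTriangle f) (coneTriangle f') a b (coneMap a b k hk e) h'
    (homotopic_of_eq ?_) (homotopic_of_eq ?_), rfl, rfl⟩
  · refine hom_ext (LinearMap.ext fun (x : N.carrier) => ?_)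
    have h : ((b.lin x + k 0, 0) + (0, a.lin 0) : N'.carrier × M'.carrier) = (b.lin x, 0) := by
      simp
    exact h
  · refine hom_ext (LinearMap.ext fun (x : N.carrier × M.carrier) => ?_)
    have h : a.lin x.2 = 0 + a.lin x.2 := (zero_add _).symm
    exact h

section Conj

variable {C : Type*} [Category C] [HasShift C ℤ] {T₁ T₂ S₁ S₂ : Triangle C} (e₁ : T₁ ≅ S₁)
  (e₂ : T₂ ≅ S₂) (a : T₁.obj₁ ⟶ T₂.obj₁) (b : T₁.obj₂ ⟶ T₂.obj₂)

lemma conj_comm (fac : T₁.mor₁ ≫ b = a ≫ T₂.mor₁) :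
    S₁.mor₁ ≫ (e₁.inv.hom₂ ≫ b ≫ e₂.hom.hom₂) = (e₁.inv.hom₁ ≫ a ≫ e₂.hom.hom₁) ≫ S₂.mor₁ := by
  have c₁ := e₁.inv.comm₁
  have c₂ := e₂.hom.comm₁
  rw [reassoc_of% c₁, reassoc_of% fac, c₂]
  simp only [Category.assoc]

lemma conj_exists (φ : S₁ ⟶ S₂) (h₁ : φ.hom₁ = e₁.inv.hom₁ ≫ a ≫ e₂.hom.hom₁)
    (h₂ : φ.hom₂ = e₁.inv.hom₂ ≫ b ≫ e₂.hom.hom₂) :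
    ∃ (c : T₁.obj₃ ⟶ T₂.obj₃), T₁.mor₂ ≫ c = b ≫ T₂.mor₂ ∧
      T₁.mor₃ ≫ a⟦(1 : ℤ)⟧' = c ≫ T₂.mor₃ := by
  let γ := e₁.hom ≫ φ ≫ e₂.inv
  have g₁ : γ.hom₁ = a := by simp [γ, h₁]
  have g₂ : γ.hom₂ = b := by simp [γ, h₂]
  refine ⟨γ.hom₃, ?_, ?_⟩
  · rw [← g₂]; exact γ.comm₂
  · rw [← g₁]; exact γ.comm₃

end Conj

lemma complete_morphism (T₁ T₂ : Triangle (HoCat A))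
    (hT₁ : T₁ ∈ distinguished A) (hT₂ : T₂ ∈ distinguished A)
    (a : T₁.obj₁ ⟶ T₂.obj₁) (b : T₁.obj₂ ⟶ T₂.obj₂) (fac : T₁.mor₁ ≫ b = a ≫ T₂.mor₁) :
    ∃ (c : T₁.obj₃ ⟶ T₂.obj₃), T₁.mor₂ ≫ c = b ≫ T₂.mor₂ ∧
      T₁.mor₃ ≫ a⟦(1 : ℤ)⟧' = c ≫ T₂.mor₃ := by
  obtain ⟨M₁, N₁, f₁, ⟨e₁⟩⟩ := hT₁
  obtain ⟨M₂, N₂, f₂, ⟨e₂⟩⟩ := hT₂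
  obtain ⟨a', ha'⟩ := (quot A).map_surjective (X := M₁) (Y := M₂) (e₁.inv.hom₁ ≫ a ≫ e₂.hom.hom₁)
  obtain ⟨b', hb'⟩ := (quot A).map_surjective (X := N₁) (Y := N₂) (e₁.inv.hom₂ ≫ b ≫ e₂.hom.hom₂)
  obtain ⟨φ, h₁, h₂⟩ := exists_coneTri_map f₁ f₂ a' b' (by
    rw [← quot_eq_iff]
    refine ((quot A).map_comp _ _).trans (Eq.trans ?_ ((quot A).map_comp _ _).symm)
    rw [ha', hb']
    exact conj_comm e₁ e₂ a b fac)
  exact conj_exists e₁ e₂ a b φ (h₁.trans ha') (h₂.trans hb')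

/-- The triangulated structure on the homotopy category. -/
noncomputable instance : Pretriangulated (HoCat A) where
  distinguishedTriangles := distinguished A
  isomorphic_distinguished := isomorphic_distinguished
  contractible_distinguished := contractible_distinguished
  distinguished_cocone_triangle := cocone_triangle
  rotate_distinguished_triangle := rotate_distinguished_triangle
  complete_distinguished_triangle_morphism := complete_morphism

end HoCat
namespace HoCat

variable {A : Cdga H}

open DGModule

/-- The last map of the cone sequence of `f` in the homotopy category. -/
noncomputable def coneδ {M N : DGModule A} (f : M ⟶ N) :
    (quot A).obj (cone f) ⟶ ((quot A).obj M)⟦(1 : ℤ)⟧ :=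
  (quot A).map (coneSnd f) ≫ ((quot A).commShiftIso (1 : ℤ)).hom.app M

lemma coneTri_distinguished {M N : DGModule A} (f : M ⟶ N) :
    Triangle.mk ((quot A).map f) ((quot A).map (coneInl f)) (coneδ f) ∈ distTriang (HoCat A) :=
  ⟨M, N, f, ⟨Iso.refl _⟩⟩

lemma coneδ_naturality {M N M' N' : DGModule A} (f : M ⟶ N) (f' : M' ⟶ N') (c : cone f ⟶ cone f')
    (a : M ⟶ M') (h : c ≫ coneSnd f' = coneSnd f ≫ a⟦(1 : ℤ)⟧') :
    (quot A).map c ≫ coneδ f' = coneδ f ≫ ((quot A).map a)⟦(1 : ℤ)⟧' := by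
  have := ((quot A).commShiftIso (1 : ℤ)).hom.naturality a
  dsimp only [Functor.comp_map] at this
  rw [coneδ, coneδ, Category.assoc, ← this, ← Category.assoc, ← Category.assoc,
    quot_comm (homotopic_of_eq h)]

section

variable {X Y Z : DGModule A} (f : X ⟶ Y) (g : Y ⟶ Z)

lemma octa_c₁ : coneInl f ≫ octa₁ f g = g ≫ coneInl (f ≫ g) := by
  refine hom_ext (LinearMap.ext fun (x : Y.carrier) => ?_)
  exact octa₁_lin f g (x, 0)

lemma octa_c₂ : octa₁ f g ≫ coneSnd (f ≫ g) = coneSnd f ≫ (𝟙 X)⟦(1 : ℤ)⟧' := by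
  refine hom_ext (LinearMap.ext fun (x : Y.carrier × X.carrier) => ?_)
  exact congrArg Prod.snd (octa₁_lin f g x)

lemma octa_c₃ : coneInl (f ≫ g) ≫ octa₂ f g = coneInl g := by
  refine hom_ext (LinearMap.ext fun (x : Z.carrier) => ?_)
  refine (octa₂_lin f g (x, 0)).trans ?_
  have h : ((x, f.lin 0) : Z.carrier × Y.carrier) = (x, 0) := by simp
  exact h

lemma octa_c₄ : octa₂ f g ≫ coneSnd g = coneSnd (f ≫ g) ≫ f⟦(1 : ℤ)⟧' := by
  refine hom_ext (LinearMap.ext fun (x : Z.carrier × X.carrier) => ?_)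
  exact congrArg Prod.snd (octa₂_lin f g x)

lemma octa_distinguished :
    Triangle.mk ((quot A).map (octa₁ f g)) ((quot A).map (octa₂ f g))
      (coneδ g ≫ ((quot A).map (coneInl f))⟦(1 : ℤ)⟧') ∈ distTriang (HoCat A) := by
  obtain ⟨e⟩ := triIso (Triangle.mk (octa₁ f g) (octa₂ f g) (coneSnd g ≫ (coneInl f)⟦(1 : ℤ)⟧'))
    (coneTriangle (octa₁ f g)) (𝟙 _) (𝟙 _) (octaHom f g)
    (homotopic_of_eq ((Category.comp_id _).trans (Category.id_comp _).symm))
    ((Congruence.equivalence (r := homotopic A)).symm (by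
      have := octa_comm f g
      rw [← Category.id_comp (coneInl (octa₁ f g))] at this
      exact this))
    (homotopic_of_eq (by
      refine hom_ext (LinearMap.ext fun (x : Z.carrier × Y.carrier) => ?_)
      have h : ((x.2, 0) : Y.carrier × X.carrier) = 0 + (x.2, 0) := (zero_add _).symm
      exact h))
    (isIso_quot_id _) (isIso_quot_id _)
    (isIso_quot_map (octaHom f g) (octaInv f g) (homotopic_of_eq (octaHom_octaInv f g))
      (octaInv_octaHom f g))
  refine isomorphic_distinguished _ ⟨_, _, octa₁ f g, ⟨e⟩⟩ _ (eqToIso ?_)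
  have := ((quot A).commShiftIso (1 : ℤ)).hom.naturality (coneInl f)
  dsimp only [Functor.comp_map] at this
  have h : coneδ g ≫ ((quot A).map (coneInl f))⟦(1 : ℤ)⟧' =
      (quot A).map (coneSnd g ≫ (coneInl f)⟦(1 : ℤ)⟧') ≫
        ((quot A).commShiftIso (1 : ℤ)).hom.app (cone f) := by
    rw [coneδ, Category.assoc, ← this, ← Category.assoc, ← Functor.map_comp]
  rw [h]
  rfl

end

noncomputable instance : IsTriangulated (HoCat A) :=
  IsTriangulated.mk' (by
    rintro ⟨X⟩ ⟨Y⟩ ⟨Z⟩ f g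
    obtain ⟨f, rfl⟩ := (quot A).map_surjective f
    obtain ⟨g, rfl⟩ := (quot A).map_surjective g
    refine ⟨_, _, _, _, _, _, _, _, Iso.refl _, Iso.refl _, Iso.refl _,
      (Category.comp_id _).trans (Category.id_comp _).symm,
      (Category.comp_id _).trans (Category.id_comp _).symm,
      _, _, coneTri_distinguished f, _, _, coneTri_distinguished g, _, _,
      coneTri_distinguished (f ≫ g), ⟨?_⟩⟩
    refine Triangulated.Octahedron.mk ((quot A).map (octa₁ f g)) ((quot A).map (octa₂ f g))
      (quot_comm (homotopic_of_eq (octa_c₁ f g))) ?_ ?_ ?_ (octa_distinguished f g)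
    · refine (coneδ_naturality f (f ≫ g) (octa₁ f g) (𝟙 X) (octa_c₂ f g)).trans ?_
      rw [CategoryTheory.Functor.map_id, CategoryTheory.Functor.map_id]
      exact Category.comp_id _
    · exact ((quot A).map_comp _ _).symm.trans (congrArg (quot A).map (octa_c₃ f g))
    · exact (coneδ_naturality (f ≫ g) g (octa₂ f g) f (octa_c₄ f g)).symm)

end HoCat
/-! ### Quasi-isomorphisms and the derived category -/

namespace DGModule

variable {A : Cdga H}

/-- The (total) cohomology `ker d / im d = ⨁ₙ Hⁿ(M)`. -/
abbrev Coh (M : DGModule A) : Type u :=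
  LinearMap.ker M.d ⧸ (LinearMap.range M.d).submoduleOf (LinearMap.ker M.d)

lemma map_mem_ker {M N : DGModule A} (f : M ⟶ N) (x : M.carrier) (hx : x ∈ LinearMap.ker M.d) :
    f.lin x ∈ LinearMap.ker N.d := by
  rw [LinearMap.mem_ker] at hx ⊢
  rw [← f.comm, hx, map_zero]

/-- The map induced by `f` on cohomology. -/
def cohMap {M N : DGModule A} (f : M ⟶ N) : M.Coh →ₗ[ℚ] N.Coh :=
  Submodule.mapQ _ _ (f.lin.restrict (map_mem_ker f)) (by
    rintro ⟨x, hx⟩ ⟨y, hy⟩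
    exact ⟨f.lin y, by rw [← f.comm]; exact congrArg f.lin hy⟩)

/-- `f` is a quasi-isomorphism of complexes of vector spaces. -/
def IsQuasiIso {M N : DGModule A} (f : M ⟶ N) : Prop := Function.Bijective (cohMap f)

/-- `M` is acyclic. -/
def IsAcyclic (M : DGModule A) : Prop := ∀ x, M.d x = 0 → ∃ y, M.d y = x

lemma isQuasiIso_iff {M N : DGModule A} (f : M ⟶ N) : IsQuasiIso f ↔
    (∀ x, M.d x = 0 → ∀ y, N.d y = f.lin x → ∃ z, M.d z = x) ∧
    (∀ y, N.d y = 0 → ∃ x z, M.d x = 0 ∧ f.lin x + N.d z = y) := by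
  refine and_congr ?_ ?_
  · rw [← LinearMap.ker_eq_bot, LinearMap.ker_eq_bot']
    constructor
    · intro h x hx y hy
      have := h (Submodule.Quotient.mk ⟨x, hx⟩) (by
        rw [cohMap, Submodule.mapQ_apply, Submodule.Quotient.mk_eq_zero]
        exact ⟨y, hy⟩)
      rw [Submodule.Quotient.mk_eq_zero] at this
      exact this
    · intro h x
      obtain ⟨⟨x, hx⟩, rfl⟩ := Submodule.Quotient.mk_surjective _ x
      rw [cohMap, Submodule.mapQ_apply, Submodule.Quotient.mk_eq_zero,
        Submodule.Quotient.mk_eq_zero]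
      rintro ⟨y, hy⟩
      exact h x hx y hy
  · constructor
    · intro h y hy
      obtain ⟨x, hx⟩ := h (Submodule.Quotient.mk ⟨y, hy⟩)
      obtain ⟨⟨x, hx'⟩, rfl⟩ := Submodule.Quotient.mk_surjective _ x
      rw [cohMap, Submodule.mapQ_apply, eq_comm, Submodule.Quotient.eq] at hx
      obtain ⟨z, hz⟩ := hx
      have h2 : N.d z = y - f.lin x := hz
      exact ⟨x, z, hx', by rw [h2]; abel⟩
    · intro h y
      obtain ⟨⟨y, hy⟩, rfl⟩ := Submodule.Quotient.mk_surjective _ y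
      obtain ⟨x, z, hx, hz⟩ := h y hy
      refine ⟨Submodule.Quotient.mk ⟨x, hx⟩, ?_⟩
      rw [cohMap, Submodule.mapQ_apply, eq_comm, Submodule.Quotient.eq]
      refine ⟨z, ?_⟩
      have h2 : N.d z = y - f.lin x := by rw [← hz]; abel
      exact h2

lemma isQuasiIso_iff_cone {M N : DGModule A} (f : M ⟶ N) :
    IsQuasiIso f ↔ IsAcyclic (cone f) := by
  rw [isQuasiIso_iff]
  constructor
  · rintro ⟨h₁, h₂⟩ ⟨y, x⟩ h
    rw [cone_d, Prod.mk_eq_zero, neg_eq_zero] at h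
    obtain ⟨z, hz⟩ := h₁ x h.2 (-y) (by rw [map_neg]; exact neg_eq_of_add_eq_zero_right h.1)
    obtain ⟨x', w, hx', hw⟩ := h₂ (y + f.lin z) (by rw [map_add, ← f.comm, hz]; exact h.1)
    refine ⟨(w, x' - z), ?_⟩
    rw [cone_d]
    refine Prod.ext ?_ ?_
    · change N.d w + f.lin (x' - z) = y
      rw [map_sub, ← add_sub_assoc, add_comm, hw]
      abel
    · change -M.d (x' - z) = x
      rw [map_sub, hx', hz]
      abel
  · intro h
    constructor
    · intro x hx y hy
      obtain ⟨⟨z, w⟩, hz⟩ := h (-y, x) (by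
        rw [cone_d]
        refine Prod.ext ?_ ?_
        · change N.d (-y) + f.lin x = 0
          rw [map_neg, hy]; abel
        · change -M.d x = 0
          rw [hx, neg_zero])
      refine ⟨-w, ?_⟩
      rw [map_neg]
      exact congrArg Prod.snd hz
    · intro y hy
      obtain ⟨⟨z, w⟩, hz⟩ := h (y, 0) (by
        rw [cone_d]
        refine Prod.ext ?_ ?_
        · change N.d y + f.lin 0 = 0
          rw [hy, map_zero, add_zero]
        · change -M.d 0 = 0
          rw [map_zero, neg_zero])
      refine ⟨w, z, neg_eq_zero.1 (congrArg Prod.snd hz), ?_⟩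
      rw [add_comm]
      exact congrArg Prod.fst hz

end DGModule

namespace HoCat

variable (A : Cdga H)

open DGModule

/-- The class of quasi-isomorphisms in the homotopy category. -/
def qis : MorphismProperty (HoCat A) := fun X Y φ =>
  ∃ f : X.as ⟶ Y.as, (quot A).map f = φ ∧ IsQuasiIso f

/-- The acyclic dg modules, as objects of the homotopy category. -/
def acyclic : ObjectProperty (HoCat A) := fun X => IsAcyclic X.as

variable {A}

instance : (acyclic A).IsClosedUnderIsomorphisms where
  of_iso := by
    rintro ⟨M⟩ ⟨N⟩ e (hM : IsAcyclic M) (y : N.carrier) (hy : N.d y = 0)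
    obtain ⟨f, hf⟩ := (quot A).map_surjective (X := M) (Y := N) e.hom
    obtain ⟨g, hg⟩ := (quot A).map_surjective (X := N) (Y := M) e.inv
    have : homotopic A (g ≫ f) (𝟙 N) := by
      rw [← quot_eq_iff]
      refine ((quot A).map_comp g f).trans ?_
      rw [hg, hf]
      exact e.inv_hom_id
    obtain ⟨h, -, e'⟩ := this
    obtain ⟨x, hx⟩ := hM (g.lin y) (by rw [← g.comm, hy, map_zero])
    have h1 : f.lin (g.lin y) - y = N.d (h y) + h (N.d y) := e' y
    rw [hy, map_zero, add_zero, ← hx, f.comm] at h1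
    refine ⟨f.lin x - h y, ?_⟩
    change N.d (f.lin x - h y) = y
    rw [map_sub, ← h1]
    abel

instance : (acyclic A).IsTriangulated where
  exists_zero := ⟨(quot A).obj (zeroModule A), (quot A).map_isZero isZero_zeroModule,
    fun x _ => ⟨x, rfl⟩⟩
  isStableUnderShiftBy n := ⟨by
    rintro ⟨M⟩ (hM : IsAcyclic M)
    refine (acyclic A).prop_of_iso (((quot A).commShiftIso n).app M) ?_
    intro (x : M.carrier) (hx : (-1 : ℚ) ^ n • M.d x = 0)
    obtain ⟨y, hy⟩ := hM x (by
      have := congrArg (fun z => (-1 : ℚ) ^ n • z) hx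
      simpa only [smul_smul, eps_sq, one_smul, smul_zero] using this)
    refine ⟨(-1 : ℚ) ^ n • y, ?_⟩
    change (-1 : ℚ) ^ n • M.d ((-1 : ℚ) ^ n • y) = x
    rw [map_smul, smul_smul, eps_sq, one_smul, hy]⟩
  toIsTriangulatedClosed₂ := .mk' (by
    rintro T ⟨M, N, f, ⟨e⟩⟩ h₁ h₃
    have h₁ : IsAcyclic M := (acyclic A).prop_of_iso (Triangle.π₁.mapIso e) h₁
    have h₃ : IsAcyclic (cone f) := (acyclic A).prop_of_iso (Triangle.π₃.mapIso e) h₃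
    refine (acyclic A).prop_of_iso (Triangle.π₂.mapIso e).symm ?_
    intro (y : N.carrier) (hy : N.d y = 0)
    obtain ⟨⟨z, w⟩, hz⟩ := h₃ (y, 0) (by
      rw [cone_d]
      refine Prod.ext ?_ ?_
      · change N.d y + f.lin 0 = 0
        rw [hy, map_zero, add_zero]
      · change -M.d 0 = 0
        rw [map_zero, neg_zero])
    obtain ⟨x, hx⟩ := h₁ w (neg_eq_zero.1 (congrArg Prod.snd hz))
    have h2 : N.d z + f.lin w = y := congrArg Prod.fst hz
    exact ⟨z + f.lin x, by
      change N.d (z + f.lin x) = y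
      rw [map_add, ← f.comm, hx, h2]⟩)

lemma qis_eq : qis A = (acyclic A).trW := by
  ext X Y φ
  rw [ObjectProperty.trW_iff]
  constructor
  · rintro ⟨f, rfl, hf⟩
    exact ⟨_, _, _, coneTri_distinguished f, (isQuasiIso_iff_cone f).1 hf⟩
  · rintro ⟨Z, g, h, hT, hZ⟩
    obtain ⟨f, hf⟩ := (quot A).map_surjective (X := X.as) (Y := Y.as) φ
    refine ⟨f, hf, (isQuasiIso_iff_cone f).2 ?_⟩
    subst hf
    have e := isoTriangleOfIso₁₂ _ _ hT (coneTri_distinguished f) (Iso.refl _) (Iso.refl _)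
      ((Category.comp_id _).trans (Category.id_comp _).symm)
    exact (acyclic A).prop_of_iso (Triangle.π₃.mapIso e) hZ

instance : (qis A).HasLeftCalculusOfFractions := by rw [qis_eq]; infer_instance
instance : (qis A).HasRightCalculusOfFractions := by rw [qis_eq]; infer_instance
instance : (qis A).IsCompatibleWithTriangulation := by rw [qis_eq]; infer_instance

end HoCat

/-- The derived category `D`: the localization of the homotopy category at the quasi-isomorphisms.
Its triangulated structure is the one for which the localization functor is exact: the distinguished
triangles are those isomorphic to the image of a distinguished triangle. -/
abbrev DerCat (A : Cdga H) := (HoCat.qis A).Localization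

/-- The localization functor. -/
abbrev DerCat.Q (A : Cdga H) : HoCat A ⥤ DerCat A := (HoCat.qis A).Q
/-! ### Cell modules -/

section Cell

/-- The map `⨁ⱼ A ⊗ V j → M`, `a ⊗ v ↦ a (b j v)`. -/
noncomputable def cellMap {A : Cdga H} (M : DGModule A) {J : Type u} (V : J → Type u)
    [∀ j, AddCommGroup (V j)] [∀ j, Module ℚ (V j)] (b : ∀ j, V j →ₗ[ℚ] M.carrier) :
    (DirectSum J fun j => A.carrier ⊗[ℚ] V j) →ₗ[ℚ] M.carrier :=
  letI := Classical.decEq J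
  DirectSum.toModule ℚ J M.carrier fun j => TensorProduct.lift (M.act.compl₂ (b j))

/-- A cell structure on `M` with index set `J`. The map `b j : V j → M`, a `G`-equivariant map into
`M^{n j}`, corresponds to the map of `A`-modules in graded `G`-representations
`A[-n j] ⊗ V j → M`, `a ⊗ v ↦ a (b j v)`. -/
structure CellStructure {A : Cdga H} (M : DGModule A) (J : Type u) where
  n : J → ℤ
  V : J → Type u
  [addCommGroup : ∀ j, AddCommGroup (V j)]
  [module : ∀ j, Module ℚ (V j)]
  [finite : ∀ j, Module.Finite ℚ (V j)]
  coact : ∀ j, V j →ₗ[ℚ] V j ⊗[ℚ] H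
  isCoaction : ∀ j, IsCoaction (coact j)
  b : ∀ j, V j →ₗ[ℚ] M.carrier
  b_equivariant : ∀ j, IsEquivariant (coact j) M.coact (b j)
  b_deg : ∀ j v, b j v ∈ M.deg (n j)
  /-- `⨁ⱼ A[-n j] ⊗ V j → M` is an isomorphism -/
  bijective : Function.Bijective (cellMap M V b)
  /-- the filtration of the index set; `fil 0` is `J₋₁` and `fil (k + 1)` is `J_k` -/
  fil : ℕ → Set J
  fil_zero : fil 0 = ∅
  fil_mono : Monotone fil
  fil_exhaustive : ∀ j, ∃ k, j ∈ fil k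
  /-- for `j ∈ J_k`, `d b_j` is an `A`-linear combination of the `b_i` with `i ∈ J_{k-1}` -/
  d_b : ∀ k, ∀ j ∈ fil (k + 1), ∀ v, M.d (b j v) ∈
    Submodule.span ℚ {m | ∃ i ∈ fil k, ∃ (a : A.carrier) (w : V i), m = M.act a (b i w)}

variable (A : Cdga H)

/-- The cell modules, as objects of the homotopy category. -/
def cell : ObjectProperty (HoCat A) := fun X => ∃ J : Type u, Nonempty (CellStructure X.as J)

/-- The finite cell modules, as objects of the homotopy category. -/
def finCell : ObjectProperty (HoCat A) := fun X =>
  ∃ J : Type u, Finite J ∧ Nonempty (CellStructure X.as J)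

/-- The objects of the derived category which are isomorphic to a finite cell module. -/
def finDer : ObjectProperty (DerCat A) := fun Y =>
  ∃ X : HoCat A, finCell A X ∧ Nonempty (Y ≅ (DerCat.Q A).obj X)

/-- The functor from the homotopy category of cell modules to the derived category. -/
noncomputable abbrev cellFunctor : (cell A).FullSubcategory ⥤ DerCat A :=
  (cell A).ι ⋙ DerCat.Q A

/-- The functor from the homotopy category of finite cell modules to the full subcategory of the
derived category on the objects isomorphic to a finite cell module. -/
noncomputable def finCellFunctor : (finCell A).FullSubcategory ⥤ (finDer A).FullSubcategory :=
  (finDer A).lift ((finCell A).ι ⋙ DerCat.Q A) fun X => ⟨X.obj, X.property, ⟨Iso.refl _⟩⟩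

noncomputable instance [(finCell A).IsTriangulated] [(finDer A).IsTriangulated] :
    (finCellFunctor A).CommShift ℤ :=
  Functor.CommShift.ofComp
    ((finDer A).liftCompιIso ((finCell A).ι ⋙ DerCat.Q A) fun X => ⟨X.obj, X.property, ⟨Iso.refl _⟩⟩) ℤ

end Cell

end RepDG

/-! Quasi-isomorphisms are exactly the morphisms of `HoCat A` with acyclic cone (`HoCat.qis_eq`), so
`DerCat A` is the Verdier quotient of the homotopy category by the acyclic modules. Two facts then
carry the theorem. (1) Every morphism from a cell module to an acyclic module is nullhomotopic
(`CellStructure.homotopic_zero`); hence localization is bijective on morphisms out of a cell module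
(`HoCat.map_Q_bijective`). (2) Every dg module receives a quasi-isomorphism from a cell module
(`exists_cell_approximation`); hence every object of the derived category comes from a cell module.

Fact (1) is where reductivity enters. Representations are locally finite, so complete reducibility
makes each finite-dimensional representation projective among all representations
(`IsReductive.exists_lift`). A nullhomotopy `h` of `f` is built cell by cell along the filtration:
on the cell `b_j` one must solve `d (h b_j) = f b_j - h (d b_j)`. The right side only involves
earlier cells, and it is a cycle because `d h + h d = f` on those; acyclicity makes it a boundary,
and projectivity makes the choice of a primitive linear and equivariant.

For (2), start from zero. Given a cell module `X` over `M`, attach one cell for each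
finite-dimensional subrepresentation of the homogeneous cycles of `Cone(X → M)`. The result `Y`
contains `X`, and every cycle of `Cone(X → M)` becomes a boundary in `Cone(Y → M)`
(`CellOver.exists_attach`). Iterating and passing to the mapping telescope, the cone of `1 - S` on
the direct sum of the stages, gives the approximation (`telescopeDesc_isQuasiIso`). This uses that
cell modules are stable under direct sums and cones.

Stability under shifts and cones also makes (finite) cell modules a triangulated subcategory. In the
finite case, (1) still gives full faithfulness, and `finDer A` is by definition the essential image,
which is triangulated because the functor is full and exact. -/

namespace RepDG

/-! ### Subrepresentations and lifting -/

section Reps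

variable {H : Type u} [CommRing H] [HopfAlgebra ℚ H]
variable {V W U : Type u} [AddCommGroup V] [Module ℚ V] [AddCommGroup W] [Module ℚ W]
  [AddCommGroup U] [Module ℚ U]
variable {ρV : V →ₗ[ℚ] V ⊗[ℚ] H} {ρW : W →ₗ[ℚ] W ⊗[ℚ] H} {ρU : U →ₗ[ℚ] U ⊗[ℚ] H}

lemma rTensor_injective {f : V →ₗ[ℚ] W} (hf : Function.Injective f) :
    Function.Injective (f.rTensor H) :=
  Module.Flat.rTensor_preserves_injective_linearMap f hf

/-- The coaction of `H` on a subrepresentation. -/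
noncomputable def restrictCoact {S : Submodule ℚ W} (hS : IsSubrep ρW S) : S →ₗ[ℚ] S ⊗[ℚ] H :=
  (LinearEquiv.ofInjective (S.subtype.rTensor H)
      (rTensor_injective S.injective_subtype)).symm.toLinearMap ∘ₗ
    (ρW ∘ₗ S.subtype).codRestrict _ fun v => hS v v.2

lemma subtype_equivariant {S : Submodule ℚ W} (hS : IsSubrep ρW S) :
    IsEquivariant (restrictCoact hS) ρW S.subtype := by
  intro v
  have := LinearEquiv.apply_symm_apply (LinearEquiv.ofInjective (S.subtype.rTensor H)
      (rTensor_injective S.injective_subtype)) ((ρW ∘ₗ S.subtype).codRestrict _ (fun v => hS v v.2) v)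
  exact (congrArg Subtype.val this).symm

lemma isEquivariant_of_comp_injective {f : V →ₗ[ℚ] W} {g : W →ₗ[ℚ] U}
    (hg : Function.Injective g) (h : IsEquivariant ρW ρU g) (hgf : IsEquivariant ρV ρU (g ∘ₗ f)) :
    IsEquivariant ρV ρW f := by
  intro v
  apply rTensor_injective (H := H) hg
  rw [← h, ← LinearMap.rTensor_comp_apply, ← hgf]
  rfl

/-- The axioms for `ρV` are identities in `V ⊗ (H ⊗ H)` and `V ⊗ ℚ`. By flatness over `ℚ` these
embed into the same spaces for `W`, where the identities become those of `ρW`. -/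
lemma IsCoaction.of_injective (hW : IsCoaction ρW) {f : V →ₗ[ℚ] W} (hf : Function.Injective f)
    (h : IsEquivariant ρV ρW f) : IsCoaction ρV where
  coassoc := by
    have h1 : ∀ x : V ⊗[ℚ] H, f.rTensor (H ⊗[ℚ] H) (TensorProduct.assoc ℚ V H H
        (ρV.rTensor H x)) = TensorProduct.assoc ℚ W H H (ρW.rTensor H (f.rTensor H x)) := by
      intro x
      induction x with
      | zero => simp
      | add x y hx hy => simp only [map_add, hx, hy]
      | tmul v a =>
        simp only [LinearMap.rTensor_tmul, h v]
        generalize ρV v = z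
        induction z with
        | zero => simp
        | add x y hx hy => simp only [map_add, TensorProduct.add_tmul, hx, hy]
        | tmul w b => simp
    refine LinearMap.ext fun v => Module.Flat.rTensor_preserves_injective_linearMap f hf
      (M := H ⊗[ℚ] H) ?_
    refine (h1 _).trans ?_
    rw [← h, hW.coassoc_apply, h]
    simp only [LinearMap.comp_apply]
    generalize ρV v = z
    induction z with
    | zero => simp
    | add x y hx hy => simp only [map_add, hx, hy]
    | tmul w b => simp
  counit v := by
    refine Module.Flat.rTensor_preserves_injective_linearMap f hf (M := ℚ) ?_
    have h1 : ∀ x : V ⊗[ℚ] H, f.rTensor ℚ ((Coalgebra.counit (R := ℚ) (A := H)).lTensor V x) =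
        (Coalgebra.counit (R := ℚ) (A := H)).lTensor W (f.rTensor H x) := by
      intro x
      induction x with
      | zero => simp
      | add x y hx hy => simp only [map_add, hx, hy]
      | tmul w b => simp
    rw [h1, ← h, hW.counit]
    simp

lemma restrictCoact_isCoaction {S : Submodule ℚ W} (hS : IsSubrep ρW S) (hW : IsCoaction ρW) :
    IsCoaction (restrictCoact hS) :=
  hW.of_injective S.injective_subtype (subtype_equivariant hS)

/-- Tensoring with the flat module `H` is exact, so the kernel of `f ⊗ H` is the image of `ker f ⊗
H`. -/
lemma IsSubrep.ker {f : V →ₗ[ℚ] W} (hf : IsEquivariant ρV ρW f) :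
    IsSubrep ρV (LinearMap.ker f) := by
  intro v hv
  have hex : Function.Exact (LinearMap.ker f).subtype f := by
    intro y; simp
  have := (Module.Flat.rTensor_exact H hex (ρV v)).1 (by
    rw [← hf, LinearMap.mem_ker.1 hv, map_zero])
  exact this

lemma IsSubrep.map {f : V →ₗ[ℚ] W} (hf : IsEquivariant ρV ρW f) {S : Submodule ℚ V}
    (hS : IsSubrep ρV S) : IsSubrep ρW (S.map f) := by
  rintro _ ⟨v, hv, rfl⟩
  exact subrep_map hS hf (fun v hv => Submodule.mem_map_of_mem hv) v hv

lemma range_rTensor_mono {S T : Submodule ℚ V} (h : S ≤ T) :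
    LinearMap.range (S.subtype.rTensor H) ≤ LinearMap.range (T.subtype.rTensor H) := by
  rintro _ ⟨x, rfl⟩
  refine ⟨(Submodule.inclusion h).rTensor H x, ?_⟩
  rw [← LinearMap.rTensor_comp_apply]
  rfl

lemma IsSubrep.sup {S T : Submodule ℚ V} (hS : IsSubrep ρV S) (hT : IsSubrep ρV T) :
    IsSubrep ρV (S ⊔ T) := by
  intro v hv
  obtain ⟨s, hs, t, ht, rfl⟩ := Submodule.mem_sup.1 hv
  rw [map_add]
  exact add_mem (range_rTensor_mono le_sup_left (hS s hs)) (range_rTensor_mono le_sup_right (hT t ht))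

lemma IsSubrep.bot : IsSubrep ρV ⊥ := by
  intro v hv
  rw [(Submodule.mem_bot ℚ).1 hv, map_zero]
  exact zero_mem _

/-- The space of coefficients `(id ⊗ φ) (ρ v)`, for `φ` a linear form on `H`. -/
noncomputable def coeffSpan (ρV : V →ₗ[ℚ] V ⊗[ℚ] H) (v : V) : Submodule ℚ V :=
  Submodule.span ℚ (Set.range fun φ : H →ₗ[ℚ] ℚ => TensorProduct.rid ℚ V (φ.lTensor V (ρV v)))

/-- Expand `ρ v = ∑ b_i ⊗ B_i` in a basis `B` of `H`; then `b_i` is the coefficient of `v` for the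
coordinate form of `B_i`. -/
lemma mem_range_coeffSpan (v : V) :
    ρV v ∈ LinearMap.range ((coeffSpan ρV v).subtype.rTensor H) := by
  classical
  let B := Module.Basis.ofVectorSpace ℚ H
  obtain ⟨b, hb⟩ := TensorProduct.eq_repr_basis_right B (ρV v)
  have hmem : ∀ i, b i ∈ coeffSpan ρV v := by
    intro i
    refine Submodule.subset_span ⟨B.coord i, ?_⟩
    simp only [← hb, Finsupp.sum, map_sum, LinearMap.lTensor_tmul, TensorProduct.rid_tmul,
      Module.Basis.coord_apply, Module.Basis.repr_self, Finsupp.single_apply, ite_smul, one_smul,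
      zero_smul]
    rw [Finset.sum_ite_eq' b.support i (fun j => b j)]
    split_ifs with h
    · rfl
    · exact (Finsupp.notMem_support_iff.1 h).symm
  rw [← hb]
  refine Submodule.sum_mem _ fun i _ => ⟨(⟨b i, hmem i⟩ : coeffSpan ρV v) ⊗ₜ B i, by simp⟩

lemma coeffSpan_isSubrep (hV : IsCoaction ρV) (v : V) : IsSubrep ρV (coeffSpan ρV v) := by
  -- Coassociativity moves the second coaction onto `H`: `ρ ((id ⊗ φ) (ρ v)) = (id ⊗ τ) (ρ v)` with
  -- `τ = (id ⊗ φ) Δ`. Since `id ⊗ τ` leaves the factor `V` alone, it preserves `coeffSpan ρV v ⊗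
  -- H`.
  have key : ∀ φ : H →ₗ[ℚ] ℚ, ρV (TensorProduct.rid ℚ V (φ.lTensor V (ρV v))) =
      (TensorProduct.rid ℚ H ∘ₗ φ.lTensor H ∘ₗ Coalgebra.comul (R := ℚ) (A := H)).lTensor V
        (ρV v) := by
    intro φ
    have h1 : ∀ x : V ⊗[ℚ] H, ρV (TensorProduct.rid ℚ V (φ.lTensor V x)) =
        (TensorProduct.rid ℚ H ∘ₗ φ.lTensor H).lTensor V
          (TensorProduct.assoc ℚ V H H (ρV.rTensor H x)) := by
      intro x
      induction x with
      | zero => simp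
      | add x y hx hy => simp only [map_add, hx, hy]
      | tmul w a =>
        simp only [LinearMap.lTensor_tmul, TensorProduct.rid_tmul, map_smul, LinearMap.rTensor_tmul]
        generalize ρV w = z
        induction z with
        | zero => simp
        | add x y hx hy => simp only [map_add, TensorProduct.add_tmul, smul_add, hx, hy]
        | tmul w b => simp
    rw [h1, hV.coassoc_apply, ← LinearMap.lTensor_comp_apply]
    rfl
  intro w hw
  induction hw using Submodule.span_induction with
  | zero => simp
  | add x y _ _ hx hy => rw [map_add]; exact add_mem hx hy
  | smul c x _ hx => rw [map_smul]; exact Submodule.smul_mem _ _ hx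
  | mem x hx =>
    obtain ⟨φ, rfl⟩ := hx
    obtain ⟨z, hz⟩ := mem_range_coeffSpan (ρV := ρV) v
    simp only
    rw [key, ← hz]
    generalize (TensorProduct.rid ℚ H).toLinearMap ∘ₗ φ.lTensor H ∘ₗ
      Coalgebra.comul (R := ℚ) (A := H) = τ
    refine ⟨τ.lTensor _ z, ?_⟩
    rw [← LinearMap.comp_apply, ← LinearMap.comp_apply, LinearMap.rTensor_comp_lTensor,
      LinearMap.lTensor_comp_rTensor]

/-- As `ρ v` is a finite sum of pure tensors, all coefficients lie in the span of the finitely many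
first factors. -/
lemma coeffSpan_finite (v : V) : Module.Finite ℚ (coeffSpan ρV v) := by
  classical
  obtain ⟨s, hs⟩ := TensorProduct.exists_finset (R := ℚ) (ρV v)
  have : coeffSpan ρV v ≤ Submodule.span ℚ ((s.image Prod.fst : Finset V) : Set V) := by
    refine Submodule.span_le.2 ?_
    rintro _ ⟨φ, rfl⟩
    simp only [hs, map_sum, LinearMap.lTensor_tmul, TensorProduct.rid_tmul]
    refine Submodule.sum_mem _ fun i hi => Submodule.smul_mem _ _ (Submodule.subset_span ?_)
    exact Finset.mem_coe.2 (Finset.mem_image_of_mem _ hi)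
  exact Submodule.finiteDimensional_of_le this

lemma mem_coeffSpan (hV : IsCoaction ρV) (v : V) : v ∈ coeffSpan ρV v := by
  refine Submodule.subset_span ⟨Coalgebra.counit (R := ℚ) (A := H), ?_⟩
  simp only [hV.counit, TensorProduct.rid_tmul, one_smul]

/-- Every vector lies in a finite-dimensional subrepresentation. -/
lemma exists_finite_subrep_mem (hV : IsCoaction ρV) (v : V) :
    ∃ S : Submodule ℚ V, Module.Finite ℚ S ∧ IsSubrep ρV S ∧ v ∈ S :=
  ⟨_, coeffSpan_finite v, coeffSpan_isSubrep hV v, mem_coeffSpan hV v⟩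

/-- A finite set of vectors lies in a finite-dimensional subrepresentation. -/
lemma exists_finite_subrep (hV : IsCoaction ρV) (s : Finset V) :
    ∃ S : Submodule ℚ V, Module.Finite ℚ S ∧ IsSubrep ρV S ∧ ∀ v ∈ s, v ∈ S := by
  classical
  induction s using Finset.induction_on with
  | empty => exact ⟨⊥, inferInstance, IsSubrep.bot, by simp⟩
  | insert v s _ ih =>
    obtain ⟨S, _, h2, h3⟩ := ih
    obtain ⟨T, _, h5, h6⟩ := exists_finite_subrep_mem hV v
    refine ⟨T ⊔ S, inferInstance, h5.sup h2, ?_⟩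
    intro w hw
    rcases Finset.mem_insert.1 hw with rfl | hw
    · exact Submodule.mem_sup_left h6
    · exact Submodule.mem_sup_right (h3 w hw)

lemma isEquivariant_symm {e : V ≃ₗ[ℚ] W} (he : IsEquivariant ρV ρW e.toLinearMap) :
    IsEquivariant ρW ρV e.symm.toLinearMap := by
  refine isEquivariant_of_comp_injective (g := e.toLinearMap) e.injective he ?_
  intro w
  simp

/-- An equivariant surjection between finite-dimensional representations has an equivariant
section. -/
lemma IsReductive.exists_section (hG : IsReductive H) [Module.Finite ℚ W] (hW : IsCoaction ρW)
    {p : W →ₗ[ℚ] V} (hp : IsEquivariant ρW ρV p) (hs : Function.Surjective p) :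
    ∃ s : V →ₗ[ℚ] W, IsEquivariant ρV ρW s ∧ ∀ v, p (s v) = v := by
  obtain ⟨T, hT, hc⟩ := hG.completelyReducible W ρW hW _ (IsSubrep.ker hp)
  -- An invariant complement `T` of `ker p` maps isomorphically to `V`; the inverse of this
  -- isomorphism is the section.
  let e : T ≃ₗ[ℚ] V := LinearEquiv.ofBijective (p ∘ₗ T.subtype) (by
    constructor
    · rw [← LinearMap.ker_eq_bot, LinearMap.ker_eq_bot']
      intro x hx
      have := Submodule.disjoint_def.1 hc.disjoint x.1 hx x.2
      exact Subtype.ext this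
    · intro v
      obtain ⟨w, rfl⟩ := hs v
      obtain ⟨a, ha, b, hb, rfl⟩ := Submodule.mem_sup.1
        (hc.codisjoint.eq_top ▸ Submodule.mem_top (x := w) : w ∈ LinearMap.ker p ⊔ T)
      exact ⟨⟨b, hb⟩, by simp [LinearMap.mem_ker.1 ha]⟩)
  have he : IsEquivariant (restrictCoact hT) ρV e.toLinearMap := hp.comp (subtype_equivariant hT)
  exact ⟨T.subtype ∘ₗ e.symm.toLinearMap, (subtype_equivariant hT).comp (isEquivariant_symm he),
    fun v => e.apply_symm_apply v⟩

/-- Finite-dimensional representations of a reductive group are projective. -/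
lemma IsReductive.exists_lift (hG : IsReductive H) [Module.Finite ℚ V] (hV : IsCoaction ρV)
    (hW : IsCoaction ρW) {D : W →ₗ[ℚ] U} (hD : IsEquivariant ρW ρU D)
    {f : V →ₗ[ℚ] U} (hf : IsEquivariant ρV ρU f) (h : ∀ v, ∃ w, D w = f v) :
    ∃ s : V →ₗ[ℚ] W, IsEquivariant ρV ρW s ∧ ∀ v, D (s v) = f v := by
  classical
  choose l hl using h
  obtain ⟨t, ht⟩ := Module.Finite.fg_top (R := ℚ) (M := V)
  -- Complete reducibility only concerns finite-dimensional representations, so `W` is replaced by a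
  -- finite-dimensional `E` containing preimages of generators of `V`.
  obtain ⟨E, _, hE, hEl⟩ := exists_finite_subrep hW (t.image l)
  have hDE : IsEquivariant (restrictCoact hE) ρU (D ∘ₗ E.subtype) :=
    hD.comp (subtype_equivariant hE)
  -- The kernel of `δ` is the fibre product of `V` and `E` over `U`. It surjects onto `V`, since it
  -- contains a point over every generator; a section followed by the projection to `E` is the lift.
  let δ : V × E →ₗ[ℚ] U := f ∘ₗ LinearMap.fst ℚ V E + (-1 : ℚ) • (D ∘ₗ E.subtype) ∘ₗ
    LinearMap.snd ℚ V E
  have hδ : IsEquivariant (prodCoact ρV (restrictCoact hE)) ρU δ :=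
    (hf.comp (fst_equivariant _ _)).add ((hDE.comp (snd_equivariant _ _)).smul (-1))
  have hK := IsSubrep.ker hδ
  have hprod := prodCoact_isCoaction hV (restrictCoact_isCoaction hE hW)
  obtain ⟨s, hs, hs'⟩ := hG.exists_section (restrictCoact_isCoaction hK hprod)
    ((fst_equivariant ρV (restrictCoact hE)).comp (subtype_equivariant hK)) (by
      intro v
      have hv : v ∈ Submodule.span ℚ (t : Set V) := ht ▸ Submodule.mem_top
      have : Submodule.span ℚ (t : Set V) ≤ LinearMap.range
          (LinearMap.fst ℚ V E ∘ₗ (LinearMap.ker δ).subtype) := by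
        refine Submodule.span_le.2 fun v hv => ?_
        refine ⟨⟨(v, ⟨l v, hEl _ (Finset.mem_image_of_mem l hv)⟩), ?_⟩, rfl⟩
        simp [δ, hl]
      exact this hv)
  refine ⟨E.subtype ∘ₗ LinearMap.snd ℚ V E ∘ₗ (LinearMap.ker δ).subtype ∘ₗ s,
    (subtype_equivariant hE).comp ((snd_equivariant _ _).comp ((subtype_equivariant hK).comp hs)),
    fun v => ?_⟩
  have h1 : f (s v).1.1 + (-1 : ℚ) • D (s v).1.2 = 0 := (s v).2
  have h2 : (s v).1.1 = v := hs' v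
  rw [h2, neg_smul, one_smul, ← sub_eq_add_neg, sub_eq_zero] at h1
  exact h1.symm

end Reps

end RepDG

/-! ### Homogeneous maps between dg modules. -/

namespace RepDG

variable {H : Type u} [CommRing H] [HopfAlgebra ℚ H]

/-- Split `x = y + z` with `y ∈ T k` and `z` in the sum of the other `T j`. Then `z = x - y` lies in
`S k` and in the sum of the other `S j`, hence vanishes. This extracts homogeneous components
without naming projections. -/
lemma mem_of_mem_iSup {V : Type*} [AddCommGroup V] [Module ℚ V] {S T : ℤ → Submodule ℚ V}
    (hS : iSupIndep S) (h : ∀ k, T k ≤ S k) {k : ℤ} {x : V} (hx : x ∈ S k) (hx' : x ∈ ⨆ k, T k) :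
    x ∈ T k := by
  have h1 : ⨆ j, T j ≤ T k ⊔ ⨆ j, ⨆ (_ : j ≠ k), T j := by
    refine iSup_le fun j => ?_
    by_cases hj : j = k
    · subst hj; exact le_sup_left
    · exact le_sup_of_le_right (le_iSup₂_of_le j hj le_rfl)
  obtain ⟨y, hy, z, hz, rfl⟩ := Submodule.mem_sup.1 (h1 hx')
  have hz1 : z ∈ S k := by simpa using sub_mem hx (h k hy)
  have hz2 : z ∈ ⨆ j, ⨆ (_ : j ≠ k), S j :=
    (iSup₂_mono fun j _ => h j : (⨆ j, ⨆ (_ : j ≠ k), T j) ≤ _) hz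
  rw [Submodule.disjoint_def.1 (hS k) z hz1 hz2, add_zero]
  exact hy

namespace DGModule

variable {A : Cdga H} {M N : DGModule A}

lemma iSup_deg (M : DGModule A) : ⨆ k, M.deg k = ⊤ :=
  ((DirectSum.isInternal_submodule_iff_iSupIndep_and_iSup_eq_top _).1 M.isInternal).2

lemma iSupIndep_deg (M : DGModule A) : iSupIndep M.deg :=
  ((DirectSum.isInternal_submodule_iff_iSupIndep_and_iSup_eq_top _).1 M.isInternal).1

/-- A linear map raises degrees by `n` if it does so on homogeneous generators. -/
lemma map_deg_of_generators {n : ℤ} (f : M.carrier →ₗ[ℚ] N.carrier)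
    (h : ∀ x, x ∈ Submodule.span ℚ {m | ∃ k, m ∈ M.deg k ∧ f m ∈ N.deg (k + n)})
    (k : ℤ) (m : M.carrier) (hm : m ∈ M.deg k) : f m ∈ N.deg (k + n) := by
  refine (mem_of_mem_iSup (T := fun k => M.deg k ⊓ (N.deg (k + n)).comap f) M.iSupIndep_deg
    (fun k => inf_le_left) hm ?_).2
  refine (Submodule.span_le.2 ?_ : _ ≤ _) (h m)
  rintro m ⟨k, h1, h2⟩
  exact Submodule.mem_iSup_of_mem k ⟨h1, h2⟩

/-- Packing the sign into the automorphism `A.twist n` makes the sign rule meaningful for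
inhomogeneous `a`. -/
lemma IsHom.map_act_twist {n : ℤ} {f : M.carrier →ₗ[ℚ] N.carrier} (hf : IsHom M N n f)
    (a : A.carrier) (m : M.carrier) : f (M.act a m) = N.act (A.twist n a) (f m) := by
  induction a using Cdga.induction with
  | zero => simp
  | add a a' h h' => simp [h, h']
  | homogeneous p a ha => simp [hf.map_act p a ha, Cdga.twist_of_mem n ha]

/-- The differential of an element of `Hom_A(M, N)ⁿ`. -/
lemma IsHom.bracket {n : ℤ} {f : M.carrier →ₗ[ℚ] N.carrier} (hf : IsHom M N n f) :
    IsHom M N (n + 1) (N.d ∘ₗ f - (-1 : ℚ) ^ n • f ∘ₗ M.d) where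
  map_deg k m hm := by
    refine sub_mem ?_ (Submodule.smul_mem _ _ ?_)
    · have := N.d_deg _ _ (hf.map_deg k m hm)
      rwa [add_assoc] at this
    · have := hf.map_deg _ _ (M.d_deg k m hm)
      rwa [add_assoc, add_comm 1 n] at this
  equivariant := by
    have := (IsEquivariant.comp N.d_equivariant hf.equivariant).add
      (((IsEquivariant.comp hf.equivariant M.d_equivariant).smul ((-1 : ℚ) ^ n)).smul (-1))
    rwa [neg_smul, one_smul, ← sub_eq_add_neg] at this
  map_act p a ha m := by
    simp only [LinearMap.sub_apply, LinearMap.comp_apply, LinearMap.smul_apply, M.leibniz p a ha,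
      hf.map_act p a ha, map_smul, N.leibniz p a ha, map_add, hf.map_act _ _ (A.d_deg p a ha),
      smul_add, smul_smul, map_sub, smul_sub]
    -- With `e1` the two terms containing `A.d a` cancel; `e2` and `e3` identify the signs of the
    -- two terms that remain.
    have e1 : (-1 : ℚ) ^ n * (-1 : ℚ) ^ (n * (p + 1)) = (-1 : ℚ) ^ (n * p) := by
      rw [mul_add, mul_one, eps_mul, mul_left_comm, eps_sq, mul_one]
    have e2 : (-1 : ℚ) ^ (n * p) * (-1 : ℚ) ^ p = (-1 : ℚ) ^ ((n + 1) * p) := by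
      rw [add_mul, one_mul, eps_mul]
    have e3 : (-1 : ℚ) ^ n * ((-1 : ℚ) ^ p * (-1 : ℚ) ^ (n * p)) =
        (-1 : ℚ) ^ ((n + 1) * p) * (-1 : ℚ) ^ n := by
      rw [← e2]; ring
    rw [e1, e2, e3]
    abel

end DGModule

open DGModule

/-! ### Spans of cells and the largest admissible filtration. -/

section CellSpan

variable {A : Cdga H} (M : DGModule A) {J : Type u} (V : J → Type u)
    [∀ j, AddCommGroup (V j)] [∀ j, Module ℚ (V j)] (b : ∀ j, V j →ₗ[ℚ] M.carrier)

/-- The `A`-submodule generated by the cells in `S`. -/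
def cellSpan (S : Set J) : Submodule ℚ M.carrier :=
  Submodule.span ℚ {m | ∃ i ∈ S, ∃ (a : A.carrier) (w : V i), m = M.act a (b i w)}

variable {M V b}

lemma act_mem_cellSpan {S : Set J} {i : J} (hi : i ∈ S) (a : A.carrier) (w : V i) :
    M.act a (b i w) ∈ cellSpan M V b S :=
  Submodule.subset_span ⟨i, hi, a, w, rfl⟩

lemma cellSpan_le {S : Set J} {T : Submodule ℚ M.carrier} :
    cellSpan M V b S ≤ T ↔ ∀ i ∈ S, ∀ (a : A.carrier) (w : V i), M.act a (b i w) ∈ T := by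
  refine Submodule.span_le.trans ⟨fun h i hi a w => h ⟨i, hi, a, w, rfl⟩, ?_⟩
  rintro h _ ⟨i, hi, a, w, rfl⟩
  exact h i hi a w

lemma cellSpan_mono {S T : Set J} (h : S ⊆ T) : cellSpan M V b S ≤ cellSpan M V b T :=
  cellSpan_le.2 fun _ hi a w => act_mem_cellSpan (h hi) a w

lemma cellMap_lof [DecidableEq J] (j : J) (a : A.carrier) (v : V j) :
    cellMap M V b (DirectSum.lof ℚ J (fun j => A.carrier ⊗[ℚ] V j) j (a ⊗ₜ v)) =
      M.act a (b j v) := by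
  unfold cellMap
  convert DirectSum.toModule_lof (M := fun j => A.carrier ⊗[ℚ] V j)
    (φ := fun j => TensorProduct.lift (M.act.compl₂ (b j))) ℚ j (a ⊗ₜ[ℚ] v)
  all_goals rfl

lemma range_cellMap : LinearMap.range (cellMap M V b) = cellSpan M V b Set.univ := by
  classical
  refine le_antisymm ?_ (cellSpan_le.2 fun i _ a w => ⟨_, cellMap_lof i a w⟩)
  rintro _ ⟨x, rfl⟩
  induction x using DirectSum.induction_on with
  | zero => simp
  | add x y hx hy => rw [map_add]; exact add_mem hx hy
  | of i x =>
    induction x with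
    | zero => simp
    | add x y hx hy => rw [map_add, map_add]; exact add_mem hx hy
    | tmul a v =>
      have := cellMap_lof (M := M) (b := b) i a v
      rw [DirectSum.lof_eq_of] at this
      rw [this]
      exact act_mem_cellSpan (Set.mem_univ _) a v

/-- A linear left inverse need only be tested on the elements `a (b j v)`, and surjectivity is
generation by the cells. For shifts, cones and direct sums, `g` is assembled from the inverses
`CellStructure.desc` of the constituents. -/
lemma cellMap_bijective [DecidableEq J]
    (g : M.carrier →ₗ[ℚ] DirectSum J fun j => A.carrier ⊗[ℚ] V j)
    (hg : ∀ j a v, g (M.act a (b j v)) = DirectSum.lof ℚ J (fun j => A.carrier ⊗[ℚ] V j) j (a ⊗ₜ v))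
    (hM : ∀ m, m ∈ cellSpan M V b Set.univ) : Function.Bijective (cellMap M V b) := by
  constructor
  · have : g ∘ₗ cellMap M V b = LinearMap.id := by
      refine DirectSum.linearMap_ext ℚ fun j => TensorProduct.ext' fun a v => ?_
      simp only [LinearMap.comp_apply, cellMap_lof, hg, LinearMap.id_apply]
    exact Function.LeftInverse.injective (g := g) (LinearMap.congr_fun this)
  · intro m
    have := hM m
    rwa [← range_cellMap] at this

variable (M V b)

/-- The largest filtration of the index set for which `d b_j` is a combination of cells of the
preceding step. -/
def cellFil : ℕ → Set J
  | 0 => ∅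
  | k + 1 => {j | ∀ v, M.d (b j v) ∈ cellSpan M V b (cellFil k)}

variable {M V b}

lemma cellFil_le_succ (k : ℕ) : cellFil M V b k ⊆ cellFil M V b (k + 1) := by
  induction k with
  | zero => exact Set.empty_subset _
  | succ k ih => exact fun j hj v => cellSpan_mono ih (hj v)

lemma cellFil_mono : Monotone (cellFil M V b) := monotone_nat_of_le_succ cellFil_le_succ

/-- The filtration is increasing, so the span of its union is a directed union of spans. -/
lemma exists_cellSpan_cellFil {m : M.carrier} (hm : m ∈ cellSpan M V b (⋃ k, cellFil M V b k)) :
    ∃ k, m ∈ cellSpan M V b (cellFil M V b k) := by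
  have h : cellSpan M V b (⋃ k, cellFil M V b k) ≤ ⨆ k, cellSpan M V b (cellFil M V b k) := by
    refine cellSpan_le.2 fun i hi a w => ?_
    obtain ⟨k, hk⟩ := Set.mem_iUnion.1 hi
    exact Submodule.mem_iSup_of_mem k (act_mem_cellSpan hk a w)
  have hmono : Monotone fun k => cellSpan M V b (cellFil M V b k) :=
    fun i j hij => cellSpan_mono (cellFil_mono hij)
  exact (Submodule.mem_iSup_of_directed _ hmono.directed_le).1 (h hm)

/-- Finite-dimensionality of `V j` is essential: the boundaries of finitely many generators lie in
the span of one common step, so the cell itself occurs in the next one. -/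
lemma mem_iUnion_cellFil [∀ j, Module.Finite ℚ (V j)] (j : J)
    (h : ∀ v, M.d (b j v) ∈ cellSpan M V b (⋃ k, cellFil M V b k)) :
    j ∈ ⋃ k, cellFil M V b k := by
  choose r hr using fun v => exists_cellSpan_cellFil (h v)
  obtain ⟨t, ht⟩ := Module.Finite.fg_top (R := ℚ) (M := V j)
  refine Set.mem_iUnion.2 ⟨t.sup r + 1, fun v => ?_⟩
  have hv : v ∈ Submodule.span ℚ (t : Set (V j)) := ht ▸ Submodule.mem_top
  have : Submodule.span ℚ (t : Set (V j)) ≤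
      (cellSpan M V b (cellFil M V b (t.sup r))).comap (M.d ∘ₗ b j) :=
    Submodule.span_le.2 fun v hv => cellSpan_mono (cellFil_mono (Finset.le_sup hv)) (hr v)
  exact this hv

end CellSpan

/-! ### Induction over cells and extension of maps from cells. -/

namespace CellStructure

attribute [instance] CellStructure.addCommGroup CellStructure.module CellStructure.finite

variable {A : Cdga H} {M : DGModule A} {J : Type u}

/-- A set of cells, containing each cell whose boundary is generated by it, contains all cells. -/
lemma cell_induction (c : CellStructure M J) (S : Set J)
    (hS : ∀ j, (∀ v, M.d (c.b j v) ∈ cellSpan M c.V c.b S) → j ∈ S) (j : J) : j ∈ S := by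
  have : ∀ k, c.fil k ⊆ S := by
    intro k
    induction k with
    | zero => rw [c.fil_zero]; exact Set.empty_subset _
    | succ k ih => exact fun j hj => hS j fun v => cellSpan_mono ih (c.d_b k j hj v)
  obtain ⟨k, hk⟩ := c.fil_exhaustive j
  exact this k hk

/-- A cell structure can be defined without a filtration, if a set of cells which contains each
cell whose boundary is generated by it contains all cells. -/
def ofClosed (n : J → ℤ) (V : J → Type u) [∀ j, AddCommGroup (V j)] [∀ j, Module ℚ (V j)]
    [∀ j, Module.Finite ℚ (V j)] (coact : ∀ j, V j →ₗ[ℚ] V j ⊗[ℚ] H)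
    (isCoaction : ∀ j, IsCoaction (coact j)) (b : ∀ j, V j →ₗ[ℚ] M.carrier)
    (b_equivariant : ∀ j, IsEquivariant (coact j) M.coact (b j))
    (b_deg : ∀ j v, b j v ∈ M.deg (n j)) (bijective : Function.Bijective (cellMap M V b))
    (hS : ∀ S : Set J, (∀ j, (∀ v, M.d (b j v) ∈ cellSpan M V b S) → j ∈ S) → ∀ j, j ∈ S) :
    CellStructure M J where
  n := n
  V := V
  coact := coact
  isCoaction := isCoaction
  b := b
  b_equivariant := b_equivariant
  b_deg := b_deg
  bijective := bijective
  fil := cellFil M V b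
  fil_zero := rfl
  fil_mono := cellFil_mono
  -- By `mem_iUnion_cellFil` the union of the steps contains every cell whose boundary it generates,
  -- so `hS` applies to it.
  fil_exhaustive j := Set.mem_iUnion.1 (hS _ mem_iUnion_cellFil j)
  d_b _ _ hj := hj

variable (c : CellStructure M J) {N : DGModule A}

lemma cellSpan_univ : cellSpan M c.V c.b Set.univ = ⊤ := by
  rw [← range_cellMap]
  exact LinearMap.range_eq_top.2 c.bijective.2

lemma mem_cellSpan {S : Set J} (hS : ∀ j, j ∈ S) (m : M.carrier) : m ∈ cellSpan M c.V c.b S := by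
  rw [Set.eq_univ_of_forall hS, cellSpan_univ]
  trivial

lemma span_homogeneous (m : M.carrier) : m ∈ Submodule.span ℚ
    {m | ∃ j p, ∃ a ∈ A.deg p, ∃ v : c.V j, m = M.act a (c.b j v)} := by
  refine (cellSpan_le (S := Set.univ)).2 (fun j _ a v => ?_) (c.mem_cellSpan (fun _ => trivial) m)
  induction a using Cdga.induction with
  | zero => simp
  | add a a' h h' => rw [map_add]; exact add_mem h h'
  | homogeneous p a ha => exact Submodule.subset_span ⟨j, p, a, ha, v, rfl⟩

lemma linear_ext {U : Type u} [AddCommGroup U] [Module ℚ U] {f g : M.carrier →ₗ[ℚ] U}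
    (h : ∀ j a v, f (M.act a (c.b j v)) = g (M.act a (c.b j v))) : f = g := by
  refine LinearMap.ext fun m => ?_
  exact (cellSpan_le (T := LinearMap.eqLocus f g)).2 (fun j _ a v => h j a v)
    (c.mem_cellSpan (fun _ => trivial) m)

/-- The set `S` of cells is arbitrary so that the lemma applies to the cells of lower rank: the
value of a homotopy on `d b_j` then depends only on its values on those. -/
lemma _root_.RepDG.DGModule.IsHom.eq_of_mem_cellSpan {J : Type u} {V : J → Type u}
    [∀ j, AddCommGroup (V j)] [∀ j, Module ℚ (V j)] {b : ∀ j, V j →ₗ[ℚ] M.carrier} {n : ℤ}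
    {f g : M.carrier →ₗ[ℚ] N.carrier}
    (hf : IsHom M N n f) (hg : IsHom M N n g) {S : Set J}
    (h : ∀ j ∈ S, ∀ v, f (b j v) = g (b j v)) {m : M.carrier}
    (hm : m ∈ cellSpan M V b S) : f m = g m :=
  (cellSpan_le (T := LinearMap.eqLocus f g)).2 (fun j hj a v => by
    rw [LinearMap.mem_eqLocus, hf.map_act_twist, hg.map_act_twist, h j hj]) hm

/-- An element of `Hom_A(M, N)ⁿ` is determined by its restriction to the cells. -/
lemma hom_ext {n : ℤ} {f g : M.carrier →ₗ[ℚ] N.carrier} (hf : IsHom M N n f) (hg : IsHom M N n g)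
    (h : ∀ j v, f (c.b j v) = g (c.b j v)) : f = g :=
  LinearMap.ext fun m => hf.eq_of_mem_cellSpan hg (fun j _ v => h j v)
    (c.mem_cellSpan (S := Set.univ) (fun _ => trivial) m)

/-- The linear map on `M` defined by linear maps on the summands `A ⊗ V j`. -/
noncomputable def desc {U : Type u} [AddCommMonoid U] [Module ℚ U]
    (φ : ∀ j, A.carrier ⊗[ℚ] c.V j →ₗ[ℚ] U) : M.carrier →ₗ[ℚ] U :=
  letI := Classical.decEq J
  DirectSum.toModule ℚ J U φ ∘ₗ (LinearEquiv.ofBijective _ c.bijective).symm.toLinearMap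

lemma desc_act {U : Type u} [AddCommMonoid U] [Module ℚ U]
    (φ : ∀ j, A.carrier ⊗[ℚ] c.V j →ₗ[ℚ] U) (j : J) (a : A.carrier) (v : c.V j) :
    c.desc φ (M.act a (c.b j v)) = φ j (a ⊗ₜ v) := by
  let := Classical.decEq J
  have h : (LinearEquiv.ofBijective _ c.bijective).symm (M.act a (c.b j v)) =
      DirectSum.lof ℚ J (fun j => A.carrier ⊗[ℚ] c.V j) j (a ⊗ₜ v) := by
    rw [LinearEquiv.symm_apply_eq]
    exact (cellMap_lof j a v).symm
  rw [desc, LinearMap.comp_apply, LinearEquiv.coe_coe, h]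
  exact DirectSum.toModule_lof (M := fun j => A.carrier ⊗[ℚ] c.V j) (φ := φ) ℚ j (a ⊗ₜ[ℚ] v)

/-- The extension of a family of maps on the cells to `M`. -/
noncomputable def extend (n : ℤ) (s : ∀ j, c.V j →ₗ[ℚ] N.carrier) : M.carrier →ₗ[ℚ] N.carrier :=
  c.desc fun j => TensorProduct.lift ((N.act ∘ₗ A.twist n).compl₂ (s j))

lemma extend_act (n : ℤ) (s : ∀ j, c.V j →ₗ[ℚ] N.carrier) (j : J) (a : A.carrier) (v : c.V j) :
    c.extend n s (M.act a (c.b j v)) = N.act (A.twist n a) (s j v) := by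
  rw [extend, desc_act]
  rfl

lemma extend_b (n : ℤ) (s : ∀ j, c.V j →ₗ[ℚ] N.carrier) (j : J) (v : c.V j) :
    c.extend n s (c.b j v) = s j v := by
  have := c.extend_act n s j 1 v
  rwa [M.one_act, Cdga.twist_one, N.one_act] at this

/-- With `hom_ext` this is the universal property of cells: elements of `Hom_A(M, N)ⁿ` correspond to
families of equivariant maps `V j → N` with values in degree `c.n j + n`. -/
lemma isHom_extend {n : ℤ} {s : ∀ j, c.V j →ₗ[ℚ] N.carrier}
    (hs : ∀ j, IsEquivariant (c.coact j) N.coact (s j)) (hd : ∀ j v, s j v ∈ N.deg (c.n j + n)) :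
    IsHom M N n (c.extend n s) where
  map_deg := by
    refine map_deg_of_generators _ fun m => ?_
    refine Submodule.span_mono ?_ (c.span_homogeneous m)
    rintro _ ⟨j, p, a, ha, v, rfl⟩
    refine ⟨p + c.n j, M.act_deg _ _ _ ha _ (c.b_deg j v), ?_⟩
    rw [c.extend_act, add_assoc]
    exact N.act_deg _ _ _ (Cdga.twist_mem n ha) _ (hd j v)
  equivariant := by
    intro m
    refine LinearMap.congr_fun (f := N.coact ∘ₗ c.extend n s)
      (g := (c.extend n s).rTensor H ∘ₗ M.coact) (c.linear_ext fun j a v => ?_) m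
    -- Equivariance is tested on `a (b j v)`. Both sides are images of the same pair of coactions,
    -- of `a` and of `v`: `h1` computes the coaction in `M`, `h2` its image in `N`.
    have h1 := map₂_natural (H := H) (M.act.compl₂ (c.b j)) M.act LinearMap.id (c.b j)
      LinearMap.id (by simp) (A.coact a) (c.coact j v)
    have h2 := map₂_natural (H := H) (M.act.compl₂ (c.b j)) N.act (A.twist n) (s j)
      (c.extend n s) (fun a v => (c.extend_act n s j a v).symm) (A.coact a) (c.coact j v)
    simp only [LinearMap.rTensor_id, LinearMap.id_apply] at h1
    rw [LinearMap.comp_apply, LinearMap.comp_apply, c.extend_act, N.act_equivariant,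
      M.act_equivariant, c.b_equivariant j v, A.twist_equivariant n a, hs j v, h1, h2]
  map_act p a ha m := by
    rw [← LinearMap.smul_apply, ← map_smul, ← Cdga.twist_of_mem n ha]
    refine LinearMap.congr_fun (f := c.extend n s ∘ₗ M.act a)
      (g := N.act (A.twist n a) ∘ₗ c.extend n s) (c.linear_ext fun j a' v => ?_) m
    simp only [LinearMap.comp_apply, ← M.mul_act, c.extend_act, Cdga.twist_mul, N.mul_act]

end CellStructure

end RepDG

/-! ### The zero module, shifts and cones of cell modules. -/

namespace RepDG

variable {H : Type u} [CommRing H] [HopfAlgebra ℚ H] {A : Cdga H}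

open DGModule

namespace Cdga

lemma twist_neg_twist (n : ℤ) (a : A.carrier) : A.twist (-n) (A.twist n a) = a := by
  rw [twist_twist, add_neg_cancel, twist_zero]

lemma twist_twist_neg (n : ℤ) (a : A.carrier) : A.twist n (A.twist (-n) a) = a := by
  rw [twist_twist, neg_add_cancel, twist_zero]

end Cdga

namespace CellStructure

/-- The zero module is a cell module without cells. -/
def zero (A : Cdga H) : CellStructure (zeroModule A) PEmpty.{u + 1} where
  n j := j.elim
  V _ := PUnit
  coact j := j.elim
  isCoaction j := j.elim
  b j := j.elim
  b_equivariant j := j.elim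
  b_deg j := j.elim
  bijective := by
    classical
    exact cellMap_bijective 0 (fun j => j.elim) fun m => by
      have : m = 0 := rfl
      rw [this]
      exact zero_mem _
  fil _ := ∅
  fil_zero := rfl
  fil_mono _ _ _ := le_rfl
  fil_exhaustive j := j.elim
  d_b _ j := j.elim

/-- The shift of a cell module is a cell module. -/
noncomputable def shift {M : DGModule A} {J : Type u} (c : CellStructure M J) (n : ℤ) :
    CellStructure (M.shift n) J :=
  -- The action on `M[n]` is that of `M` precomposed with the automorphism `twist n`, so acting by
  -- `a` in `M` is acting by `twist (-n) a` in `M[n]`.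
  have hspan : ∀ S, cellSpan M c.V c.b S ≤ cellSpan (M.shift n) c.V c.b S := fun S =>
    cellSpan_le.2 fun j hj a v => by
      have h := act_mem_cellSpan (M := M.shift n) (b := c.b) hj (A.twist (-n) a) v
      have h' : M.act (A.twist n (A.twist (-n) a)) (c.b j v) ∈ _ := h
      rwa [Cdga.twist_twist_neg] at h'
  ofClosed (M := M.shift n) (fun j => c.n j - n) c.V c.coact c.isCoaction c.b c.b_equivariant
    (fun j v => by
      have h : c.b j v ∈ M.deg (c.n j - n + n) := by rw [sub_add_cancel]; exact c.b_deg j v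
      exact h)
    (by
      classical
      -- The inverse for `M` is corrected by `twist (-n)` to undo the sign in the action on `M[n]`.
      refine cellMap_bijective (M := M.shift n) (c.desc fun j =>
        DirectSum.lof ℚ J (fun j => A.carrier ⊗[ℚ] c.V j) j ∘ₗ (A.twist (-n)).rTensor (c.V j)) ?_ ?_
      · intro j a v
        have h := c.desc_act (fun j => DirectSum.lof ℚ J (fun j => A.carrier ⊗[ℚ] c.V j) j ∘ₗ
          (A.twist (-n)).rTensor (c.V j)) j (A.twist n a) v
        refine h.trans ?_
        rw [LinearMap.comp_apply, LinearMap.rTensor_tmul, Cdga.twist_neg_twist]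
      · intro m
        exact hspan _ (c.mem_cellSpan (fun _ => trivial) m))
    (fun S hS => c.cell_induction S fun j hj => hS j fun v =>
      Submodule.smul_mem _ _ (hspan S (hj v)))

section Cone

variable {M N : DGModule A} {J K : Type u} (c : CellStructure M J) (e : CellStructure N K)

/-- The cells of a mapping cone. -/
abbrev coneV : K ⊕ J → Type u := Sum.elim e.V c.V

instance : ∀ j, AddCommGroup (coneV c e j)
  | .inl j => e.addCommGroup j
  | .inr j => c.addCommGroup j

instance : ∀ j, Module ℚ (coneV c e j)
  | .inl j => e.module j
  | .inr j => c.module j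

instance : ∀ j, Module.Finite ℚ (coneV c e j)
  | .inl j => e.finite j
  | .inr j => c.finite j

/-- The coactions on the cells of a mapping cone. -/
def coneVCoact : ∀ j, coneV c e j →ₗ[ℚ] coneV c e j ⊗[ℚ] H
  | .inl j => e.coact j
  | .inr j => c.coact j

/-- The inclusion of the cells of a mapping cone. -/
def coneB : ∀ j, coneV c e j →ₗ[ℚ] N.carrier × M.carrier
  | .inl j => LinearMap.inl ℚ N.carrier M.carrier ∘ₗ e.b j
  | .inr j => LinearMap.inr ℚ N.carrier M.carrier ∘ₗ c.b j

variable (f : M ⟶ N)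

lemma inl_mem_cellSpan (S : Set (K ⊕ J)) {x : N.carrier}
    (hx : x ∈ cellSpan N e.V e.b (Sum.inl ⁻¹' S)) :
    (x, 0) ∈ cellSpan (cone f) (coneV c e) (coneB c e) S := by
  refine (cellSpan_le (T := (cellSpan (cone f) (coneV c e) (coneB c e) S).comap
    (LinearMap.inl ℚ N.carrier M.carrier))).2 (fun j hj a v => ?_) hx
  have h := act_mem_cellSpan (M := cone f) (b := coneB c e) (i := Sum.inl j) hj a v
  have h' : (N.act a (e.b j v), M.act (A.twist 1 a) 0) ∈
    cellSpan (cone f) (coneV c e) (coneB c e) S := h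
  rwa [map_zero] at h'

lemma inr_mem_cellSpan (S : Set (K ⊕ J)) {x : M.carrier}
    (hx : x ∈ cellSpan M c.V c.b (Sum.inr ⁻¹' S)) :
    (0, x) ∈ cellSpan (cone f) (coneV c e) (coneB c e) S := by
  refine (cellSpan_le (T := (cellSpan (cone f) (coneV c e) (coneB c e) S).comap
    (LinearMap.inr ℚ N.carrier M.carrier))).2 (fun j hj a v => ?_) hx
  have h := act_mem_cellSpan (M := cone f) (b := coneB c e) (i := Sum.inr j) hj (A.twist (-1) a) v
  have h' : (N.act (A.twist (-1) a) 0, M.act (A.twist 1 (A.twist (-1) a)) (c.b j v)) ∈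
    cellSpan (cone f) (coneV c e) (coneB c e) S := h
  rwa [map_zero, Cdga.twist_twist_neg] at h'

/-- The mapping cone of a morphism of cell modules is a cell module. -/
noncomputable def cone : CellStructure (DGModule.cone f) (K ⊕ J) :=
  -- A cell of `M` drops by one degree because `Cone(f)^k` contains `M^{k+1}`. Defining the
  -- structure by closed sets avoids adjusting the two filtrations: `f (b j v)` may involve cells of
  -- `N` at any step.
  ofClosed (M := DGModule.cone f) (Sum.elim e.n fun j => c.n j - 1) (coneV c e) (coneVCoact c e)
    (by
      rintro (j | j)
      · exact e.isCoaction j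
      · exact c.isCoaction j)
    (coneB c e)
    (by
      rintro (j | j)
      · exact (inl_equivariant _ _).comp (e.b_equivariant j)
      · exact (inr_equivariant _ _).comp (c.b_equivariant j))
    (by
      rintro (j | j) v
      · exact ⟨e.b_deg j v, zero_mem _⟩
      · have h : c.b j v ∈ M.deg (c.n j - 1 + 1) := by rw [sub_add_cancel]; exact c.b_deg j v
        exact ⟨zero_mem _, h⟩)
    (by
      classical
      let p : N.carrier →ₗ[ℚ] DirectSum (K ⊕ J) fun j => A.carrier ⊗[ℚ] coneV c e j :=
        e.desc fun j => DirectSum.lof ℚ (K ⊕ J) (fun j => A.carrier ⊗[ℚ] coneV c e j) (Sum.inl j)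
      let q : M.carrier →ₗ[ℚ] DirectSum (K ⊕ J) fun j => A.carrier ⊗[ℚ] coneV c e j :=
        c.desc fun j => DirectSum.lof ℚ (K ⊕ J) (fun j => A.carrier ⊗[ℚ] coneV c e j) (Sum.inr j) ∘ₗ
          (A.twist (-1)).rTensor (c.V j)
      refine cellMap_bijective (M := DGModule.cone f) (LinearMap.coprod p q) ?_ ?_
      · rintro (j | j) a v
        · have h' : p (N.act a (e.b j v)) + q (M.act (A.twist 1 a) 0) = p (N.act a (e.b j v)) := by
            rw [map_zero, map_zero, add_zero]
          exact h'.trans (e.desc_act _ j a v)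
        · have h' : p (N.act a 0) + q (M.act (A.twist 1 a) (c.b j v)) =
              q (M.act (A.twist 1 a) (c.b j v)) := by
            rw [map_zero, map_zero, zero_add]
          refine h'.trans ((c.desc_act _ j (A.twist 1 a) v).trans ?_)
          refine congrArg (DirectSum.lof ℚ (K ⊕ J)
            (fun j => A.carrier ⊗[ℚ] coneV c e j) (Sum.inr j)) ?_
          refine (LinearMap.rTensor_tmul _ _ _ _).trans ?_
          rw [Cdga.twist_neg_twist]
          rfl
      · rintro ⟨x, y⟩
        have h := add_mem
          (inl_mem_cellSpan c e f Set.univ (e.mem_cellSpan (fun _ => trivial) x))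
          (inr_mem_cellSpan c e f Set.univ (c.mem_cellSpan (fun _ => trivial) y))
        simpa using h)
    (by
      intro S hS
      -- The summand `N` is a subcomplex, so its cells are reached first, by induction in `N` alone.
      have hK : ∀ j, Sum.inl j ∈ S := e.cell_induction (Sum.inl ⁻¹' S) fun j hj => hS _ fun v => by
        have h := inl_mem_cellSpan c e f S (hj v)
        have h' : (DGModule.cone f).d (coneB c e (Sum.inl j) v) = (N.d (e.b j v), 0) := by
          refine (cone_d f _).trans (Prod.ext ?_ ?_)
          · exact (congrArg (fun z => _ + z) (map_zero f.lin)).trans (add_zero _)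
          · exact (congrArg Neg.neg (map_zero M.d)).trans neg_zero
        rwa [h']
      -- Here `d (0, b) = (f b, -d b)`. Since all cells of `N` are already in `S`, the component `f
      -- b` is harmless and only `d b` matters for the induction in `M`.
      have hJ : ∀ j, Sum.inr j ∈ S := c.cell_induction (Sum.inr ⁻¹' S) fun j hj => hS _ fun v => by
        have h := sub_mem (inl_mem_cellSpan c e f S (e.mem_cellSpan hK (f.lin (c.b j v))))
          (inr_mem_cellSpan c e f S (hj v))
        have h' : (DGModule.cone f).d (coneB c e (Sum.inr j) v) =
            (f.lin (c.b j v), 0) - (0, M.d (c.b j v)) := by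
          refine (cone_d f _).trans (Prod.ext ?_ ?_)
          · refine (congrArg (fun z => z + _) (map_zero N.d)).trans ((zero_add _).trans ?_)
            exact (sub_zero _).symm
          · exact (zero_sub _).symm
        rwa [h']
      rintro (j | j)
      · exact hK j
      · exact hJ j)

end Cone

end CellStructure

end RepDG

namespace RepDG

variable {H : Type u} [CommRing H] [HopfAlgebra ℚ H] {A : Cdga H}

open DGModule

/-! ### Direct sums of dg modules -/

namespace DGModule

section DirectSum

variable {I : Type u} [DecidableEq I] (M : I → DGModule A)

/-- The underlying vector space of a direct sum. -/
abbrev SumCarrier : Type u := DirectSum I fun i => (M i).carrier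

/-- The inclusion of a summand. -/
abbrev sumι (i : I) : (M i).carrier →ₗ[ℚ] SumCarrier M :=
  DirectSum.lof ℚ I (fun i => (M i).carrier) i

variable {M} in
lemma sum_induction {p : SumCarrier M → Prop} (x : SumCarrier M) (zero : p 0)
    (lof : ∀ i m, p (sumι M i m)) (add : ∀ x y, p x → p y → p (x + y)) : p x :=
  DirectSum.induction_on x zero lof add

/-- The differential of a direct sum. -/
def sumD : SumCarrier M →ₗ[ℚ] SumCarrier M :=
  DirectSum.toModule ℚ I _ fun i => sumι M i ∘ₗ (M i).d

@[simp]
lemma sumD_lof (i : I) (m : (M i).carrier) : sumD M (sumι M i m) = sumι M i ((M i).d m) :=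
  DirectSum.toModule_lof (φ := fun i => sumι M i ∘ₗ (M i).d) ℚ i m

/-- The action of `A` on a direct sum. -/
def sumAct : A.carrier →ₗ[ℚ] SumCarrier M →ₗ[ℚ] SumCarrier M :=
  (DirectSum.toModule ℚ I (A.carrier →ₗ[ℚ] SumCarrier M) fun i =>
    ((M i).act.compr₂ (sumι M i)).flip).flip

@[simp]
lemma sumAct_lof (a : A.carrier) (i : I) (m : (M i).carrier) :
    sumAct M a (sumι M i m) = sumι M i ((M i).act a m) :=
  LinearMap.congr_fun (DirectSum.toModule_lof (φ := fun i => ((M i).act.compr₂ (sumι M i)).flip)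
    ℚ i m) a

/-- The coaction on a direct sum. -/
def sumCoact : SumCarrier M →ₗ[ℚ] SumCarrier M ⊗[ℚ] H :=
  DirectSum.toModule ℚ I _ fun i => (sumι M i).rTensor H ∘ₗ (M i).coact

lemma sumι_equivariant (i : I) : IsEquivariant (M i).coact (sumCoact M) (sumι M i) :=
  fun m => DirectSum.toModule_lof (φ := fun i => (sumι M i).rTensor H ∘ₗ (M i).coact) ℚ i m

/-- The grading of a direct sum. -/
def sumDeg (n : ℤ) : Submodule ℚ (SumCarrier M) := ⨆ i, ((M i).deg n).map (sumι M i)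

lemma sumι_mem_deg {n : ℤ} {i : I} {m : (M i).carrier} (hm : m ∈ (M i).deg n) :
    sumι M i m ∈ sumDeg M n :=
  Submodule.mem_iSup_of_mem i (Submodule.mem_map_of_mem hm)

lemma sumDeg_le {n : ℤ} {T : Submodule ℚ (SumCarrier M)} :
    sumDeg M n ≤ T ↔ ∀ i, ∀ m ∈ (M i).deg n, sumι M i m ∈ T := by
  simp only [sumDeg, iSup_le_iff, Submodule.map_le_iff_le_comap]
  rfl

/-- The component maps carry degree `n` into degree `n` and jointly detect elements, so independence
of the degrees is inherited from the summands. -/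
lemma sumDeg_isInternal : DirectSum.IsInternal (sumDeg M) := by
  rw [DirectSum.isInternal_submodule_iff_iSupIndep_and_iSup_eq_top]
  have hcomp : ∀ i n, sumDeg M n ≤ ((M i).deg n).comap
      (DirectSum.component ℚ I (fun i => (M i).carrier) i) := by
    intro i n
    refine (sumDeg_le M).2 fun j m hm => ?_
    rw [Submodule.mem_comap]
    by_cases h : j = i
    · subst h
      rwa [DirectSum.component.lof_self]
    · rw [DirectSum.component.of, dif_neg h]
      exact zero_mem _
  constructor
  · intro n
    rw [Submodule.disjoint_def]
    intro x hx hx'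
    refine DirectSum.ext_component ℚ fun i => ?_
    rw [map_zero]
    refine Submodule.disjoint_def.1 ((M i).iSupIndep_deg n) _ (hcomp i n hx) ?_
    have : (⨆ j, ⨆ (_ : j ≠ n), sumDeg M j) ≤ (⨆ j, ⨆ (_ : j ≠ n), (M i).deg j).comap
        (DirectSum.component ℚ I (fun i => (M i).carrier) i) :=
      iSup₂_le fun j hj => (hcomp i j).trans (Submodule.comap_mono (le_iSup₂_of_le j hj le_rfl))
    exact this hx'
  · rw [eq_top_iff]
    rintro x -
    induction x using sum_induction with
    | zero => exact zero_mem _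
    | add x y hx hy => exact add_mem hx hy
    | lof i m =>
      have h : ⨆ k, (M i).deg k ≤ (⨆ k, sumDeg M k).comap (sumι M i) :=
        iSup_le fun k m hm => Submodule.mem_iSup_of_mem k (sumι_mem_deg M hm)
      exact h (by rw [iSup_deg]; trivial)

/-- The direct sum of a family of dg modules. -/
def directSum : DGModule A where
  carrier := SumCarrier M
  deg := sumDeg M
  isInternal := sumDeg_isInternal M
  coact := sumCoact M
  isCoaction :=
    { coassoc := DirectSum.linearMap_ext ℚ fun i => LinearMap.ext fun m =>
        coassoc_of_equivariant (M i).isCoaction (sumι_equivariant M i) m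
      counit := fun x => by
        induction x using sum_induction with
        | zero => simp
        | add x y hx hy => rw [map_add, map_add, hx, hy, TensorProduct.add_tmul]
        | lof i m => exact counit_of_equivariant (M i).isCoaction (sumι_equivariant M i) m }
  isSubrep_deg n := (sumDeg_le M (T := (LinearMap.range ((sumDeg M n).subtype.rTensor H)).comap
    (sumCoact M))).2 fun i m hm =>
      subrep_map ((M i).isSubrep_deg n) (sumι_equivariant M i) (fun m hm => sumι_mem_deg M hm) m hm
  act := sumAct M
  act_equivariant a x := by
    induction x using sum_induction with
    | zero => simp
    | add x y hx hy => simp only [map_add, hx, hy]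
    | lof i m =>
      rw [sumAct_lof, sumι_equivariant M i, sumι_equivariant M i, (M i).act_equivariant a m]
      have := map₂_natural (H := H) (M i).act (sumAct M) LinearMap.id (sumι M i) (sumι M i)
        (fun a m => sumAct_lof M a i m) (A.coact a) ((M i).coact m)
      simpa only [LinearMap.rTensor_id, LinearMap.id_apply] using this.symm
  act_deg p q a ha := (sumDeg_le M (T := (sumDeg M (p + q)).comap (sumAct M a))).2 fun i m hm => by
    rw [Submodule.mem_comap, sumAct_lof]
    exact sumι_mem_deg M ((M i).act_deg p q a ha m hm)
  one_act x := by
    induction x using sum_induction with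
    | zero => simp
    | add x y hx hy => rw [map_add, hx, hy]
    | lof i m => rw [sumAct_lof, (M i).one_act]
  mul_act a b x := by
    induction x using sum_induction with
    | zero => simp
    | add x y hx hy => simp only [map_add, hx, hy]
    | lof i m => simp only [sumAct_lof, (M i).mul_act]
  d := sumD M
  d_equivariant x := by
    induction x using sum_induction with
    | zero => simp
    | add x y hx hy => simp only [map_add, hx, hy]
    | lof i m =>
      rw [sumD_lof, sumι_equivariant M i, sumι_equivariant M i, (M i).d_equivariant,
        ← LinearMap.rTensor_comp_apply, ← LinearMap.rTensor_comp_apply]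
      refine LinearMap.congr_fun (congrArg (LinearMap.rTensor H) ?_) _
      exact LinearMap.ext fun m => (sumD_lof M i m).symm
  d_deg n := (sumDeg_le M (T := (sumDeg M (n + 1)).comap (sumD M))).2 fun i m hm => by
    rw [Submodule.mem_comap, sumD_lof]
    exact sumι_mem_deg M ((M i).d_deg n m hm)
  d_d x := by
    induction x using sum_induction with
    | zero => simp
    | add x y hx hy => rw [map_add, map_add, hx, hy, add_zero]
    | lof i m => rw [sumD_lof, sumD_lof, (M i).d_d, map_zero]
  leibniz p a ha x := by
    induction x using sum_induction with
    | zero => simp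
    | add x y hx hy => simp only [map_add, hx, hy, smul_add]; abel
    | lof i m => simp only [sumAct_lof, sumD_lof, (M i).leibniz p a ha, map_add, map_smul]

/-- The inclusion of a summand. -/
def directSumι (i : I) : M i ⟶ directSum M where
  lin := sumι M i
  isHom :=
    { map_deg := fun k m hm => by rw [add_zero]; exact sumι_mem_deg M hm
      equivariant := sumι_equivariant M i
      map_act := fun p a ha m => by
        rw [zero_mul, zpow_zero, one_smul]
        exact (sumAct_lof M a i m).symm }
  comm m := (sumD_lof M i m).symm

variable {M} {N : DGModule A} (f : ∀ i, M i ⟶ N)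

/-- The linear map from a direct sum defined by a family of morphisms. -/
def sumDesc : SumCarrier M →ₗ[ℚ] N.carrier := DirectSum.toModule ℚ I N.carrier fun i => (f i).lin

@[simp]
lemma sumDesc_lof (i : I) (m : (M i).carrier) : sumDesc f (sumι M i m) = (f i).lin m :=
  DirectSum.toModule_lof (φ := fun i => (f i).lin) ℚ i m

lemma sumDesc_equivariant : IsEquivariant (sumCoact M) N.coact (sumDesc f) := by
  intro x
  induction x using sum_induction with
  | zero => simp
  | add x y hx hy => simp only [map_add, hx, hy]
  | lof i m =>
    rw [sumDesc_lof, sumι_equivariant M i, (f i).isHom.equivariant m,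
      ← LinearMap.rTensor_comp_apply]
    refine LinearMap.congr_fun (congrArg (LinearMap.rTensor H) ?_) _
    exact LinearMap.ext fun m => (sumDesc_lof f i m).symm

lemma sumDesc_act (a : A.carrier) (x : SumCarrier M) :
    sumDesc f (sumAct M a x) = N.act a (sumDesc f x) := by
  induction x using sum_induction with
  | zero => simp
  | add x y hx hy => simp only [map_add, hx, hy]
  | lof i m => rw [sumAct_lof, sumDesc_lof, sumDesc_lof, (f i).isHom.map_act_twist, Cdga.twist_zero]

lemma sumDesc_d (x : SumCarrier M) : sumDesc f (sumD M x) = N.d (sumDesc f x) := by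
  induction x using sum_induction with
  | zero => simp
  | add x y hx hy => simp only [map_add, hx, hy]
  | lof i m => rw [sumD_lof, sumDesc_lof, sumDesc_lof, (f i).comm]

/-- The morphism from a direct sum defined by a family of morphisms. -/
def directSumDesc : directSum M ⟶ N where
  lin := sumDesc f
  isHom :=
    { map_deg := fun k => (sumDeg_le M (T := (N.deg (k + 0)).comap (sumDesc f))).2 fun i m hm => by
        rw [Submodule.mem_comap, sumDesc_lof]
        exact (f i).isHom.map_deg k m hm
      equivariant := sumDesc_equivariant f
      map_act := fun p a ha x => by
        rw [zero_mul, zpow_zero, one_smul]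
        exact sumDesc_act f a x }
  comm := sumDesc_d f

lemma directSumDesc_lof (i : I) (m : (M i).carrier) :
    (directSumDesc f).lin (sumι M i m) = (f i).lin m :=
  sumDesc_lof f i m

end DirectSum

end DGModule

/-! ### Cells of a direct sum. -/

namespace CellStructure

section DirectSum

variable {I : Type u} [DecidableEq I] {M : I → DGModule A} {J : I → Type u}
  (c : ∀ i, CellStructure (M i) (J i))

/-- The inclusion of the cells of a direct sum. -/
def sumB (x : Σ i, J i) : (c x.1).V x.2 →ₗ[ℚ] (DGModule.directSum M).carrier :=
  sumι M x.1 ∘ₗ (c x.1).b x.2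

lemma sumι_mem_cellSpan (S : Set (Σ i, J i)) (i : I) {m : (M i).carrier}
    (hm : m ∈ cellSpan (M i) (c i).V (c i).b {j | ⟨i, j⟩ ∈ S}) :
    sumι M i m ∈ cellSpan (DGModule.directSum M) (fun x : Σ i, J i => (c x.1).V x.2) (sumB c) S := by
  refine (cellSpan_le (T := (cellSpan (DGModule.directSum M) (fun x : Σ i, J i => (c x.1).V x.2)
    (sumB c) S).comap (sumι M i))).2 (fun j hj a v => ?_) hm
  have h := act_mem_cellSpan (M := DGModule.directSum M) (S := S) (b := sumB c) (i := ⟨i, j⟩) hj a v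
  have h' : sumAct M a (sumι M i ((c i).b j v)) ∈ cellSpan (DGModule.directSum M)
    (fun x : Σ i, J i => (c x.1).V x.2) (sumB c) S := h
  rwa [sumAct_lof] at h'

/-- A direct sum of cell modules is a cell module. -/
noncomputable def directSum : CellStructure (DGModule.directSum M) (Σ i, J i) :=
  ofClosed (M := DGModule.directSum M) (fun x => (c x.1).n x.2) (fun x => (c x.1).V x.2)
    (fun x => (c x.1).coact x.2) (fun x => (c x.1).isCoaction x.2) (sumB c)
    (fun x => (sumι_equivariant M x.1).comp ((c x.1).b_equivariant x.2))
    (fun x v => sumι_mem_deg M ((c x.1).b_deg x.2 v))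
    (by
      classical
      refine cellMap_bijective (M := DGModule.directSum M) (DirectSum.toModule ℚ I _ fun i =>
        (c i).desc fun j => DirectSum.lof ℚ (Σ i, J i)
          (fun x => A.carrier ⊗[ℚ] (c x.1).V x.2) ⟨i, j⟩) ?_ ?_
      · rintro ⟨i, j⟩ a v
        refine (congrArg _ (sumAct_lof M a i ((c i).b j v))).trans ?_
        refine (DirectSum.toModule_lof ℚ i _).trans ?_
        exact (c i).desc_act _ j a v
      · intro x
        induction x using sum_induction with
        | zero => exact zero_mem _
        | add x y hx hy => exact add_mem hx hy
        | lof i m => exact sumι_mem_cellSpan c Set.univ i ((c i).mem_cellSpan (fun _ => trivial) m))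
    (by
      rintro S hS ⟨i, j⟩
      -- The differential preserves each summand, so a closed set of cells of the sum restricts to a
      -- closed set of cells of every `M i`.
      refine (c i).cell_induction {j | ⟨i, j⟩ ∈ S} (fun j hj => hS _ fun v => ?_) j
      have h := sumι_mem_cellSpan c S i (hj v)
      rw [← sumD_lof] at h
      exact h)

end DirectSum

end CellStructure

end RepDG

namespace RepDG

variable {H : Type u} [CommRing H] [HopfAlgebra ℚ H] {A : Cdga H}

/-! ### Free modules on a representation -/

section TensorCoact

variable {V W : Type u} [AddCommGroup V] [Module ℚ V] [AddCommGroup W] [Module ℚ W]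

/-- The tensor product of two representations. -/
noncomputable def tensorCoact (ρV : V →ₗ[ℚ] V ⊗[ℚ] H) (ρW : W →ₗ[ℚ] W ⊗[ℚ] H) :
    V ⊗[ℚ] W →ₗ[ℚ] (V ⊗[ℚ] W) ⊗[ℚ] H :=
  TensorProduct.lift
    ((TensorProduct.map₂ (TensorProduct.mk ℚ V W) (LinearMap.mul ℚ H)).compl₁₂ ρV ρW)

variable (ρV : V →ₗ[ℚ] V ⊗[ℚ] H) (ρW : W →ₗ[ℚ] W ⊗[ℚ] H)

lemma mk_equivariant : IsEquivariant₂ ρV ρW (tensorCoact ρV ρW) (TensorProduct.mk ℚ V W) :=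
  fun _ _ => rfl

/-- Writes the left side of coassociativity for `V ⊗ W` as the product, over the algebra `H ⊗ H`, of
the left sides for `V` and for `W`. `comul_map₂` does the same for the right sides, because
comultiplication is multiplicative. -/
lemma assoc_tensorCoact (x : V ⊗[ℚ] H) (y : W ⊗[ℚ] H) :
    TensorProduct.assoc ℚ (V ⊗[ℚ] W) H H ((tensorCoact ρV ρW).rTensor H
        (TensorProduct.map₂ (TensorProduct.mk ℚ V W) (LinearMap.mul ℚ H) x y)) =
      TensorProduct.map₂ (TensorProduct.mk ℚ V W) (LinearMap.mul ℚ (H ⊗[ℚ] H))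
        (TensorProduct.assoc ℚ V H H (ρV.rTensor H x))
        (TensorProduct.assoc ℚ W H H (ρW.rTensor H y)) := by
  induction x with
  | zero => simp
  | add x₁ x₂ h₁ h₂ => simp only [map_add, LinearMap.add_apply, h₁, h₂]
  | tmul v h =>
    induction y with
    | zero => simp
    | add y₁ y₂ h₁ h₂ => simp only [map_add, h₁, h₂]
    | tmul w k =>
      rw [TensorProduct.map₂_apply_tmul, TensorProduct.map_tmul, LinearMap.rTensor_tmul,
        LinearMap.rTensor_tmul, LinearMap.rTensor_tmul, mk_equivariant]
      generalize ρV v = x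
      generalize ρW w = y
      induction x with
      | zero => simp
      | add x₁ x₂ h₁ h₂ =>
        simp only [map_add, LinearMap.add_apply, TensorProduct.add_tmul, h₁, h₂]
      | tmul v h =>
        induction y with
        | zero => simp
        | add y₁ y₂ h₁ h₂ => simp only [map_add, TensorProduct.add_tmul, h₁, h₂]
        | tmul w k => simp

lemma comul_map₂ (x : V ⊗[ℚ] H) (y : W ⊗[ℚ] H) :
    (Coalgebra.comul (R := ℚ) (A := H)).lTensor (V ⊗[ℚ] W)
        (TensorProduct.map₂ (TensorProduct.mk ℚ V W) (LinearMap.mul ℚ H) x y) =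
      TensorProduct.map₂ (TensorProduct.mk ℚ V W) (LinearMap.mul ℚ (H ⊗[ℚ] H))
        ((Coalgebra.comul (R := ℚ) (A := H)).lTensor V x)
        ((Coalgebra.comul (R := ℚ) (A := H)).lTensor W y) := by
  induction x with
  | zero => simp
  | add x₁ x₂ h₁ h₂ => simp only [map_add, LinearMap.add_apply, h₁, h₂]
  | tmul v h =>
    induction y with
    | zero => simp
    | add y₁ y₂ h₁ h₂ => simp only [map_add, h₁, h₂]
    | tmul w k => simp

lemma counit_map₂ (x : V ⊗[ℚ] H) (y : W ⊗[ℚ] H) :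
    (Coalgebra.counit (R := ℚ) (A := H)).lTensor (V ⊗[ℚ] W)
        (TensorProduct.map₂ (TensorProduct.mk ℚ V W) (LinearMap.mul ℚ H) x y) =
      TensorProduct.map₂ (TensorProduct.mk ℚ V W) (LinearMap.mul ℚ ℚ)
        ((Coalgebra.counit (R := ℚ) (A := H)).lTensor V x)
        ((Coalgebra.counit (R := ℚ) (A := H)).lTensor W y) := by
  induction x with
  | zero => simp
  | add x₁ x₂ h₁ h₂ => simp only [map_add, LinearMap.add_apply, h₁, h₂]
  | tmul v h =>
    induction y with
    | zero => simp
    | add y₁ y₂ h₁ h₂ => simp only [map_add, h₁, h₂]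
    | tmul w k => simp

variable {ρV ρW}

lemma tensorCoact_isCoaction (hV : IsCoaction ρV) (hW : IsCoaction ρW) :
    IsCoaction (tensorCoact ρV ρW) where
  coassoc := TensorProduct.ext' fun v w => by
    simp only [LinearMap.comp_apply, LinearEquiv.coe_coe]
    rw [← TensorProduct.mk_apply, mk_equivariant ρV ρW v w, assoc_tensorCoact, hV.coassoc_apply,
      hW.coassoc_apply, comul_map₂]
  counit x := by
    induction x with
    | zero => simp
    | add x y hx hy => rw [map_add, map_add, hx, hy, TensorProduct.add_tmul]
    | tmul v w =>
      rw [← TensorProduct.mk_apply, mk_equivariant ρV ρW v w, counit_map₂, hV.counit, hW.counit]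
      simp

/-- Associativity in the coefficients and in `H` together. Its use is for `(a b) ⊗ v = a (b ⊗ v)`,
to prove that the action on `A ⊗ V` is equivariant. -/
lemma map₂_assoc {X Y Z XY YZ U : Type u} [AddCommGroup X] [Module ℚ X] [AddCommGroup Y]
    [Module ℚ Y] [AddCommGroup Z] [Module ℚ Z] [AddCommGroup XY] [Module ℚ XY] [AddCommGroup YZ]
    [Module ℚ YZ] [AddCommGroup U] [Module ℚ U] (α : X →ₗ[ℚ] Y →ₗ[ℚ] XY) (β : XY →ₗ[ℚ] Z →ₗ[ℚ] U)
    (γ : Y →ₗ[ℚ] Z →ₗ[ℚ] YZ) (δ : X →ₗ[ℚ] YZ →ₗ[ℚ] U) (e : ∀ x y z, β (α x y) z = δ x (γ y z))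
    (x : X ⊗[ℚ] H) (y : Y ⊗[ℚ] H) (z : Z ⊗[ℚ] H) :
    TensorProduct.map₂ β (LinearMap.mul ℚ H) (TensorProduct.map₂ α (LinearMap.mul ℚ H) x y) z =
      TensorProduct.map₂ δ (LinearMap.mul ℚ H) x
        (TensorProduct.map₂ γ (LinearMap.mul ℚ H) y z) := by
  induction x with
  | zero => simp
  | add x₁ x₂ h₁ h₂ => simp only [map_add, LinearMap.add_apply, h₁, h₂]
  | tmul v h =>
    induction y with
    | zero => simp
    | add y₁ y₂ h₁ h₂ => simp only [map_add, LinearMap.add_apply, h₁, h₂]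
    | tmul w k =>
      induction z with
      | zero => simp
      | add y₁ y₂ h₁ h₂ => simp only [map_add, h₁, h₂]
      | tmul z l => simp [e, mul_assoc]

lemma rTensor_mem_range (f : V →ₗ[ℚ] W) (x : V ⊗[ℚ] H) :
    f.rTensor H x ∈ LinearMap.range ((LinearMap.range f).subtype.rTensor H) := by
  refine ⟨f.rangeRestrict.rTensor H x, ?_⟩
  rw [← LinearMap.rTensor_comp_apply]
  rfl

end TensorCoact

lemma iSupIndep_of_projections {V : Type*} [AddCommGroup V] [Module ℚ V] {S : ℤ → Submodule ℚ V}
    (π : ℤ → V →ₗ[ℚ] V) (h₁ : ∀ n, ∀ x ∈ S n, π n x = x)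
    (h₂ : ∀ n m, m ≠ n → ∀ x ∈ S m, π n x = 0) : iSupIndep S := by
  intro n
  rw [Submodule.disjoint_def]
  intro x hx hx'
  have : (⨆ j, ⨆ (_ : j ≠ n), S j) ≤ LinearMap.ker (π n) := iSup₂_le fun j hj x hx => h₂ n j hj x hx
  rw [← h₁ n x hx]
  exact this hx'

namespace DGModule

variable {V : Type u} [AddCommGroup V] [Module ℚ V]

/-- The subspace `A^p ⊗ V`. -/
noncomputable def freeDeg (A : Cdga H) (V : Type u) [AddCommGroup V] [Module ℚ V] (p : ℤ) :
    Submodule ℚ (A.carrier ⊗[ℚ] V) :=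
  LinearMap.range ((A.deg p).subtype.rTensor V)

lemma tmul_mem_freeDeg {p : ℤ} {a : A.carrier} (ha : a ∈ A.deg p) (v : V) :
    a ⊗ₜ v ∈ freeDeg A V p :=
  ⟨(⟨a, ha⟩ : A.deg p) ⊗ₜ v, rfl⟩

lemma freeDeg_le {p : ℤ} {T : Submodule ℚ (A.carrier ⊗[ℚ] V)} :
    freeDeg A V p ≤ T ↔ ∀ a ∈ A.deg p, ∀ v, a ⊗ₜ v ∈ T := by
  refine ⟨fun h a ha v => h (tmul_mem_freeDeg ha v), ?_⟩
  rintro h _ ⟨x, rfl⟩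
  induction x with
  | zero => simp
  | add x y hx hy => rw [map_add]; exact add_mem hx hy
  | tmul a v => exact h a a.2 v

lemma freeDeg_isInternal : DirectSum.IsInternal (freeDeg A V) := by
  rw [DirectSum.isInternal_submodule_iff_iSupIndep_and_iSup_eq_top]
  constructor
  -- The endomorphisms `π p ⊗ V`, with `π p` the projection of `A` to `A^p`, separate the subspaces
  -- `A^p ⊗ V`.
  · let π : ℤ → A.carrier →ₗ[ℚ] A.carrier := fun p =>
      (A.deg p).subtype ∘ₗ DirectSum.component ℚ ℤ (fun p => A.deg p) p ∘ₗ
        (DirectSum.decomposeLinearEquiv A.deg).toLinearMap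
    have hπ : ∀ n m, ∀ a ∈ A.deg m, π n a = if m = n then a else 0 := by
      intro n m a ha
      have : π n a = DirectSum.decompose A.deg a n := rfl
      rw [this, DirectSum.decompose_of_mem _ ha]
      split_ifs with h
      · subst h
        rw [DirectSum.of_eq_same]
      · rw [DirectSum.of_eq_of_ne _ _ _ (Ne.symm h)]
        rfl
    refine iSupIndep_of_projections (fun p => (π p).rTensor V) (fun n x hx => ?_)
      (fun n m h x hx => ?_)
    · refine (freeDeg_le (T := LinearMap.eqLocus ((π n).rTensor V) LinearMap.id)).2 ?_ hx
      intro a ha v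
      rw [LinearMap.mem_eqLocus, LinearMap.rTensor_tmul, hπ n n a ha, if_pos rfl,
        LinearMap.id_apply]
    · refine (freeDeg_le (T := LinearMap.ker ((π n).rTensor V))).2 ?_ hx
      intro a ha v
      rw [LinearMap.mem_ker, LinearMap.rTensor_tmul, hπ n m a ha, if_neg h, TensorProduct.zero_tmul]
  · rw [eq_top_iff]
    rintro x -
    induction x with
    | zero => exact zero_mem _
    | add x y hx hy => exact add_mem hx hy
    | tmul a v =>
      induction a using Cdga.induction with
      | zero => simp
      | add a b ha hb => rw [TensorProduct.add_tmul]; exact add_mem ha hb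
      | homogeneous p a ha => exact Submodule.mem_iSup_of_mem p (tmul_mem_freeDeg ha v)

lemma freeDeg_shift_isInternal (n : ℤ) :
    DirectSum.IsInternal (fun p => freeDeg A V (p + n)) :=
  shift_isInternal (V := A.carrier ⊗[ℚ] V) (S := freeDeg A V) freeDeg_isInternal n

/-- The action of `A` on `A ⊗ V`. -/
noncomputable def freeAct (A : Cdga H) (V : Type u) [AddCommGroup V] [Module ℚ V] :
    A.carrier →ₗ[ℚ] A.carrier ⊗[ℚ] V →ₗ[ℚ] A.carrier ⊗[ℚ] V :=
  LinearMap.rTensorHom V ∘ₗ LinearMap.mul ℚ A.carrier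

@[simp]
lemma freeAct_tmul (a b : A.carrier) (v : V) : freeAct A V a (b ⊗ₜ v) = (a * b) ⊗ₜ v := rfl

lemma freeAct_equivariant (ρV : V →ₗ[ℚ] V ⊗[ℚ] H) : IsEquivariant₂ A.coact (tensorCoact A.coact ρV)
    (tensorCoact A.coact ρV) (freeAct A V) := by
  intro a x
  induction x with
  | zero => simp
  | add x y hx hy => simp only [map_add, hx, hy]
  | tmul b v =>
    have h := map₂_assoc (H := H) (LinearMap.mul ℚ A.carrier) (TensorProduct.mk ℚ A.carrier V)
      (TensorProduct.mk ℚ A.carrier V) (freeAct A V)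
      (fun a b v => rfl) (A.coact a) (A.coact b) (ρV v)
    rw [← A.mul_equivariant, ← mk_equivariant A.coact ρV, ← mk_equivariant A.coact ρV] at h
    exact h

lemma freeD_equivariant (ρV : V →ₗ[ℚ] V ⊗[ℚ] H) : IsEquivariant (tensorCoact A.coact ρV)
    (tensorCoact A.coact ρV) (A.d.rTensor V) := by
  intro x
  induction x with
  | zero => simp
  | add x y hx hy => simp only [map_add, hx, hy]
  | tmul b v =>
    have h := map₂_natural (H := H) (TensorProduct.mk ℚ A.carrier V)
      (TensorProduct.mk ℚ A.carrier V) A.d LinearMap.id (A.d.rTensor V) (fun a v => rfl)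
      (A.coact b) (ρV v)
    rw [LinearMap.rTensor_id, LinearMap.id_apply, ← A.d_equivariant] at h
    exact h

/-- The coaction of `a ∈ A^p` comes from `z ∈ A^p ⊗ H`, so that of `a ⊗ v` comes from the product of
`z` and `ρV v` in `(A^p ⊗ V) ⊗ H`. -/
lemma freeDeg_isSubrep (ρV : V →ₗ[ℚ] V ⊗[ℚ] H) (p : ℤ) :
    IsSubrep (tensorCoact A.coact ρV) (freeDeg A V p) := by
  refine freeDeg_le (T := (LinearMap.range
    ((freeDeg A V p).subtype.rTensor H)).comap (tensorCoact A.coact ρV)) |>.2 fun a ha v => ?_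
  obtain ⟨z, hz⟩ := A.isSubrep_deg _ a ha
  have h := map₂_natural (H := H) (U := A.deg p ⊗[ℚ] V) (TensorProduct.mk ℚ (A.deg p) V)
    (TensorProduct.mk ℚ A.carrier V) (A.deg p).subtype LinearMap.id
    ((A.deg p).subtype.rTensor V) (by intros; rfl) z (ρV v)
  rw [LinearMap.rTensor_id, LinearMap.id_apply, hz] at h
  have h' := rTensor_mem_range (H := H) (V := A.deg p ⊗[ℚ] V) ((A.deg p).subtype.rTensor V)
    (TensorProduct.map₂ (TensorProduct.mk ℚ (A.deg p) V) (LinearMap.mul ℚ H) z (ρV v))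
  rw [← h] at h'
  exact h'

lemma mk_one_equivariant (ρV : V →ₗ[ℚ] V ⊗[ℚ] H) :
    IsEquivariant ρV (tensorCoact A.coact ρV) (TensorProduct.mk ℚ A.carrier V 1) := by
  intro v
  rw [mk_equivariant A.coact ρV, A.coact_one]
  generalize ρV v = x
  induction x with
  | zero => simp
  | add x y hx hy => rw [map_add, map_add, hx, hy]
  | tmul w k => simp

lemma freeAct_mem {p q : ℤ} {a : A.carrier} (ha : a ∈ A.deg p) {x : A.carrier ⊗[ℚ] V}
    (hx : x ∈ freeDeg A V q) : freeAct A V a x ∈ freeDeg A V (p + q) :=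
  freeDeg_le (T := (freeDeg A V (p + q)).comap (freeAct A V a)) |>.2
    (fun _ hb v => tmul_mem_freeDeg (Cdga.mul_mem ha hb) v) hx

lemma freeD_mem {p : ℤ} {x : A.carrier ⊗[ℚ] V} (hx : x ∈ freeDeg A V p) :
    A.d.rTensor V x ∈ freeDeg A V (p + 1) :=
  freeDeg_le (T := (freeDeg A V (p + 1)).comap (A.d.rTensor V)) |>.2
    (fun a ha v => tmul_mem_freeDeg (A.d_deg _ a ha) v) hx

lemma one_freeAct (x : A.carrier ⊗[ℚ] V) : freeAct A V 1 x = x := by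
  induction x with
  | zero => simp
  | add x y hx hy => rw [map_add, hx, hy]
  | tmul b v => simp

lemma mul_freeAct (a b : A.carrier) (x : A.carrier ⊗[ℚ] V) :
    freeAct A V (a * b) x = freeAct A V a (freeAct A V b x) := by
  induction x with
  | zero => simp
  | add x y hx hy => simp only [map_add, hx, hy]
  | tmul c v => simp only [freeAct_tmul, mul_assoc]

lemma freeD_freeD (x : A.carrier ⊗[ℚ] V) : A.d.rTensor V (A.d.rTensor V x) = 0 := by
  induction x with
  | zero => simp
  | add x y hx hy => rw [map_add, map_add, hx, hy, add_zero]
  | tmul b v => simp [A.d_d]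

lemma freeD_freeAct (p : ℤ) (a : A.carrier) (ha : a ∈ A.deg p) (x : A.carrier ⊗[ℚ] V) :
    A.d.rTensor V (freeAct A V a x) =
      freeAct A V (A.d a) x + (-1 : ℚ) ^ p • freeAct A V a (A.d.rTensor V x) := by
  induction x with
  | zero => simp
  | add x y hx hy => simp only [map_add, hx, hy, smul_add]; abel
  | tmul b v => simp [A.leibniz p a ha, TensorProduct.add_tmul, TensorProduct.smul_tmul']

/-- The free dg module `A[-n] ⊗ V` on a representation `V` in degree `n`. -/
noncomputable def free (A : Cdga H) {ρV : V →ₗ[ℚ] V ⊗[ℚ] H} (hV : IsCoaction ρV) (n : ℤ) :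
    DGModule A where
  carrier := A.carrier ⊗[ℚ] V
  deg p := freeDeg A V (p + -n)
  isInternal := freeDeg_shift_isInternal (-n)
  coact := tensorCoact A.coact ρV
  isCoaction := tensorCoact_isCoaction A.isCoaction hV
  isSubrep_deg p := freeDeg_isSubrep ρV (p + -n)
  act := freeAct A V
  act_equivariant := freeAct_equivariant ρV
  act_deg p q a ha x hx := by rw [add_assoc]; exact freeAct_mem ha hx
  one_act := one_freeAct
  mul_act := mul_freeAct
  d := A.d.rTensor V
  d_equivariant := freeD_equivariant ρV
  d_deg p x hx := by rw [add_right_comm]; exact freeD_mem hx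
  d_d := freeD_freeD
  leibniz := freeD_freeAct

end DGModule

open DGModule

namespace Cdga

/-- The Leibniz rule for `1 * 1` reads `d 1 = d 1 + d 1`. Hence the generators `1 ⊗ v` of a free
module are cycles. -/
lemma d_one (A : Cdga H) : A.d 1 = 0 := by
  have := A.leibniz 0 1 one_mem 1
  simpa using this

end Cdga

namespace CellStructure

variable {V : Type u} [AddCommGroup V] [Module ℚ V]

/-- The free module on a finite-dimensional representation has one cell. -/
noncomputable def free (A : Cdga H) [Module.Finite ℚ V] {ρV : V →ₗ[ℚ] V ⊗[ℚ] H}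
    (hV : IsCoaction ρV) (n : ℤ) : CellStructure (DGModule.free A hV n) PUnit.{u + 1} :=
  have h₁ : ∀ (a : A.carrier) (v : V), freeAct A V a (TensorProduct.mk ℚ A.carrier V 1 v) =
      a ⊗ₜ v := fun a v => congrArg (fun z => z ⊗ₜ[ℚ] v) (mul_one a)
  ofClosed (M := DGModule.free A hV n) (fun _ => n) (fun _ => V) (fun _ => ρV) (fun _ => hV)
    (fun _ => TensorProduct.mk ℚ A.carrier V 1)
    (fun _ => mk_one_equivariant ρV)
    (fun _ v => by
      have h : (1 : A.carrier) ∈ A.deg (n + -n) := by rw [add_neg_cancel]; exact Cdga.one_mem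
      exact tmul_mem_freeDeg h v)
    (by
      classical
      refine cellMap_bijective (M := DGModule.free A hV n)
        (DirectSum.lof ℚ PUnit.{u + 1} (fun _ => A.carrier ⊗[ℚ] V) PUnit.unit) ?_ ?_
      · intro j a v
        exact congrArg _ (h₁ a v)
      · intro x
        have hx : (x : A.carrier ⊗[ℚ] V) ∈ Submodule.span ℚ {t | ∃ a v, a ⊗ₜ[ℚ] v = t} := by
          rw [TensorProduct.span_tmul_eq_top]; trivial
        refine (Submodule.span_le (p := cellSpan (DGModule.free A hV n) _ _ _)).2 ?_ hx
        rintro _ ⟨a, v, rfl⟩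
        have := act_mem_cellSpan (M := DGModule.free A hV n)
          (b := fun _ : PUnit.{u + 1} => TensorProduct.mk ℚ A.carrier V 1)
          (Set.mem_univ PUnit.unit) a v
        rw [← h₁]
        exact this)
    (fun S hS j => hS j fun v => by
      have h : (DGModule.free A hV n).d (TensorProduct.mk ℚ A.carrier V 1 v) = 0 := by
        change (A.d 1) ⊗ₜ[ℚ] v = 0
        rw [A.d_one, TensorProduct.zero_tmul]
      exact h.symm.subst (motive := fun z => z ∈ cellSpan (DGModule.free A hV n) _ _ S)
        (zero_mem _))

end CellStructure

end RepDG

namespace RepDG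

variable {H : Type u} [CommRing H] [HopfAlgebra ℚ H] {A : Cdga H}

open DGModule

/-! ### Cell modules are orthogonal to acyclic modules -/

/-- Construction of a family by recursion along a rank function. -/
lemma exists_family_of_rank {J : Type*} {X : J → Type*} [∀ j, Nonempty (X j)] (r : J → ℕ)
    (R : ∀ j, X j → (∀ i, X i) → Prop)
    (hloc : ∀ j x s s', (∀ i, r i < r j → s i = s' i) → R j x s → R j x s')
    (hex : ∀ s j, (∀ i, r i < r j → R i (s i) s) → ∃ x, R j x s) : ∃ s, ∀ j, R j (s j) s := by
  classical
  -- Values at indices of rank at least `r j` are filled in arbitrarily; by `hloc` the condition at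
  -- `j` does not see them.
  let ext (j : J) (t : ∀ i, r i < r j → X i) : ∀ i, X i := fun i =>
    if h : r i < r j then t i h else Classical.arbitrary _
  -- A solution is known to exist only if the conditions of lower rank hold, so the recursion needs
  -- a default. The induction below shows that the default is never taken.
  let Φ (j : J) (t : ∀ i, r i < r j → X i) : X j :=
    if h : ∃ x, R j x (ext j t) then h.choose else Classical.arbitrary _
  let s : ∀ j, X j := (measure r).wf.fix Φ
  have hs : ∀ j, s j = Φ j fun i _ => s i := fun j => (measure r).wf.fix_eq Φ j
  have hext : ∀ j i, r i < r j → s i = ext j (fun i _ => s i) i := fun j i h =>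
    (dif_pos h : ext j (fun i _ => s i) i = s i).symm
  refine ⟨s, fun j => ?_⟩
  induction h : r j using Nat.strong_induction_on generalizing j with
  | _ n ih =>
    subst h
    obtain ⟨x, hx⟩ := hex s j fun i hi => ih _ hi i rfl
    have h1 : ∃ x, R j x (ext j fun i _ => s i) := ⟨x, hloc j x _ _ (hext j) hx⟩
    have h2 : s j = h1.choose := (hs j).trans (dif_pos h1)
    rw [h2]
    exact hloc j _ _ _ (fun i hi => (hext j i hi).symm) h1.choose_spec

namespace DGModule

/-- An arbitrary primitive shows that `x` lies in the sum of the subspaces `d (N^{k-1}) ⊆ N^k`; as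
`x` has degree `n`, it lies in the one with `k = n`. -/
lemma IsAcyclic.exists_homogeneous {N : DGModule A} (hN : IsAcyclic N) {n : ℤ} {x : N.carrier}
    (hx : x ∈ N.deg n) (h : N.d x = 0) : ∃ y ∈ N.deg (n + -1), N.d y = x := by
  obtain ⟨y, rfl⟩ := hN x h
  refine mem_of_mem_iSup (T := fun k => (N.deg (k + -1)).map N.d) N.iSupIndep_deg ?_ hx ?_
  · rintro k _ ⟨z, hz, rfl⟩
    have := N.d_deg _ z hz
    rwa [neg_add_cancel_right] at this
  · have h1 : ⨆ k, N.deg k ≤ (⨆ k, (N.deg (k + -1)).map N.d).comap N.d := by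
      refine iSup_le fun k z hz => Submodule.mem_iSup_of_mem (k + 1) ⟨z, ?_, rfl⟩
      rw [add_neg_cancel_right]
      exact hz
    exact h1 (by rw [iSup_deg]; trivial)

end DGModule

namespace CellStructure

variable {M : DGModule A} {J : Type u} (c : CellStructure M J)

open Classical in
/-- The first step of the filtration in which a cell occurs. -/
noncomputable def rank (j : J) : ℕ := Nat.find (c.fil_exhaustive j)

lemma d_mem_cellSpan_rank (j : J) (v : c.V j) :
    M.d (c.b j v) ∈ cellSpan M c.V c.b {i | c.rank i < c.rank j} := by
  classical
  have h1 : j ∈ c.fil (c.rank j) := Nat.find_spec (c.fil_exhaustive j)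
  obtain ⟨k, hk⟩ : ∃ k, c.rank j = k + 1 := by
    refine Nat.exists_eq_succ_of_ne_zero fun h0 => ?_
    rw [h0, c.fil_zero] at h1
    exact h1
  rw [hk] at h1 ⊢
  refine cellSpan_mono (fun i hi => ?_) (c.d_b k j h1 v)
  -- A cell in `fil k` has rank at most `k`, while `j` has rank `k + 1`; the rank of `j` is positive
  -- because `fil 0` is empty.
  exact Nat.lt_succ_of_le (Nat.find_min' (c.fil_exhaustive i) hi)

/-- Morphisms from a cell module to an acyclic module are nullhomotopic. -/
theorem homotopic_zero {M : DGModule A} {J : Type u} (c : CellStructure M J)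
    (hG : IsReductive H) {N : DGModule A} (hN : IsAcyclic N) (f : M ⟶ N) :
    homotopic A f 0 := by
  -- The possible restrictions of a homotopy to the cell `j`; each family of them extends to an
  -- element `h s` of `Hom_A(M, N)⁻¹`.
  let X (j : J) : Type u := {s : c.V j →ₗ[ℚ] N.carrier //
    IsEquivariant (c.coact j) N.coact s ∧ ∀ v, s v ∈ N.deg (c.n j + -1)}
  have hX : ∀ j, Nonempty (X j) := fun j => ⟨0, fun v => by simp, fun v => zero_mem _⟩
  let h (s : ∀ j, X j) : M.carrier →ₗ[ℚ] N.carrier := c.extend (-1) fun j => (s j).1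
  have hh : ∀ s, IsHom M N (-1) (h s) := fun s =>
    c.isHom_extend (fun j => (s j).2.1) fun j => (s j).2.2
  -- The condition is `d h + h d = f` on the cell `j`, solved for the new value. It is local because
  -- `d b_j` lies in the span of the cells of lower rank.
  obtain ⟨s, hs⟩ := exists_family_of_rank c.rank
    (fun j (x : X j) s => ∀ v, N.d (x.1 v) = f.lin (c.b j v) - h s (M.d (c.b j v)))
    (by
      intro j x s s' hss' hR v
      rw [hR v, (hh s).eq_of_mem_cellSpan (hh s') (fun i hi w => ?_) (c.d_mem_cellSpan_rank j v)]
      rw [c.extend_b, c.extend_b, hss' i hi])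
    (by
      intro s j hR
      have hb := (hh s).bracket
      -- For degree `-1` the bracket is `d h + h d`. By the conditions already met it equals `f` on
      -- the span of the lower cells, in particular on `d b_j`, where it reduces to `d (h (d b_j))`.
      have hcycle : ∀ v, N.d (f.lin (c.b j v) - h s (M.d (c.b j v))) = 0 := by
        intro v
        have := hb.eq_of_mem_cellSpan (f.isHom.of_eq (by simp)) (fun i hi w => by
          have h1 : h s (c.b i w) = (s i).1 w := c.extend_b _ _ i w
          have h2 := hR i hi w
          rw [← h1, eq_sub_iff_add_eq] at h2
          simpa using h2) (c.d_mem_cellSpan_rank j v)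
        simp only [LinearMap.sub_apply, LinearMap.comp_apply, LinearMap.smul_apply, M.d_d, map_zero,
          smul_zero, sub_zero] at this
        rw [map_sub, this, f.comm, sub_self]
      have hdeg : ∀ v, f.lin (c.b j v) - h s (M.d (c.b j v)) ∈ N.deg (c.n j) := by
        intro v
        have h1 := f.isHom.map_deg _ _ (c.b_deg j v)
        have h2 := (hh s).map_deg _ _ (M.d_deg _ _ (c.b_deg j v))
        rw [add_zero] at h1
        rw [add_neg_cancel_right] at h2
        exact sub_mem h1 h2
      have hu : IsEquivariant (c.coact j) N.coact
          (f.lin ∘ₗ c.b j + (-1 : ℚ) • h s ∘ₗ M.d ∘ₗ c.b j) :=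
        (IsEquivariant.comp f.isHom.equivariant (c.b_equivariant j)).add
          (IsEquivariant.smul (-1) (IsEquivariant.comp (hh s).equivariant
            (IsEquivariant.comp M.d_equivariant (c.b_equivariant j))))
      have hue : ∀ v, (f.lin ∘ₗ c.b j + (-1 : ℚ) • h s ∘ₗ M.d ∘ₗ c.b j) v =
          f.lin (c.b j v) - h s (M.d (c.b j v)) := by
        intro v
        simp [sub_eq_add_neg]
      -- The lift is taken through `d` restricted to the subrepresentation `N^{n_j - 1}`, so that
      -- the new value has the right degree.
      have hE := N.isSubrep_deg (c.n j + -1)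
      obtain ⟨σ, hσ, hσ'⟩ := hG.exists_lift (c.isCoaction j)
        (restrictCoact_isCoaction hE N.isCoaction)
        (IsEquivariant.comp N.d_equivariant (subtype_equivariant hE)) hu (fun v => by
          obtain ⟨y, hy, hy'⟩ := hN.exists_homogeneous (hdeg v) (hcycle v)
          exact ⟨⟨y, hy⟩, hy'.trans (hue v).symm⟩)
      exact ⟨⟨Submodule.subtype _ ∘ₗ σ, (subtype_equivariant hE).comp hσ, fun v => (σ v).2⟩,
        fun v => (hσ' v).trans (hue v)⟩)
  refine ⟨h s, hh s, fun m => ?_⟩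
  -- Both `d h + h d` and `f` are `A`-linear of degree `0`, and they agree on every cell.
  have h1 := c.hom_ext (hh s).bracket (f.isHom.of_eq (by simp)) (fun j v => by
    have h1 : h s (c.b j v) = (s j).1 v := c.extend_b _ _ j v
    have h2 := hs j v
    rw [← h1, eq_sub_iff_add_eq] at h2
    simpa using h2)
  have h2 := LinearMap.congr_fun h1 m
  rw [zero_lin, LinearMap.zero_apply, sub_zero, ← h2]
  simp

end CellStructure

end RepDG

namespace RepDG

variable {H : Type u} [CommRing H] [HopfAlgebra ℚ H] {A : Cdga H}

open DGModule

/-! ### Approximation by cell modules -/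

namespace DGModule

/-- The homogeneous cycles of degree `n`. -/
def cycles (N : DGModule A) (n : ℤ) : Submodule ℚ N.carrier :=
  (LinearMap.ker (N.d ∘ₗ (N.deg n).subtype)).map (N.deg n).subtype

lemma mem_cycles {N : DGModule A} {n : ℤ} {x : N.carrier} :
    x ∈ N.cycles n ↔ x ∈ N.deg n ∧ N.d x = 0 := by
  constructor
  · rintro ⟨⟨x, hx⟩, h, rfl⟩
    exact ⟨hx, h⟩
  · rintro ⟨hx, h⟩
    exact ⟨⟨x, hx⟩, h, rfl⟩

lemma isSubrep_cycles (N : DGModule A) (n : ℤ) : IsSubrep N.coact (N.cycles n) :=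
  (IsSubrep.ker (N.d_equivariant.comp (subtype_equivariant (N.isSubrep_deg n)))).map
    (subtype_equivariant (N.isSubrep_deg n))

/-- Since `d` is homogeneous, it commutes with taking components up to a shift of degree; the
components of a cycle are therefore cycles. -/
lemma ker_d_le_iSup_cycles (N : DGModule A) : LinearMap.ker N.d ≤ ⨆ n, N.cycles n := by
  classical
  intro x hx
  let := N.isInternal.chooseDecomposition
  have h : ∀ (y : N.carrier) (k : ℤ), N.d (DirectSum.decompose N.deg y k) =
      DirectSum.decompose N.deg (N.d y) (k + 1) := by
    intro y k
    induction y using DirectSum.Decomposition.inductionOn N.deg with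
    | zero => simp
    | add y z hy hz => simp [hy, hz]
    | @homogeneous j y =>
      have hy := N.d_deg j y y.2
      by_cases hj : j = k
      · subst hj
        rw [DirectSum.decompose_of_mem_same _ y.2, DirectSum.decompose_of_mem_same _ hy]
      · rw [DirectSum.decompose_of_mem_ne _ y.2 hj,
          DirectSum.decompose_of_mem_ne _ hy (by simpa using hj), map_zero]
  rw [← DirectSum.sum_support_decompose N.deg x]
  refine sum_mem fun k _ => Submodule.mem_iSup_of_mem k (mem_cycles.2 ⟨SetLike.coe_mem _, ?_⟩)
  rw [h, LinearMap.mem_ker.1 hx, DirectSum.decompose_zero]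
  rfl

end DGModule

/-- Local finiteness is applied inside `E`, with its restricted coaction, and the result is pushed
forward to `V`. -/
lemma exists_finite_subrep_le {V : Type u} [AddCommGroup V] [Module ℚ V]
    {ρ : V →ₗ[ℚ] V ⊗[ℚ] H} (hρ : IsCoaction ρ) {E : Submodule ℚ V} (hE : IsSubrep ρ E) {v : V}
    (hv : v ∈ E) : ∃ S ≤ E, Module.Finite ℚ S ∧ IsSubrep ρ S ∧ v ∈ S := by
  obtain ⟨S, h1, h2, h3⟩ := exists_finite_subrep_mem (restrictCoact_isCoaction hE hρ) ⟨v, hv⟩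
  exact ⟨S.map E.subtype, Submodule.map_subtype_le E S, Module.Finite.map S E.subtype,
    h2.map (subtype_equivariant hE), ⟨⟨v, hv⟩, h3, rfl⟩⟩

/-- Up to sign and shift, every dg module receives a morphism from a cell module which is surjective
on cycles. -/
lemma exists_cell_cover (N : DGModule A) : ∃ (F : DGModule A) (J : Type u)
    (_ : CellStructure F J) (ε : F.carrier →ₗ[ℚ] N.carrier), IsHom F N (-1) ε ∧
      (∀ x, N.d (ε x) + ε (F.d x) = 0) ∧ ∀ z, N.d z = 0 → ∃ x, F.d x = 0 ∧ ε x = z := by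
  classical
  -- All finite-dimensional subrepresentations of cycles are used at once, so no generators have to
  -- be chosen.
  let I : Type u := Σ n : ℤ, {S : Submodule ℚ N.carrier //
    S ≤ N.cycles n ∧ Module.Finite ℚ S ∧ IsSubrep N.coact S}
  have (i : I) : Module.Finite ℚ i.2.1 := i.2.2.2.1
  have hI (i : I) := restrictCoact_isCoaction i.2.2.2.2 N.isCoaction
  -- The cell for `S ⊆ N^n` sits in degree `n + 1`, because `ε` has degree `-1`.
  let c := CellStructure.directSum fun i : I => CellStructure.free A (hI i) (i.1 + 1)
  let ε := c.extend (N := N) (-1) fun x => x.1.2.1.subtype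
  have hε : IsHom _ N (-1) ε := c.isHom_extend
    (fun x => subtype_equivariant x.1.2.2.2.2)
    (fun x v => by
      have h : x.1.2.1.subtype v ∈ N.deg (x.1.1 + 1 + -1) := by
        rw [add_neg_cancel_right]
        exact (mem_cycles.1 (x.1.2.2.1 (Subtype.property (p := (· ∈ x.1.2.1)) v))).1
      exact h)
  have hb : ∀ x v, (DGModule.directSum _).d (c.b x v) = 0 := by
    rintro ⟨i, j⟩ v
    refine (sumD_lof _ i _).trans ?_
    have h : (DGModule.free A (hI i) (i.1 + 1)).d ((1 : A.carrier) ⊗ₜ[ℚ] v) = 0 := by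
      change (A.d 1) ⊗ₜ[ℚ] v = 0
      rw [A.d_one, TensorProduct.zero_tmul]
    exact (congrArg _ h).trans (map_zero _)
  have hεb : ∀ x v, ε (c.b x v) = x.1.2.1.subtype v := fun x v => c.extend_b _ _ x v
  refine ⟨_, _, c, ε, hε, fun x => ?_, ?_⟩
  -- The bracket of `ε` is `d ε + ε d`; it vanishes on the cells since these are cycles and go to
  -- cycles.
  · have h := c.hom_ext hε.bracket IsHom.zero (fun x v => by
      have h1 : N.d (ε (c.b x v)) = 0 := by
        rw [hεb]
        exact (mem_cycles.1 (x.1.2.2.1 (Subtype.property (p := (· ∈ x.1.2.1)) v))).2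
      simp [hb, h1])
    simpa using LinearMap.congr_fun h x
  -- By linearity only homogeneous cycles need preimages. Each lies in some `S` by local finiteness,
  -- and the corresponding element of the cell indexed by `S` is a cycle mapping to it.
  · suffices LinearMap.ker N.d ≤ (LinearMap.ker (DGModule.directSum _).d).map ε from
      fun z hz => this hz
    refine (ker_d_le_iSup_cycles N).trans (iSup_le fun n z hz => ?_)
    obtain ⟨S, h1, h2, h3, h4⟩ := exists_finite_subrep_le N.isCoaction (isSubrep_cycles N n) hz
    exact ⟨c.b ⟨⟨n, S, h1, h2, h3⟩, PUnit.unit⟩ (⟨z, h4⟩ : S), hb _ _, hεb _ _⟩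

namespace DGModule

/-- The morphism from a mapping cone defined by a morphism on the target and a homotopy. -/
def coneDesc {F P M : DGModule A} {g : F ⟶ P} (φ : P ⟶ M) (η : F.carrier →ₗ[ℚ] M.carrier)
    (hη : IsHom F M (-1) η) (h : ∀ x, M.d (η x) + φ.lin (g.lin x) + η (F.d x) = 0) :
    cone g ⟶ M where
  -- Hypothesis `h` says that `-η` is a nullhomotopy of the composite `g ≫ φ`, whence the minus
  -- sign.
  lin := φ.lin ∘ₗ LinearMap.fst ℚ P.carrier F.carrier - η ∘ₗ LinearMap.snd ℚ P.carrier F.carrier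
  isHom := (φ.isHom.comp (isHom_fst g) rfl).sub (hη.comp (isHom_snd g) rfl)
  comm := by
    rintro ⟨p, x⟩
    have h1 := h x
    have h2 : φ.lin (P.d p + g.lin x) - η (-F.d x) = M.d (φ.lin p - η x) := by
      rw [map_add, map_neg, φ.comm, map_sub, ← sub_eq_zero, ← h1]
      abel
    exact h2

end DGModule

/-- A cell module with a morphism to `M`. -/
structure CellOver (M : DGModule A) where
  obj : DGModule A
  J : Type u
  cell : CellStructure obj J
  map : obj ⟶ M

/-- Attaching cells along all cycles of the mapping cone. -/
lemma CellOver.exists_attach {M : DGModule A} (X : CellOver M) : ∃ (Y : CellOver M)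
    (i : X.obj ⟶ Y.obj), Function.Injective i.lin ∧ (∀ p, Y.map.lin (i.lin p) = X.map.lin p) ∧
      ∀ m p, X.obj.d p = 0 → M.d m + X.map.lin p = 0 →
        ∃ x, Y.obj.d x = i.lin p ∧ Y.map.lin x = -m := by
  -- Split `ε : F → Cone(X → M)` into components. As `d ε + ε d = 0`, the component in `X` is the
  -- attaching map `g`, a chain map, and the component in `M` is the homotopy that extends `X → M`
  -- over `Cone(g)`.
  obtain ⟨F, J, c, ε, hε, hd, hz⟩ := exists_cell_cover (cone X.map)
  let g : F ⟶ X.obj := ⟨LinearMap.snd ℚ M.carrier X.obj.carrier ∘ₗ ε, (isHom_snd X.map).comp hε rfl,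
    fun x => by
      have h : -X.obj.d (ε x).2 + (ε (F.d x)).2 = 0 := congrArg Prod.snd (hd x)
      exact (neg_add_eq_zero.1 h).symm⟩
  let ψ : cone g ⟶ M := coneDesc X.map (LinearMap.fst ℚ M.carrier X.obj.carrier ∘ₗ ε)
    ((isHom_fst X.map).comp hε rfl) fun x => congrArg Prod.fst (hd x)
  refine ⟨⟨cone g, _, CellStructure.cone c X.cell g, ψ⟩, coneInl g,
    LinearMap.inl_injective, fun p => ?_, fun m p hp hm => ?_⟩
  · have h : ψ.lin ((p, 0) : X.obj.carrier × F.carrier) = X.map.lin p - (ε 0).1 := rfl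
    rw [map_zero] at h
    exact h.trans (sub_zero _)
  -- The hypotheses say that `(m, p)` is a cycle of `Cone(X → M)`. If it is `ε x` with `d x = 0`,
  -- then `(0, x)` has boundary `(p, 0)` and image `-m`.
  · obtain ⟨x, hx, hx'⟩ := hz (m, p) (by
      rw [cone_d]
      exact Prod.ext hm (neg_eq_zero.2 hp))
    refine ⟨((0, x) : X.obj.carrier × F.carrier), ?_, ?_⟩
    · refine (cone_d g _).trans (Prod.ext ?_ ?_)
      · have h : X.obj.d 0 + (ε x).2 = p := by rw [hx', map_zero, zero_add]
        exact h
      · exact neg_eq_zero.2 hx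
    · have h : X.map.lin 0 - (ε x).1 = -m := by rw [hx', map_zero, zero_sub]
      exact h

end RepDG

namespace RepDG

variable {H : Type u} [CommRing H] [HopfAlgebra ℚ H] {A : Cdga H}

open DGModule

/-! ### Mapping telescopes -/

section Telescope

variable (P : ℕ → DGModule A) (i : ∀ k, P k ⟶ P (k + 1))

/-- The direct sum of a sequence of dg modules. -/
abbrev seqSum : DGModule A := DGModule.directSum fun k : ULift.{u} ℕ => P k.down

/-- The inclusion of a term of a sequence. -/
abbrev seqι (k : ℕ) : P k ⟶ seqSum P := directSumι (fun k : ULift.{u} ℕ => P k.down) ⟨k⟩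

/-- The projection to a term of a sequence. -/
abbrev seqπ (k : ℕ) : (seqSum P).carrier →ₗ[ℚ] (P k).carrier :=
  DirectSum.component ℚ (ULift.{u} ℕ) (fun k => (P k.down).carrier) ⟨k⟩

variable {P}

lemma seq_induction {p : (seqSum P).carrier → Prop} (x : (seqSum P).carrier) (zero : p 0)
    (ι : ∀ k m, p ((seqι P k).lin m)) (add : ∀ x y, p x → p y → p (x + y)) : p x :=
  sum_induction x zero (fun k m => ι k.down m) add

lemma seqπ_ι_self (k : ℕ) (m : (P k).carrier) : seqπ P k ((seqι P k).lin m) = m :=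
  DirectSum.component.lof_self ℚ (M := fun k : ULift.{u} ℕ => (P k.down).carrier) ⟨k⟩ m

lemma seqπ_ι_of_ne {k l : ℕ} (h : k ≠ l) (m : (P k).carrier) :
    seqπ P l ((seqι P k).lin m) = 0 :=
  (DirectSum.component.of ℚ (M := fun k : ULift.{u} ℕ => (P k.down).carrier) ⟨l⟩ ⟨k⟩ m).trans
    (dif_neg fun h' => h (congrArg ULift.down h'))

lemma seq_ext {x y : (seqSum P).carrier} (h : ∀ k, seqπ P k x = seqπ P k y) : x = y :=
  DirectSum.ext_component ℚ fun k => h k.down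

lemma exists_seqπ_eq_zero (x : (seqSum P).carrier) : ∃ N, ∀ k, N ≤ k → seqπ P k x = 0 := by
  induction x using seq_induction with
  | zero => exact ⟨0, fun k _ => map_zero _⟩
  | add x y hx hy =>
    obtain ⟨N, hN⟩ := hx
    obtain ⟨N', hN'⟩ := hy
    exact ⟨max N N', fun k hk => by
      rw [map_add, hN k (le_of_max_le_left hk), hN' k (le_of_max_le_right hk), add_zero]⟩
  | ι k m => exact ⟨k + 1, fun l hl => seqπ_ι_of_ne (by omega) m⟩

/-- The map `1 - S` on the sum of a sequence, where `S` consists of the transition maps. -/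
def seqDiff : seqSum P ⟶ seqSum P :=
  directSumDesc fun k : ULift.{u} ℕ => seqι P k.down - i k.down ≫ seqι P (k.down + 1)

@[simp]
lemma seqDiff_ι (k : ℕ) (m : (P k).carrier) :
    (seqDiff i).lin ((seqι P k).lin m) = (seqι P k).lin m - (seqι P (k + 1)).lin ((i k).lin m) := by
  refine (directSumDesc_lof (M := fun k : ULift.{u} ℕ => P k.down)
    (fun k => seqι P k.down - i k.down ≫ seqι P (k.down + 1)) ⟨k⟩ m).trans ?_
  rw [sub_lin]
  rfl

lemma seqπ_zero_seqDiff (x : (seqSum P).carrier) : seqπ P 0 ((seqDiff i).lin x) = seqπ P 0 x := by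
  induction x using seq_induction with
  | zero => rw [map_zero]
  | add x y hx hy => rw [map_add, map_add, map_add, hx, hy]
  | ι k m => rw [seqDiff_ι, map_sub, seqπ_ι_of_ne (Nat.succ_ne_zero k), sub_zero]

lemma seqπ_succ_seqDiff (n : ℕ) (x : (seqSum P).carrier) :
    seqπ P (n + 1) ((seqDiff i).lin x) = seqπ P (n + 1) x - (i n).lin (seqπ P n x) := by
  induction x using seq_induction with
  | zero => simp
  | add x y hx hy => simp only [map_add, hx, hy]; abel
  | ι k m =>
    rw [seqDiff_ι, map_sub]
    by_cases h : k = n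
    · subst h
      rw [seqπ_ι_self, seqπ_ι_self]
    · rw [seqπ_ι_of_ne h, seqπ_ι_of_ne (by omega : k + 1 ≠ n + 1), map_zero, sub_zero]

/-- Elements `y` of the sum of a sequence of injections for which `(1 - S) y` is concentrated in a
single spot vanish. -/
lemma eq_zero_of_seqDiff_eq_ι (hi : ∀ k, Function.Injective (i k).lin) {y : (seqSum P).carrier}
    {N : ℕ} {e : (P N).carrier} (h : (seqDiff i).lin y = (seqι P N).lin e) : y = 0 := by
  -- Comparing components in degree `k + 1` of the sequence, away from the spot `N`.
  have h0 : ∀ k, N ≠ k + 1 → seqπ P (k + 1) y = (i k).lin (seqπ P k y) := by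
    intro k hk
    have := seqπ_succ_seqDiff i k y
    rw [h, seqπ_ι_of_ne hk] at this
    exact (sub_eq_zero.1 this.symm)
  -- Below `N` the components vanish upwards from `y_0 = 0`.
  have h1 : ∀ k, k < N → seqπ P k y = 0 := by
    intro k hk
    induction k with
    | zero =>
      have := seqπ_zero_seqDiff i y
      rwa [h, seqπ_ι_of_ne (by omega), eq_comm] at this
    | succ k ih => rw [h0 k (by omega), ih (by omega), map_zero]
  obtain ⟨K, hK⟩ := exists_seqπ_eq_zero y
  -- From `N` on, injectivity propagates vanishing downwards from a bound `K` beyond which `y` has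
  -- no components; `j` bounds the distance to `K`.
  have h2 : ∀ j k, N ≤ k → K ≤ k + j → seqπ P k y = 0 := by
    intro j
    induction j with
    | zero => exact fun k _ hk => hK k hk
    | succ j ih =>
      intro k hk hk'
      refine hi k ?_
      rw [← h0 k (by omega), ih (k + 1) (by omega) (by omega), map_zero]
  refine seq_ext fun k => ?_
  rw [map_zero]
  by_cases hk : k < N
  · exact h1 k hk
  · exact h2 K k (by omega) (by omega)

/-- Modulo the image of `1 - S`, an element of the sum is concentrated in a single spot. -/
lemma exists_eq_seqDiff_add_ι (x : (seqSum P).carrier) : ∃ N, ∀ k, N ≤ k → ∃ w p,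
    x = (seqDiff i).lin w + (seqι P k).lin p := by
  induction x using seq_induction with
  | zero => exact ⟨0, fun k _ => ⟨0, 0, by simp only [map_zero, add_zero]⟩⟩
  | add x y hx hy =>
    obtain ⟨N, hN⟩ := hx
    obtain ⟨N', hN'⟩ := hy
    -- The statement is for all large `k` so that two elements can be moved to a common spot and
    -- added.
    refine ⟨max N N', fun k hk => ?_⟩
    obtain ⟨w, p, h⟩ := hN k (le_of_max_le_left hk)
    obtain ⟨w', p', h'⟩ := hN' k (le_of_max_le_right hk)
    exact ⟨w + w', p + p', by simp only [map_add]; rw [h, h']; abel⟩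
  | ι n m =>
    refine ⟨n, fun k hk => ?_⟩
    induction k, hk using Nat.le_induction with
    | base => exact ⟨0, m, by simp only [map_zero, zero_add]⟩
    | succ k _ ih =>
      obtain ⟨w, p, h⟩ := ih
      -- An element at spot `k` equals `1 - S` of itself plus its transition to spot `k + 1`.
      refine ⟨w + (seqι P k).lin p, (i k).lin p, ?_⟩
      rw [map_add, seqDiff_ι, h]
      abel

variable {M : DGModule A} {i} (φ : ∀ k, P k ⟶ M)

/-- The morphism from the sum of a sequence defined by morphisms on its terms. -/
def seqDesc : seqSum P ⟶ M := directSumDesc fun k : ULift.{u} ℕ => φ k.down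

@[simp]
lemma seqDesc_ι (k : ℕ) (m : (P k).carrier) : (seqDesc φ).lin ((seqι P k).lin m) = (φ k).lin m :=
  directSumDesc_lof (M := fun k : ULift.{u} ℕ => P k.down) (fun k => φ k.down) ⟨k⟩ m

variable {φ} (hφ : ∀ k p, (φ (k + 1)).lin ((i k).lin p) = (φ k).lin p)
include hφ

lemma seqDesc_seqDiff (x : (seqSum P).carrier) : (seqDesc φ).lin ((seqDiff i).lin x) = 0 := by
  induction x using seq_induction with
  | zero => simp only [map_zero]
  | add x y hx hy => simp only [map_add, hx, hy, add_zero]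
  | ι k m => rw [seqDiff_ι, map_sub, seqDesc_ι, seqDesc_ι, hφ, sub_self]

/-- The morphism from the mapping telescope of a sequence defined by compatible morphisms on its
terms. -/
def telescopeDesc : cone (seqDiff i) ⟶ M :=
  coneDesc (seqDesc φ) 0 IsHom.zero fun x => by
    rw [seqDesc_seqDiff hφ]
    simp

lemma telescopeDesc_lin (x y : (seqSum P).carrier) :
    (telescopeDesc hφ).lin ((x, y) : (seqSum P).carrier × (seqSum P).carrier) =
      (seqDesc φ).lin x :=
  sub_zero _

/-- Hypothesis `h` says that every cycle `(m, p)` of `Cone(φ k)` becomes a boundary in the next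
cone. A class of the telescope can be moved to one stage `N`; if it dies in `M`, then it dies at
stage `N + 1`. Every class of `M` is already hit at stage `1`. -/
lemma telescopeDesc_isQuasiIso (hi : ∀ k, Function.Injective (i k).lin)
    (h : ∀ k m p, (P k).d p = 0 → M.d m + (φ k).lin p = 0 →
      ∃ x, (P (k + 1)).d x = (i k).lin p ∧ (φ (k + 1)).lin x = -m) :
    IsQuasiIso (telescopeDesc hφ) := by
  rw [isQuasiIso_iff]
  constructor
  · rintro ⟨x, y⟩ hxy m hm
    rw [telescopeDesc_lin] at hm
    rw [cone_d, Prod.mk_eq_zero, neg_eq_zero] at hxy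
    obtain ⟨N, hN⟩ := exists_eq_seqDiff_add_ι i x
    obtain ⟨w, p, hx⟩ := hN N le_rfl
    -- Subtracting the boundary of `(0, w)` turns `(x, y)` into `(ι_N p, y + d w)`. Being a cycle,
    -- it satisfies this equation, and injectivity of the transitions forces `y + d w = 0`.
    have h1 : (seqDiff i).lin (y + (seqSum P).d w) = (seqι P N).lin (-(P N).d p) := by
      have h2 := hxy.1
      dsimp only at h2
      rw [hx, map_add, ← (seqDiff i).comm, ← (seqι P N).comm] at h2
      rw [map_add, map_neg, eq_neg_iff_add_eq_zero, ← h2]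
      abel
    have h2 := eq_zero_of_seqDiff_eq_ι i hi h1
    rw [h2, map_zero, map_neg, zero_eq_neg] at h1
    have h3 : (P N).d p = 0 := by
      rw [← seqπ_ι_self N ((P N).d p), h1, map_zero]
    have h4 : M.d (-m) + (φ N).lin p = 0 := by
      rw [map_neg, hm, hx, map_add, seqDesc_seqDiff hφ, seqDesc_ι, zero_add, neg_add_cancel]
    obtain ⟨r, hr, -⟩ := h N (-m) p h3 h4
    -- The term `ι_N p` in the second component moves `p` to spot `N + 1`, where `d r` cancels it.
    refine ⟨((seqι P (N + 1)).lin r, w + (seqι P N).lin p), ?_⟩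
    rw [cone_d]
    refine Prod.ext ?_ ?_
    · dsimp only
      rw [← (seqι P (N + 1)).comm, hr, map_add, seqDiff_ι, hx]
      abel
    · dsimp only
      rw [map_add, ← (seqι P N).comm, h3, map_zero, add_zero]
      exact neg_eq_of_add_eq_zero_left h2
  · intro m hm
    -- Apply `h` to the cycle `(-m, 0)`: this gives a cycle of `P 1` mapping to `m`.
    obtain ⟨x, hx, hx'⟩ := h 0 (-m) 0 (map_zero _) (by rw [map_neg, hm, map_zero, neg_zero, add_zero])
    refine ⟨((seqι P 1).lin x, 0), 0, ?_, ?_⟩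
    · rw [cone_d]
      refine Prod.ext ?_ ?_
      · dsimp only
        rw [← (seqι P 1).comm, hx, map_zero, map_zero, map_zero, add_zero]
        rfl
      · dsimp only
        rw [map_zero, neg_zero]
        rfl
    · rw [telescopeDesc_lin, seqDesc_ι, hx', neg_neg, map_zero, add_zero]

end Telescope

/-- Every dg module is quasi-isomorphic to a cell module. -/
theorem exists_cell_approximation (M : DGModule A) : ∃ X : CellOver M, IsQuasiIso X.map := by
  choose next i hi hφ h using fun X : CellOver M => X.exists_attach
  -- Every stage is obtained by attaching cells to the previous one, starting from the zero module.
  let X : ℕ → CellOver M := fun k => next^[k] ⟨zeroModule A, _, CellStructure.zero A, 0⟩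
  have hX : ∀ k, X (k + 1) = next (X k) := fun k => Function.iterate_succ_apply' _ _ _
  have hex : ∀ k, ∃ i : (X k).obj ⟶ (X (k + 1)).obj, Function.Injective i.lin ∧
      (∀ p, (X (k + 1)).map.lin (i.lin p) = (X k).map.lin p) ∧
      ∀ m p, (X k).obj.d p = 0 → M.d m + (X k).map.lin p = 0 →
        ∃ x, (X (k + 1)).obj.d x = i.lin p ∧ (X (k + 1)).map.lin x = -m := by
    intro k
    rw [hX k]
    exact ⟨i _, hi _, hφ _, h _⟩
  choose j hj hφj hh using hex
  let c := CellStructure.directSum fun k : ULift.{u} ℕ => (X k.down).cell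
  exact ⟨⟨_, _, CellStructure.cone c c (seqDiff j), telescopeDesc hφj⟩,
    telescopeDesc_isQuasiIso hφj hj hh⟩

end RepDG

namespace RepDG

variable {H : Type u} [CommRing H] [HopfAlgebra ℚ H] {A : Cdga H}

open DGModule HoCat

/-! ### Cell modules in the homotopy category and in the derived category -/

namespace HoCat

lemma shift_quot_obj (M : DGModule A) (n : ℤ) :
    ((quot A).obj M)⟦n⟧ = (quot A).obj (M.shift n) :=
  Quotient.functor_obj_shift _ _ M n

/-- A property of dg modules which holds for the zero module and is stable under shifts and mapping
cones defines a triangulated subcategory of the homotopy category. -/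
lemma isTriangulated_of_closed (P : ObjectProperty (HoCat A)) (h₀ : P ((quot A).obj (zeroModule A)))
    (hshift : ∀ M n, P ((quot A).obj M) → P ((quot A).obj (M.shift n)))
    (hcone : ∀ M N (f : M ⟶ N), P ((quot A).obj M) → P ((quot A).obj N) →
      P ((quot A).obj (cone f))) : P.IsTriangulated :=
  have : P.IsStableUnderShift ℤ := ⟨fun n => ⟨by
    rintro ⟨M⟩ hM
    have := hshift M n hM
    rw [← shift_quot_obj] at this
    exact this⟩⟩
  -- A distinguished triangle is determined up to isomorphism by its first map, so its third object
  -- is the cone of any representative. This is membership up to isomorphism; together with shifts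
  -- it yields stability under extensions.
  have : P.IsTriangulatedClosed₃ := ⟨by
    intro T hT h₁ h₂
    obtain ⟨f, hf⟩ := (quot A).map_surjective (X := T.obj₁.as) (Y := T.obj₂.as) T.mor₁
    refine ⟨_, hcone _ _ f h₁ h₂, ⟨Triangle.π₃.mapIso (isoTriangleOfIso₁₂ _ _ hT
      (coneTri_distinguished f) (Iso.refl _) (Iso.refl _) ?_)⟩⟩
    refine (Category.comp_id _).trans (Eq.trans ?_ (Category.id_comp _).symm)
    exact hf.symm⟩
  { exists_zero := ⟨_, (quot A).map_isZero isZero_zeroModule, h₀⟩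
    toIsTriangulatedClosed₂ := .of_isTriangulatedClosed₃ }

variable (A) in
instance : (cell A).IsTriangulated :=
  isTriangulated_of_closed _ ⟨_, ⟨CellStructure.zero A⟩⟩
    (fun _ n ⟨_, ⟨c⟩⟩ => ⟨_, ⟨c.shift n⟩⟩)
    (fun _ _ f ⟨_, ⟨c⟩⟩ ⟨_, ⟨e⟩⟩ => ⟨_, ⟨c.cone e f⟩⟩)

variable (A) in
instance : (finCell A).IsTriangulated :=
  isTriangulated_of_closed _ ⟨_, inferInstance, ⟨CellStructure.zero A⟩⟩
    (fun _ n ⟨_, h, ⟨c⟩⟩ => ⟨_, h, ⟨c.shift n⟩⟩)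
    (fun _ _ f ⟨_, _, ⟨c⟩⟩ ⟨_, _, ⟨e⟩⟩ => ⟨_, inferInstance, ⟨c.cone e f⟩⟩)

lemma finCell_le_cell : finCell A ≤ cell A := fun _ ⟨J, _, hJ⟩ => ⟨J, hJ⟩

lemma cell_le_leftOrthogonal (hG : IsReductive H) : cell A ≤ (acyclic A).leftOrthogonal := by
  rintro ⟨M⟩ ⟨J, ⟨c⟩⟩ ⟨N⟩ φ (hN : IsAcyclic N)
  obtain ⟨f, rfl⟩ := (quot A).map_surjective (X := M) (Y := N) φ
  rw [← (quot A).map_zero, quot_eq_iff]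
  exact c.homotopic_zero hG hN f

/-- Presents the derived category as the Verdier quotient by acyclic modules, so that orthogonality
to these controls morphisms. -/
instance : (DerCat.Q A).IsLocalization (acyclic A).trW := by
  rw [← qis_eq]
  infer_instance

/-- The localization functor is fully faithful on cell modules. -/
lemma map_Q_bijective (hG : IsReductive H) {X : HoCat A} (hX : cell A X) (Y : HoCat A) :
    Function.Bijective ((DerCat.Q A).map : (X ⟶ Y) → _) :=
  -- A quasi-isomorphism `X' → X` has acyclic cone, so `X → Cone` is zero and `X' → X` has a
  -- section. Thus fractions out of `X` reduce to actual morphisms.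
  ObjectProperty.leftOrthogonal.map_bijective_of_isTriangulated (cell_le_leftOrthogonal hG X hX) _ Y

lemma exists_cell_iso (Y : DerCat A) : ∃ X, cell A X ∧ Nonempty ((DerCat.Q A).obj X ≅ Y) := by
  let X := (DerCat.Q A).objPreimage Y
  obtain ⟨P, hP⟩ := exists_cell_approximation X.as
  have : IsIso ((DerCat.Q A).map ((quot A).map P.map : _ ⟶ X)) :=
    Localization.inverts (DerCat.Q A) (qis A) _ ⟨P.map, rfl, hP⟩
  exact ⟨_, ⟨_, ⟨P.cell⟩⟩, ⟨asIso ((DerCat.Q A).map ((quot A).map P.map : _ ⟶ X)) ≪≫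
    (DerCat.Q A).objObjPreimageIso Y⟩⟩

lemma full_and_faithful_of_le_cell (hG : IsReductive H) {P : ObjectProperty (HoCat A)}
    (hP : P ≤ cell A) : (P.ι ⋙ DerCat.Q A).Full ∧ (P.ι ⋙ DerCat.Q A).Faithful := by
  constructor
  · refine ⟨fun {X Y} g => ?_⟩
    obtain ⟨f, hf⟩ := (map_Q_bijective hG (hP _ X.property) Y.obj).2 g
    obtain ⟨f', rfl⟩ := P.ι.map_surjective f
    exact ⟨f', hf⟩
  · refine ⟨fun {X Y} f g h => P.ι.map_injective ?_⟩
    exact (map_Q_bijective hG (hP _ X.property) Y.obj).1 h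

lemma cellFunctor_isEquivalence (hG : IsReductive H) : (cellFunctor A).IsEquivalence := by
  obtain ⟨h₁, h₂⟩ := full_and_faithful_of_le_cell hG (le_refl (cell A))
  have : (cellFunctor A).EssSurj := ⟨fun Y => by
    obtain ⟨X, hX, ⟨e⟩⟩ := exists_cell_iso Y
    exact ⟨⟨X, hX⟩, ⟨e⟩⟩⟩
  exact {}

lemma finDer_eq : finDer A = ((finCell A).ι ⋙ DerCat.Q A).essImage := by
  ext Y
  constructor
  · rintro ⟨X, hX, ⟨e⟩⟩
    exact ⟨⟨X, hX⟩, ⟨e.symm⟩⟩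
  · rintro ⟨X, ⟨e⟩⟩
    exact ⟨X.obj, X.property, ⟨e.symm⟩⟩

/-- Fullness is what makes the essential image of an exact functor triangulated: a morphism between
images lifts, and the image of a cone of the lift is a cone of the morphism. -/
lemma finDer_isTriangulated (hG : IsReductive H) : (finDer A).IsTriangulated := by
  have := (full_and_faithful_of_le_cell hG (finCell_le_cell (A := A))).1
  rw [finDer_eq]
  infer_instance

/-- The shift structure on `finCellFunctor A` was induced from the composite with the inclusion of
`finDer A`; hence `e` is compatible with shifts and exactness can be tested after that inclusion. -/
lemma finCellFunctor_isTriangulated [(finDer A).IsTriangulated] :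
    (finCellFunctor A).IsTriangulated := by
  let e : finCellFunctor A ⋙ (finDer A).ι ≅ (finCell A).ι ⋙ DerCat.Q A :=
    (finDer A).liftCompιIso ((finCell A).ι ⋙ DerCat.Q A) fun X =>
      ⟨X.obj, X.property, ⟨Iso.refl _⟩⟩
  have : NatTrans.CommShift e.hom ℤ := Functor.CommShift.ofComp_compatibility e ℤ
  exact (Functor.isTriangulated_iff_comp_right e).2 inferInstance

lemma finCellFunctor_isEquivalence (hG : IsReductive H) : (finCellFunctor A).IsEquivalence := by
  obtain ⟨h₁, h₂⟩ := full_and_faithful_of_le_cell hG (finCell_le_cell (A := A))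
  have : (finCellFunctor A).EssSurj := ⟨by
    rintro ⟨Y, X, hX, ⟨e⟩⟩
    exact ⟨⟨X, hX⟩, ⟨(finDer A).ι.preimageIso e.symm⟩⟩⟩
  have h₁ : (finCellFunctor A ⋙ (finDer A).ι).Full := h₁
  have h₂ : (finCellFunctor A ⋙ (finDer A).ι).Faithful := h₂
  have : (finCellFunctor A).Full :=
    Functor.Full.of_comp_faithful (finCellFunctor A) (finDer A).ι
  have : (finCellFunctor A).Faithful :=
    Functor.Faithful.of_comp (finCellFunctor A) (finDer A).ι
  exact {}

end HoCat

end RepDG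

theorem mainTheorem5 (H : Type u) [CommRing H] [HopfAlgebra ℚ H] (hG : RepDG.IsReductive H)
    (A : RepDG.Cdga H) :
    (∃ _ : (RepDG.cell A).IsTriangulated,
      (RepDG.cellFunctor A).IsTriangulated ∧ (RepDG.cellFunctor A).IsEquivalence) ∧
    (∃ (_ : (RepDG.finCell A).IsTriangulated) (_ : (RepDG.finDer A).IsTriangulated),
      (RepDG.finCellFunctor A).IsTriangulated ∧ (RepDG.finCellFunctor A).IsEquivalence) := by
  have := RepDG.HoCat.finDer_isTriangulated (A := A) hG
  exact ⟨⟨inferInstance, inferInstance, RepDG.HoCat.cellFunctor_isEquivalence hG⟩,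
    ⟨inferInstance, this, RepDG.HoCat.finCellFunctor_isTriangulated,
      RepDG.HoCat.finCellFunctor_isEquivalence hG⟩⟩
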